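/- Let $k$ be a commutative ring, let $A$ and $B$ be associative unital $k$-algebras, let $\mathfrak C$ be an $A$-coring and $\mathfrak D$ a $B$-coring ($k$ acts centrally on all bimodules). Write $\mathcal M^{\mathfrak C}$ for the $k$-linear category of right $\mathfrak C$-comodules, and ${}^{\mathfrak C}\mathcal M$, ${}^{\mathfrak C}\mathcal M^{\mathfrak D}$ for the categories of left $\mathfrak C$-comodules and of $\mathfrak C$-$\mathfrak D$-bicomodules. For $X\in\mathcal M^{\mathfrak C}$ with coaction $\rho_X$ and $M\in{}^{\mathfrak C}\mathcal M^{\mathfrak D}$ with left coaction $\lambda_M$, the cotensor product $X\square_{\mathfrak C}M$ is the kernel of $\omega_{X,M}=\rho_X\otimes_A M-X\otimes_A\lambda_M: X\otimes_A M\to X\otimes_A\mathfrak C\otimes_A M$. If, for every $X$, the functor $-\otimes_B\mathfrak D$ preserves this kernel and $(X\square_{\mathfrak C}M)\otimes_B\mathfrak D\otimes_B\mathfrak D\to X\otimes_A M\otimes_B\mathfrak D\otimes_B\mathfrak D$ is injective, then the right $\mathfrak D$-coaction of $X\otimes_AM$ restricts to $X\square_{\mathfrak C}M$, and we say that the functor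 $-\square_{\mathfrak C}M:\mathcal M^{\mathfrak C}\to\mathcal M^{\mathfrak D}$ is well defined. The bicomodule $M$ is coflat in ${}^{\mathfrak C}\mathcal M$ if $-\square_{\mathfrak C}M$ is exact as a functor from $\mathcal M^{\mathfrak C}$ to $k$-modules. The coring $\mathfrak C$ is coseparable if its comultiplication is a split monomorphism of $\mathfrak C$-bicomodules. Inductive limits are arbitrary small colimits, direct limits are filtered colimits, and exact (left exact) functors preserve finite limits and finite colimits (finite limits). In each of parts 1--3, under the stated hypotheses on the rings, corings and categories, $-\square_{\mathfrak C}M:\mathcal M^{\mathfrak C}\to\mathcal M^{\mathfrak D}$ is well defined for every $M\in{}^{\mathfrak C}\mathcal M^{\mathfrak D}$. Moreover, for every $k$-linear functor $F:\mathcal M^{\mathfrak C}\to\mathcal M^{\mathfrak D}$ the following hold. 1. If ${}_B\mathfrak D$ is flat and $A$ is a semisimple ring (resp. a von Neumann regular ring), then the following are equivalent: (a) $F$ is left exact and preserves coproducts (resp. is left exact and preserves direct limits); (b) $F\simeq-\square_{\mathfrak C}M$ for some bicomodule $M\in{}^{\mathfrak C}\mathcal M^{\mathfrak D}$. 2. If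 ${}_A\mathfrak C$ and ${}_B\mathfrak D$ are flat, then the following are equivalent: (a) $F$ is exact and preserves inductive limits; (b) $F\simeq-\square_{\mathfrak C}M$ for some bicomodule $M\in{}^{\mathfrak C}\mathcal M^{\mathfrak D}$ which is coflat in ${}^{\mathfrak C}\mathcal M$. 3. If $\mathfrak C$ is coseparable and the categories $\mathcal M^{\mathfrak C}$ and $\mathcal M^{\mathfrak D}$ are abelian, then the following are equivalent: (a) $F$ preserves inductive limits; (b) $F$ preserves cokernels and $F\simeq-\square_{\mathfrak C}M$ for some bicomodule $M\in{}^{\mathfrak C}\mathcal M^{\mathfrak D}$. 4. If $\mathfrak C=A$ is the trivial $A$-coring and the category $\mathcal M^{\mathfrak D}$ is abelian, then the following are equivalent: (a) $F$ has a right adjoint; (b) $F$ preserves inductive limits; (c) $F\simeq-\otimes_A M$ for some bicomodule $M\in{}^A\mathcal M^{\mathfrak D}$. -/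

import Mathlib

open CategoryTheory Limits MulOpposite
open scoped TensorProduct

universe u

namespace Corings

/-! ### The tensor product over a noncommutative ring

A right `R`-module is a module over the opposite ring `Rᵐᵒᵖ`; `op r • x` is `x · r`. -/

section Balanced

variable (R : Type u) [Ring R] (X Y : Type u) [AddCommGroup X] [Module Rᵐᵒᵖ X]
  [AddCommGroup Y] [Module R Y]

/-- The relations `(x r) ⊗ y = x ⊗ (r y)`. -/
def balancedRel : AddSubgroup (X ⊗[ℤ] Y) :=
  AddSubgroup.closure {t | ∃ (x : X) (r : R) (y : Y), t = (op r • x) ⊗ₜ[ℤ] y - x ⊗ₜ[ℤ] (r • y)}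

/-- The tensor product `X ⊗_R Y` of a right `R`-module and a left `R`-module. -/
def BalTensor : Type u := (X ⊗[ℤ] Y) ⧸ balancedRel R X Y

instance : AddCommGroup (BalTensor R X Y) :=
  inferInstanceAs (AddCommGroup ((X ⊗[ℤ] Y) ⧸ balancedRel R X Y))

end Balanced

/-- A biadditive map from a function. -/
def mkBiadd {X Y P : Type u} [AddCommGroup X] [AddCommGroup Y] [AddCommGroup P] (f : X → Y → P)
    (h₁ : ∀ x x' y, f (x + x') y = f x y + f x' y)
    (h₂ : ∀ x y y', f x (y + y') = f x y + f x y') : X →+ Y →+ P :=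
  AddMonoidHom.mk' (fun x => AddMonoidHom.mk' (f x) (h₂ x))
    (fun x x' => by ext y; exact h₁ x x' y)

namespace BalTensor

section

variable {R : Type u} [Ring R] {X Y : Type u} [AddCommGroup X] [Module Rᵐᵒᵖ X]
  [AddCommGroup Y] [Module R Y]

variable (R) in
/-- The pure tensor `x ⊗ y` in `X ⊗_R Y`. -/
def tmul (x : X) (y : Y) : BalTensor R X Y := QuotientAddGroup.mk (x ⊗ₜ[ℤ] y)

theorem tmul_add (x : X) (y y' : Y) : tmul R x (y + y') = tmul R x y + tmul R x y' := by
  unfold tmul; rw [TensorProduct.tmul_add]; rfl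

theorem add_tmul (x x' : X) (y : Y) : tmul R (x + x') y = tmul R x y + tmul R x' y := by
  unfold tmul; rw [TensorProduct.add_tmul]; rfl

theorem smul_tmul (r : R) (x : X) (y : Y) : tmul R (op r • x) y = tmul R x (r • y) := by
  refine (QuotientAddGroup.eq_iff_sub_mem (N := balancedRel R X Y)).2 ?_
  exact AddSubgroup.subset_closure ⟨x, r, y, rfl⟩

@[elab_as_elim]
theorem induction_on {p : BalTensor R X Y → Prop} (t : BalTensor R X Y)
    (tmul : ∀ x y, p (tmul R x y)) (zero : p 0) (add : ∀ s t, p s → p t → p (s + t)) : p t := by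
  obtain ⟨t, rfl⟩ := QuotientAddGroup.mk_surjective (s := balancedRel R X Y) t
  induction t using TensorProduct.induction_on with
  | zero => exact zero
  | tmul x y => exact tmul x y
  | add s t hs ht => exact add _ _ hs ht

/-- The universal property of `X ⊗_R Y`. -/
def lift {P : Type u} [AddCommGroup P] (f : X →+ Y →+ P)
    (h : ∀ (r : R) x y, f (op r • x) y = f x (r • y)) : BalTensor R X Y →+ P :=
  QuotientAddGroup.lift (balancedRel R X Y)
    (TensorProduct.liftAddHom f (fun z x y => by simp))
    (by
      refine (AddSubgroup.closure_le _).2 ?_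
      rintro _ ⟨x, r, y, rfl⟩
      simp [h])

@[simp] theorem lift_tmul {P : Type u} [AddCommGroup P] (f : X →+ Y →+ P)
    (h : ∀ (r : R) x y, f (op r • x) y = f x (r • y)) (x : X) (y : Y) :
    lift f h (tmul R x y) = f x y := by
  unfold tmul lift
  exact (QuotientAddGroup.lift_mk' _ _ _).trans (TensorProduct.liftAddHom_tmul _ _ _ _)

theorem hom_ext {P : Type u} [AddCommGroup P] {f g : BalTensor R X Y →+ P}
    (h : ∀ x y, f (tmul R x y) = g (tmul R x y)) (t : BalTensor R X Y) : f t = g t := by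
  induction t using induction_on with
  | tmul x y => exact h x y
  | zero => simp
  | add s t hs ht => simp [hs, ht]

variable {X' Y' X'' Y'' : Type u} [AddCommGroup X'] [Module Rᵐᵒᵖ X'] [AddCommGroup Y'] [Module R Y']
  [AddCommGroup X''] [Module Rᵐᵒᵖ X''] [AddCommGroup Y''] [Module R Y'']

/-- The map `f ⊗_R g`. -/
def map (f : X →ₗ[Rᵐᵒᵖ] X') (g : Y →ₗ[R] Y') : BalTensor R X Y →+ BalTensor R X' Y' :=
  lift (mkBiadd (fun x y => tmul R (f x) (g y))
    (fun x x' y => by rw [map_add, add_tmul]) (fun x y y' => by rw [map_add, tmul_add]))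
    (fun r x y => by
      change tmul R (f (op r • x)) (g y) = tmul R (f x) (g (r • y))
      rw [map_smul, map_smul, smul_tmul])

@[simp] theorem map_tmul (f : X →ₗ[Rᵐᵒᵖ] X') (g : Y →ₗ[R] Y') (x : X) (y : Y) :
    map f g (tmul R x y) = tmul R (f x) (g y) := by
  unfold map; rw [lift_tmul]; rfl

end

end BalTensor

/-- A left `R`-module `N` is flat if `- ⊗_R N` preserves injectivity of maps of right
`R`-modules. -/
def FlatLeft (R : Type u) [Ring R] (N : Type u) [AddCommGroup N] [Module R N] : Prop :=
  ∀ (X Y : Type u) [AddCommGroup X] [Module Rᵐᵒᵖ X] [AddCommGroup Y] [Module Rᵐᵒᵖ Y]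
    (f : X →ₗ[Rᵐᵒᵖ] Y), Function.Injective f →
      Function.Injective (BalTensor.map f (LinearMap.id : N →ₗ[R] N))

/-- Von Neumann regular rings. -/
def IsVonNeumannRegular (R : Type u) [Ring R] : Prop := ∀ a : R, ∃ x : R, a * x * a = a

/-- A preadditive category is abelian. -/
structure IsAbelianCategory (V : Type*) [Category V] [Preadditive V] : Prop where
  hasFiniteProducts : HasFiniteProducts V
  hasKernels : HasKernels V
  hasCokernels : HasCokernels V
  normalMono : IsNormalMonoCategory V
  normalEpi : IsNormalEpiCategory V

/-! ### Bimodules over `k`-algebras -/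

section Bimodules

variable (k : Type u) [CommRing k]

/-- An `A`-`B`-bimodule over the `k`-algebras `A` and `B`, on which the two actions of `k` agree.
Since `k` acts on the left of a right `A`-module through `k → A`, a `k`-`A`-bimodule in this sense
is the same as a right `A`-module, and an `A`-`k`-bimodule the same as a left `A`-module. -/
structure Bimodule (A B : Type u) [Ring A] [Algebra k A] [Ring B] [Algebra k B] where
  /-- the underlying set -/
  carrier : Type u
  [addCommGroup : AddCommGroup carrier]
  [leftModule : Module A carrier]
  [rightModule : Module Bᵐᵒᵖ carrier]
  [smulComm : SMulCommClass A Bᵐᵒᵖ carrier]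
  central : ∀ (r : k) (x : carrier), algebraMap k A r • x = op (algebraMap k B r) • x

end Bimodules

namespace Bimodule

variable {k : Type u} [CommRing k]
variable {S A B E : Type u} [Ring S] [Algebra k S] [Ring A] [Algebra k A] [Ring B] [Algebra k B]
  [Ring E] [Algebra k E]

instance : CoeSort (Bimodule k A B) (Type u) := ⟨carrier⟩

attribute [instance] addCommGroup leftModule rightModule smulComm

instance (X : Bimodule k A B) : SMulCommClass Bᵐᵒᵖ A X := SMulCommClass.symm _ _ _

/-- Morphisms of bimodules. -/
@[ext] structure Hom (X Y : Bimodule k A B) where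
  /-- the underlying left linear map -/
  toLin : X →ₗ[A] Y
  map_rsmul : ∀ (b : B) (x : X), toLin (op b • x) = op b • toLin x

instance : Category (Bimodule k A B) where
  Hom := Hom
  id X := ⟨LinearMap.id, fun _ _ => rfl⟩
  comp f g := ⟨g.toLin.comp f.toLin, fun b x => by simp [f.map_rsmul, g.map_rsmul]⟩

instance (X Y : Bimodule k A B) : CoeFun (X ⟶ Y) (fun _ => X → Y) := ⟨fun f => f.toLin⟩

variable {X Y Z : Bimodule k A B}

theorem hom_ext {f g : X ⟶ Y} (h : ∀ x : X, f x = g x) : f = g :=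
  Hom.ext (LinearMap.ext h)

@[simp] theorem id_apply (x : X) : (𝟙 X : X ⟶ X) x = x := rfl
@[simp] theorem comp_apply (f : X ⟶ Y) (g : Y ⟶ Z) (x : X) : (f ≫ g) x = g (f x) := rfl

/-- The underlying right linear map. -/
def Hom.rightLin (f : X ⟶ Y) : X →ₗ[Bᵐᵒᵖ] Y where
  toFun := f
  map_add' x y := map_add f.toLin x y
  map_smul' b x := f.map_rsmul b.unop x

/-- The underlying left linear map. -/
def Hom.leftLin (f : X ⟶ Y) : X →ₗ[A] Y := f.toLin

@[simp] theorem rightLin_apply (f : X ⟶ Y) (x : X) : Hom.rightLin f x = f x := rfl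
@[simp] theorem leftLin_apply (f : X ⟶ Y) (x : X) : Hom.leftLin f x = f x := rfl

instance : Zero (X ⟶ Y) := ⟨⟨0, fun _ _ => by simp⟩⟩
instance : Add (X ⟶ Y) := ⟨fun f g => ⟨f.toLin + g.toLin, fun b x => by
  simp [f.map_rsmul, g.map_rsmul]⟩⟩
instance : Neg (X ⟶ Y) := ⟨fun f => ⟨-f.toLin, fun b x => by simp [f.map_rsmul]⟩⟩
instance : Sub (X ⟶ Y) := ⟨fun f g => ⟨f.toLin - g.toLin, fun b x => by
  simp [f.map_rsmul, g.map_rsmul, smul_sub]⟩⟩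
instance : SMul ℕ (X ⟶ Y) := ⟨fun n f => ⟨n • f.toLin, fun b x => by
  simp [f.map_rsmul, smul_comm n]⟩⟩
instance : SMul ℤ (X ⟶ Y) := ⟨fun n f => ⟨n • f.toLin, fun b x => by
  simp [f.map_rsmul, smul_comm n]⟩⟩

instance : AddCommGroup (X ⟶ Y) :=
  Function.Injective.addCommGroup (fun f : X ⟶ Y => f.toLin) (fun _ _ h => Hom.ext h) rfl
    (fun _ _ => rfl) (fun _ => rfl) (fun _ _ => rfl) (fun _ _ => rfl) (fun _ _ => rfl)

@[simp] theorem zero_apply (x : X) : (0 : X ⟶ Y) x = 0 := rfl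
@[simp] theorem add_apply (f g : X ⟶ Y) (x : X) : (f + g) x = f x + g x := rfl
@[simp] theorem sub_apply (f g : X ⟶ Y) (x : X) : (f - g) x = f x - g x := rfl

instance : Preadditive (Bimodule k A B) where
  add_comp X Y Z f g h := hom_ext fun x => map_add h.toLin _ _
  comp_add X Y Z f g h := rfl

/-- The bimodule `A`. -/
def unit (k : Type u) [CommRing k] (A : Type u) [Ring A] [Algebra k A] : Bimodule k A A where
  carrier := A
  central r x := by
    rw [smul_eq_mul, op_smul_eq_mul]; exact Algebra.commutes r x

/-! ### The tensor product of bimodules -/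

section Tensor

open BalTensor

variable (X : Bimodule k S A) (Y : Bimodule k A B)

instance tensorLeftModule : Module S (BalTensor A X Y) where
  smul s := BalTensor.map (DistribSMul.toLinearMap Aᵐᵒᵖ X s) LinearMap.id
  one_smul t := by
    change BalTensor.map _ _ t = AddMonoidHom.id _ t
    exact BalTensor.hom_ext (fun x y => by simp) t
  mul_smul s s' t := by
    change BalTensor.map _ _ t = ((BalTensor.map _ _).comp (BalTensor.map _ _)) t
    exact BalTensor.hom_ext (fun x y => by simp [mul_smul]) t
  smul_zero s := map_zero _
  smul_add s := map_add _
  add_smul s s' t := by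
    change BalTensor.map _ _ t = BalTensor.map _ _ t + BalTensor.map _ _ t
    rw [← AddMonoidHom.add_apply]
    exact BalTensor.hom_ext (fun x y => by simp [add_smul, add_tmul]) t
  zero_smul t := by
    change BalTensor.map _ _ t = (0 : BalTensor A X Y →+ BalTensor A X Y) t
    refine BalTensor.hom_ext (fun x y => ?_) t
    have h := add_tmul (R := A) (0 : X) 0 y
    simp at h
    simp [h]

instance tensorRightModule : Module Bᵐᵒᵖ (BalTensor A X Y) where
  smul s := BalTensor.map LinearMap.id (DistribSMul.toLinearMap A Y s)
  one_smul t := by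
    change BalTensor.map _ _ t = AddMonoidHom.id _ t
    exact BalTensor.hom_ext (fun x y => by simp) t
  mul_smul s s' t := by
    change BalTensor.map _ _ t = ((BalTensor.map _ _).comp (BalTensor.map _ _)) t
    exact BalTensor.hom_ext (fun x y => by simp [mul_smul]) t
  smul_zero s := map_zero _
  smul_add s := map_add _
  add_smul s s' t := by
    change BalTensor.map _ _ t = BalTensor.map _ _ t + BalTensor.map _ _ t
    rw [← AddMonoidHom.add_apply]
    exact BalTensor.hom_ext (fun x y => by simp [add_smul, tmul_add]) t
  zero_smul t := by
    change BalTensor.map _ _ t = (0 : BalTensor A X Y →+ BalTensor A X Y) t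
    refine BalTensor.hom_ext (fun x y => ?_) t
    have h := tmul_add (R := A) x (0 : Y) 0
    simp at h
    simp [h]

theorem smul_tmul_left (s : S) (x : X) (y : Y) : s • tmul A x y = tmul A (s • x) y :=
  BalTensor.map_tmul _ _ x y

theorem smul_tmul_right (b : Bᵐᵒᵖ) (x : X) (y : Y) : b • tmul A x y = tmul A x (b • y) :=
  BalTensor.map_tmul _ _ x y

/-- The `S`-`B`-bimodule `X ⊗_A Y`. -/
def tensor : Bimodule k S B where
  carrier := BalTensor A X Y
  smulComm := ⟨fun s b t => by
    induction t using BalTensor.induction_on with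
    | tmul x y => simp only [smul_tmul_left, smul_tmul_right]
    | zero => simp
    | add s t hs ht => simp only [smul_add, hs, ht]⟩
  central r t := by
    induction t using BalTensor.induction_on with
    | tmul x y =>
      rw [smul_tmul_left, smul_tmul_right, X.central, BalTensor.smul_tmul, Y.central]
    | zero => simp
    | add s t hs ht => simp only [smul_add, hs, ht]

end Tensor

/-- A bimodule morphism from an additive map. -/
def homMk {X Y : Bimodule k A B} (f : X →+ Y) (hl : ∀ (a : A) x, f (a • x) = a • f x)
    (hr : ∀ (b : B) x, f (op b • x) = op b • f x) : X ⟶ Y :=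
  ⟨{ f with map_smul' := hl }, hr⟩

@[simp] theorem homMk_apply {X Y : Bimodule k A B} (f : X →+ Y)
    (hl : ∀ (a : A) x, f (a • x) = a • f x) (hr : ∀ (b : B) x, f (op b • x) = op b • f x) (x : X) :
    homMk f hl hr x = f x := rfl

@[simp] theorem hom_add (f : X ⟶ Y) (x x' : X) : f (x + x') = f x + f x' := map_add f.toLin x x'
@[simp] theorem hom_zero (f : X ⟶ Y) : f 0 = 0 := map_zero f.toLin
@[simp] theorem hom_smul (f : X ⟶ Y) (a : A) (x : X) : f (a • x) = a • f x := map_smul f.toLin a x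
@[simp] theorem hom_rsmul (f : X ⟶ Y) (b : Bᵐᵒᵖ) (x : X) : f (b • x) = b • f x :=
  f.map_rsmul b.unop x

/-- The pure tensor `x ⊗ y` in the bimodule `X ⊗_A Y`. -/
def tm {X : Bimodule k S A} {Y : Bimodule k A B} (x : X) (y : Y) : tensor X Y :=
  BalTensor.tmul A x y

theorem tm_add {X : Bimodule k S A} {Y : Bimodule k A B} (x : X) (y y' : Y) :
    tm x (y + y') = tm x y + tm x y' := BalTensor.tmul_add x y y'
theorem add_tm {X : Bimodule k S A} {Y : Bimodule k A B} (x x' : X) (y : Y) :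
    tm (x + x') y = tm x y + tm x' y := BalTensor.add_tmul x x' y
theorem rsmul_tm {X : Bimodule k S A} {Y : Bimodule k A B} (a : A) (x : X) (y : Y) :
    tm (op a • x) y = tm x (a • y) := BalTensor.smul_tmul a x y
@[simp] theorem smul_tm {X : Bimodule k S A} {Y : Bimodule k A B} (s : S) (x : X) (y : Y) :
    s • tm x y = tm (s • x) y := smul_tmul_left X Y s x y
@[simp] theorem smul_tm' {X : Bimodule k S A} {Y : Bimodule k A B} (b : Bᵐᵒᵖ) (x : X) (y : Y) :
    b • tm x y = tm x (b • y) := smul_tmul_right X Y b x y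

@[elab_as_elim]
theorem tensor_induction {X : Bimodule k S A} {Y : Bimodule k A B} {p : tensor X Y → Prop}
    (t : tensor X Y) (tm : ∀ x y, p (tm x y)) (zero : p 0)
    (add : ∀ s t, p s → p t → p (s + t)) : p t :=
  BalTensor.induction_on (R := A) (X := X) (Y := Y) t tm zero add

/-- The additive map out of `X ⊗_A Y` induced by a balanced biadditive function. -/
def tlift {P : Type u} [AddCommGroup P] {X : Bimodule k S A} {Y : Bimodule k A B} (f : X → Y → P)
    (h₁ : ∀ x x' y, f (x + x') y = f x y + f x' y)
    (h₂ : ∀ x y y', f x (y + y') = f x y + f x y')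
    (h : ∀ (a : A) x y, f (op a • x) y = f x (a • y)) : tensor X Y →+ P :=
  BalTensor.lift (mkBiadd f h₁ h₂) h

theorem tlift_tm {P : Type u} [AddCommGroup P] {X : Bimodule k S A} {Y : Bimodule k A B}
    (f : X → Y → P) (h₁ h₂) (h : ∀ (a : A) x y, f (op a • x) y = f x (a • y)) (x : X) (y : Y) :
    tlift f h₁ h₂ h (tm x y) = f x y := BalTensor.lift_tmul (mkBiadd f h₁ h₂) h x y

theorem tensor_hom_ext {X : Bimodule k S A} {Y : Bimodule k A B} {W : Bimodule k S B}
    {f g : tensor X Y ⟶ W} (h : ∀ x y, f (tm x y) = g (tm x y)) : f = g := by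
  refine hom_ext fun t => ?_
  induction t using tensor_induction with
  | tm x y => exact h x y
  | zero => simp
  | add s t hs ht => simp [hs, ht]

/-- A bimodule morphism out of `X ⊗_A Y` from a balanced bilinear function. -/
def desc {X : Bimodule k S A} {Y : Bimodule k A B} {P : Bimodule k S B} (f : X → Y → P)
    (h₁ : ∀ x x' y, f (x + x') y = f x y + f x' y)
    (h₂ : ∀ x y y', f x (y + y') = f x y + f x y')
    (h : ∀ (a : A) x y, f (op a • x) y = f x (a • y))
    (hl : ∀ (s : S) x y, f (s • x) y = s • f x y)
    (hr : ∀ (b : B) x y, f x (op b • y) = op b • f x y) : tensor X Y ⟶ P :=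
  homMk (tlift f h₁ h₂ h)
    (fun s t => by
      induction t using tensor_induction with
      | tm x y => rw [smul_tm, tlift_tm, tlift_tm]; exact hl s x y
      | zero => rw [smul_zero, map_zero, smul_zero]
      | add t t' ht ht' => rw [smul_add, map_add, map_add, smul_add, ht, ht'])
    (fun s t => by
      induction t using tensor_induction with
      | tm x y => rw [smul_tm', tlift_tm, tlift_tm]; exact hr s x y
      | zero => rw [smul_zero, map_zero, smul_zero]
      | add t t' ht ht' => rw [smul_add, map_add, map_add, smul_add, ht, ht'])

theorem desc_tm {X : Bimodule k S A} {Y : Bimodule k A B} {P : Bimodule k S B} (f : X → Y → P)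
    (h₁ h₂ h hl hr) (x : X) (y : Y) : desc f h₁ h₂ h hl hr (tm x y) = f x y :=
  tlift_tm f h₁ h₂ h x y

/-- The morphism `f ⊗_A g`. -/
def tmap {X X' : Bimodule k S A} {Y Y' : Bimodule k A B} (f : X ⟶ X') (g : Y ⟶ Y') :
    tensor X Y ⟶ tensor X' Y' :=
  desc (fun x y => tm (f x) (g y)) (fun x x' y => by rw [hom_add, add_tm])
    (fun x y y' => by rw [hom_add, tm_add]) (fun a x y => by rw [hom_rsmul, hom_smul, rsmul_tm])
    (fun s x y => by rw [hom_smul, smul_tm]) (fun b x y => by rw [hom_rsmul, smul_tm'])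

@[simp] theorem tmap_tm {X X' : Bimodule k S A} {Y Y' : Bimodule k A B} (f : X ⟶ X') (g : Y ⟶ Y')
    (x : X) (y : Y) : tmap f g (tm x y) = tm (f x) (g y) := desc_tm ..

theorem tmap_id (X : Bimodule k S A) (Y : Bimodule k A B) : tmap (𝟙 X) (𝟙 Y) = 𝟙 _ :=
  tensor_hom_ext fun x y => by simp

theorem tmap_comp {X X' X'' : Bimodule k S A} {Y Y' Y'' : Bimodule k A B} (f : X ⟶ X')
    (f' : X' ⟶ X'') (g : Y ⟶ Y') (g' : Y' ⟶ Y'') :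
    tmap (f ≫ f') (g ≫ g') = tmap f g ≫ tmap f' g' :=
  tensor_hom_ext fun x y => by simp

/-- The map `x ⊗ y ↦ x ⊗ (y ⊗ z)`. -/
def assocAux (X : Bimodule k S A) (Y : Bimodule k A B) (Z : Bimodule k B E) (z : Z) :
    tensor X Y →+ tensor X (tensor Y Z) :=
  tlift (fun x y => tm x (tm y z)) (fun x x' y => by rw [add_tm])
    (fun x y y' => by rw [add_tm, tm_add])
    (fun a x y => by
      rw [rsmul_tm, smul_tm])

theorem assocAux_tm (X : Bimodule k S A) (Y : Bimodule k A B) (Z : Bimodule k B E) (z : Z)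
    (x : X) (y : Y) : assocAux X Y Z z (tm x y) = tm x (tm y z) := tlift_tm ..

/-- The associativity isomorphism, as a map. -/
def assocHom (X : Bimodule k S A) (Y : Bimodule k A B) (Z : Bimodule k B E) :
    tensor (tensor X Y) Z ⟶ tensor X (tensor Y Z) :=
  desc (fun t z => assocAux X Y Z z t) (fun t t' z => map_add _ _ _)
    (fun t z z' => by
      induction t using tensor_induction with
      | tm x y => rw [assocAux_tm, assocAux_tm, assocAux_tm, tm_add, tm_add]
      | zero => rw [map_zero, map_zero, map_zero, add_zero]
      | add t t' ht ht' => rw [map_add, map_add, map_add, ht, ht']; abel)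
    (fun b t z => by
      induction t using tensor_induction with
      | tm x y => rw [smul_tm', assocAux_tm, assocAux_tm, rsmul_tm]
      | zero => rw [smul_zero, map_zero, map_zero]
      | add t t' ht ht' => rw [smul_add, map_add, map_add, ht, ht'])
    (fun s t z => by
      induction t using tensor_induction with
      | tm x y => rw [smul_tm, assocAux_tm, assocAux_tm, smul_tm]
      | zero => rw [smul_zero, map_zero, smul_zero]
      | add t t' ht ht' => rw [smul_add, map_add, map_add, smul_add, ht, ht'])
    (fun e t z => by
      induction t using tensor_induction with
      | tm x y => rw [assocAux_tm, assocAux_tm, smul_tm', smul_tm']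
      | zero => rw [map_zero, map_zero, smul_zero]
      | add t t' ht ht' => rw [map_add, map_add, smul_add, ht, ht'])

@[simp] theorem assocHom_tm (X : Bimodule k S A) (Y : Bimodule k A B) (Z : Bimodule k B E)
    (x : X) (y : Y) (z : Z) : assocHom X Y Z (tm (tm x y) z) = tm x (tm y z) :=
  (desc_tm ..).trans (assocAux_tm ..)

/-- The map `y ⊗ z ↦ (x ⊗ y) ⊗ z`. -/
def assocInvAux (X : Bimodule k S A) (Y : Bimodule k A B) (Z : Bimodule k B E) (x : X) :
    tensor Y Z →+ tensor (tensor X Y) Z :=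
  tlift (fun y z => tm (tm x y) z) (fun y y' z => by rw [tm_add, add_tm])
    (fun y z z' => by rw [tm_add])
    (fun b y z => by
      rw [← smul_tm', rsmul_tm])

theorem assocInvAux_tm (X : Bimodule k S A) (Y : Bimodule k A B) (Z : Bimodule k B E) (x : X)
    (y : Y) (z : Z) : assocInvAux X Y Z x (tm y z) = tm (tm x y) z := tlift_tm ..

/-- The inverse of the associativity isomorphism. -/
def assocInv (X : Bimodule k S A) (Y : Bimodule k A B) (Z : Bimodule k B E) :
    tensor X (tensor Y Z) ⟶ tensor (tensor X Y) Z :=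
  desc (fun x t => assocInvAux X Y Z x t)
    (fun x x' t => by
      induction t using tensor_induction with
      | tm y z => rw [assocInvAux_tm, assocInvAux_tm, assocInvAux_tm, add_tm, add_tm]
      | zero => rw [map_zero, map_zero, map_zero, add_zero]
      | add t t' ht ht' => rw [map_add, map_add, map_add, ht, ht']; abel)
    (fun x t t' => map_add _ _ _)
    (fun a x t => by
      induction t using tensor_induction with
      | tm y z => rw [smul_tm, assocInvAux_tm, assocInvAux_tm, rsmul_tm]
      | zero => rw [smul_zero, map_zero, map_zero]
      | add t t' ht ht' => rw [smul_add, map_add, map_add, ht, ht'])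
    (fun s x t => by
      induction t using tensor_induction with
      | tm y z => rw [assocInvAux_tm, assocInvAux_tm, smul_tm, smul_tm]
      | zero => rw [map_zero, map_zero, smul_zero]
      | add t t' ht ht' => rw [map_add, map_add, smul_add, ht, ht'])
    (fun e x t => by
      induction t using tensor_induction with
      | tm y z => rw [smul_tm', assocInvAux_tm, assocInvAux_tm, smul_tm']
      | zero => rw [smul_zero, map_zero, smul_zero]
      | add t t' ht ht' => rw [smul_add, map_add, map_add, smul_add, ht, ht'])

@[simp] theorem assocInv_tm (X : Bimodule k S A) (Y : Bimodule k A B) (Z : Bimodule k B E)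
    (x : X) (y : Y) (z : Z) : assocInv X Y Z (tm x (tm y z)) = tm (tm x y) z :=
  (desc_tm ..).trans (assocInvAux_tm ..)

theorem tensor_hom_ext₃ {X : Bimodule k S A} {Y : Bimodule k A B} {Z : Bimodule k B E}
    {W : Bimodule k S E} {f g : tensor (tensor X Y) Z ⟶ W}
    (h : ∀ x y z, f (tm (tm x y) z) = g (tm (tm x y) z)) : f = g := by
  refine tensor_hom_ext fun t z => ?_
  induction t using tensor_induction with
  | tm x y => exact h x y z
  | zero =>
    have h0 : tm (0 : tensor X Y) z = 0 := by
      have := add_tm (0 : tensor X Y) 0 z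
      simpa using this
    rw [h0, hom_zero, hom_zero]
  | add t t' ht ht' => rw [add_tm, hom_add, hom_add, ht, ht']

theorem tensor_hom_ext₃' {X : Bimodule k S A} {Y : Bimodule k A B} {Z : Bimodule k B E}
    {W : Bimodule k S E} {f g : tensor X (tensor Y Z) ⟶ W}
    (h : ∀ x y z, f (tm x (tm y z)) = g (tm x (tm y z))) : f = g := by
  refine tensor_hom_ext fun x t => ?_
  induction t using tensor_induction with
  | tm y z => exact h x y z
  | zero =>
    have h0 : tm x (0 : tensor Y Z) = 0 := by
      have := tm_add x (0 : tensor Y Z) 0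
      simpa using this
    rw [h0, hom_zero, hom_zero]
  | add t t' ht ht' => rw [tm_add, hom_add, hom_add, ht, ht']

/-- The isomorphism `A ⊗_A X → X`, as a map. -/
def lUnit (X : Bimodule k A B) : tensor (unit k A) X ⟶ X :=
  desc (fun a x => (show A from a) • x) (fun a a' x => add_smul (show A from a) (show A from a') x)
    (fun a x x' => smul_add (show A from a) x x')
    (fun r a x => mul_smul (show A from a) r x)
    (fun s a x => mul_smul s (show A from a) x)
    (fun s a x => smul_comm (show A from a) (op s) x)

@[simp] theorem lUnit_tm (X : Bimodule k A B) (a : A) (x : X) :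
    lUnit X (tm (X := unit k A) a x) = a • x := desc_tm ..

/-- The isomorphism `X ⊗_B B → X`, as a map. -/
def rUnit (X : Bimodule k A B) : tensor X (unit k B) ⟶ X :=
  desc (fun x b => op (show B from b) • x) (fun x x' b => smul_add (op (show B from b)) x x')
    (fun x b b' => add_smul (op (show B from b)) (op (show B from b')) x)
    (fun r x b => (mul_smul (op (show B from b)) (op r) x).symm)
    (fun s x b => smul_comm (op (show B from b)) s x)
    (fun s x b => mul_smul (op s) (op (show B from b)) x)

@[simp] theorem rUnit_tm (X : Bimodule k A B) (x : X) (b : B) :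
    rUnit X (tm (Y := unit k B) x b) = op b • x := desc_tm ..

/-! ### Naturality and coherence -/

section Coherence

variable {F : Type u} [Ring F] [Algebra k F]

theorem assocInv_assocHom (X : Bimodule k S A) (Y : Bimodule k A B) (Z : Bimodule k B E) :
    assocInv X Y Z ≫ assocHom X Y Z = 𝟙 _ := tensor_hom_ext₃' fun x y z => by simp

theorem assocHom_assocInv (X : Bimodule k S A) (Y : Bimodule k A B) (Z : Bimodule k B E) :
    assocHom X Y Z ≫ assocInv X Y Z = 𝟙 _ := tensor_hom_ext₃ fun x y z => by simp

theorem assocInv_naturality {X X' : Bimodule k S A} {Y Y' : Bimodule k A B} {Z Z' : Bimodule k B E}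
    (f : X ⟶ X') (g : Y ⟶ Y') (h : Z ⟶ Z') :
    assocInv X Y Z ≫ tmap (tmap f g) h = tmap f (tmap g h) ≫ assocInv X' Y' Z' :=
  tensor_hom_ext₃' fun x y z => by simp

theorem assocHom_naturality {X X' : Bimodule k S A} {Y Y' : Bimodule k A B} {Z Z' : Bimodule k B E}
    (f : X ⟶ X') (g : Y ⟶ Y') (h : Z ⟶ Z') :
    assocHom X Y Z ≫ tmap f (tmap g h) = tmap (tmap f g) h ≫ assocHom X' Y' Z' :=
  tensor_hom_ext₃ fun x y z => by simp

theorem rUnit_naturality {X Y : Bimodule k A B} (f : X ⟶ Y) :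
    tmap f (𝟙 (unit k B)) ≫ rUnit Y = rUnit X ≫ f := tensor_hom_ext fun x b => by
  have h1 := rUnit_tm X x b
  have h2 := rUnit_tm Y (f x) b
  simp only [comp_apply, tmap_tm, id_apply]
  rw [h1, hom_rsmul]; exact h2

theorem pentagonAux (X : Bimodule k S A) (Y : Bimodule k A B) (Z : Bimodule k B E)
    (W : Bimodule k E F) :
    assocInv X (tensor Y Z) W ≫ tmap (assocInv X Y Z) (𝟙 W) ≫ assocHom (tensor X Y) Z W
      = tmap (𝟙 X) (assocHom Y Z W) ≫ assocInv X Y (tensor Z W) :=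
  tensor_hom_ext₃' fun x t w => by
    induction t using tensor_induction with
    | tm y z => simp
    | zero =>
      have h0 : tm (0 : tensor Y Z) w = 0 := by simpa using add_tm (0 : tensor Y Z) 0 w
      have h1 : tm x (0 : tensor (tensor Y Z) W) = 0 := by
        simpa using tm_add x (0 : tensor (tensor Y Z) W) 0
      rw [h0, h1, hom_zero, hom_zero]
    | add t t' ht ht' => rw [add_tm, tm_add, hom_add, hom_add, ht, ht']

theorem pentagonAux' (X : Bimodule k S A) (Y : Bimodule k A B) (Z : Bimodule k B E)
    (W : Bimodule k E F) :
    assocInv (tensor X Y) Z W ≫ tmap (assocHom X Y Z) (𝟙 W)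
      = assocHom X Y (tensor Z W) ≫ tmap (𝟙 X) (assocInv Y Z W) ≫ assocInv X (tensor Y Z) W :=
  tensor_hom_ext₃' fun t z w => by
    induction t using tensor_induction with
    | tm x y => simp
    | zero =>
      have h1 : tm (0 : tensor X Y) (tm z w) = 0 := by
        simpa using add_tm (0 : tensor X Y) 0 (tm z w)
      rw [h1, hom_zero, hom_zero]
    | add t t' ht ht' => rw [add_tm, hom_add, hom_add, ht, ht']

theorem triangleAux (X : Bimodule k S A) (Y : Bimodule k A B) :
    assocInv X Y (unit k B) ≫ rUnit (tensor X Y) = tmap (𝟙 X) (rUnit Y) :=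
  tensor_hom_ext₃' fun x y b => by
    have h1 := rUnit_tm (tensor X Y) (tm x y) b
    have h2 := rUnit_tm Y y b
    simp only [comp_apply, tmap_tm, id_apply, assocInv_tm]
    rw [h2, ← smul_tm']; exact h1

theorem tmap_comp_left {X X' X'' : Bimodule k S A} (Y : Bimodule k A B) (f : X ⟶ X')
    (f' : X' ⟶ X'') : tmap (f ≫ f') (𝟙 Y) = tmap f (𝟙 Y) ≫ tmap f' (𝟙 Y) := by
  rw [← tmap_comp, Category.comp_id]

theorem tmap_comp_right (X : Bimodule k S A) {Y Y' Y'' : Bimodule k A B} (g : Y ⟶ Y')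
    (g' : Y' ⟶ Y'') : tmap (𝟙 X) (g ≫ g') = tmap (𝟙 X) g ≫ tmap (𝟙 X) g' := by
  rw [← tmap_comp, Category.comp_id]

theorem tmap_exchange {X X' : Bimodule k S A} {Y Y' : Bimodule k A B} (f : X ⟶ X') (g : Y ⟶ Y') :
    tmap f (𝟙 Y) ≫ tmap (𝟙 X') g = tmap (𝟙 X) g ≫ tmap f (𝟙 Y') := by
  rw [← tmap_comp, ← tmap_comp]; simp

theorem tmap_add_left {X X' : Bimodule k S A} (Y : Bimodule k A B) (f g : X ⟶ X') :
    tmap (f + g) (𝟙 Y) = tmap f (𝟙 Y) + tmap g (𝟙 Y) :=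
  tensor_hom_ext fun x y => by simp [add_tm]

theorem tmap_sub_left {X X' : Bimodule k S A} (Y : Bimodule k A B) (f g : X ⟶ X') :
    tmap (f - g) (𝟙 Y) = tmap f (𝟙 Y) - tmap g (𝟙 Y) := by
  rw [eq_sub_iff_add_eq, ← tmap_add_left, sub_add_cancel]

theorem tmap_zero_left {X X' : Bimodule k S A} (Y : Bimodule k A B) :
    tmap (0 : X ⟶ X') (𝟙 Y) = 0 := by
  simpa using tmap_sub_left Y (0 : X ⟶ X') 0

end Coherence

/-! ### Right modules form a `k`-linear category -/

section Linear

variable {X Y : Bimodule k k B}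

instance : SMul k (X ⟶ Y) := ⟨fun r f => ⟨r • f.toLin, fun b x => by
  simp [f.map_rsmul, smul_comm r]⟩⟩

theorem smul_apply (r : k) (f : X ⟶ Y) (x : X) : (r • f) x = r • f x := rfl

instance : Module k (X ⟶ Y) :=
  Function.Injective.module k (⟨⟨fun f => f.toLin, rfl⟩, fun _ _ => rfl⟩ : (X ⟶ Y) →+ (X →ₗ[k] Y))
    (fun _ _ h => Hom.ext h) (fun _ _ => rfl)

instance : Linear k (Bimodule k k B) where
  smul_comp X Y Z r f g := hom_ext fun x => hom_smul g r (f x)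
  comp_smul X Y Z f r g := rfl

theorem tmap_smul_left {B' : Type u} [Ring B'] [Algebra k B'] (Z : Bimodule k B B') (r : k)
    (f : X ⟶ Y) : tmap (r • f) (𝟙 Z) = r • tmap f (𝟙 Z) :=
  tensor_hom_ext fun x y => by simp [smul_apply]

variable (k B) in
/-- The forgetful functor from right `B`-modules to `k`-modules. -/
def forgetToModuleCat : Bimodule k k B ⥤ ModuleCat.{u} k where
  obj X := ModuleCat.of k X
  map f := ModuleCat.ofHom f.toLin

end Linear

/-! ### Kernels -/

section Kernel

variable {X Y : Bimodule k A B}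

instance kerRightSMul (f : X ⟶ Y) : SMul Bᵐᵒᵖ (LinearMap.ker f.toLin) :=
  ⟨fun b x => ⟨b • x.1, by
    have h : f x.1 = 0 := x.2
    change f (b • x.1) = 0
    rw [hom_rsmul, h, smul_zero]⟩⟩

instance kerRightModule (f : X ⟶ Y) : Module Bᵐᵒᵖ (LinearMap.ker f.toLin) where
  one_smul := fun x => Subtype.ext (one_smul _ x.1)
  mul_smul := fun b b' x => Subtype.ext (mul_smul b b' x.1)
  smul_zero := fun b => Subtype.ext (smul_zero b)
  smul_add := fun b x y => Subtype.ext (smul_add b x.1 y.1)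
  add_smul := fun b b' x => Subtype.ext (add_smul b b' x.1)
  zero_smul := fun x => Subtype.ext (zero_smul _ x.1)

/-- The kernel of a morphism of bimodules. -/
def ker (f : X ⟶ Y) : Bimodule k A B where
  carrier := LinearMap.ker f.toLin
  smulComm := ⟨fun a b x => Subtype.ext (smul_comm a b x.1)⟩
  central r x := Subtype.ext (X.central r x.1)

/-- The inclusion of the kernel. -/
def kerι (f : X ⟶ Y) : ker f ⟶ X := ⟨(LinearMap.ker f.toLin).subtype, fun _ _ => rfl⟩

theorem kerι_injective (f : X ⟶ Y) : Function.Injective (kerι f) := Subtype.val_injective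

theorem kerι_comp (f : X ⟶ Y) : kerι f ≫ f = 0 := hom_ext fun x => x.2

/-- The universal property of the kernel. -/
def kerLift {W : Bimodule k A B} (f : X ⟶ Y) (g : W ⟶ X) (h : g ≫ f = 0) : W ⟶ ker f :=
  ⟨g.toLin.codRestrict _ fun w => congrArg (fun e : W ⟶ Y => e w) h,
    fun b w => Subtype.ext (g.map_rsmul b w)⟩

theorem kerLift_comp {W : Bimodule k A B} (f : X ⟶ Y) (g : W ⟶ X) (h : g ≫ f = 0) :
    kerLift f g h ≫ kerι f = g := rfl

theorem eq_of_comp_injective {W : Bimodule k A B} {f g : W ⟶ X} (i : X ⟶ Y)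
    (hi : Function.Injective i) (h : f ≫ i = g ≫ i) : f = g :=
  hom_ext fun w => hi (congrArg (fun e : W ⟶ Y => e w) h)

/-- `f` is `Z`-pure: the functor `- ⊗_B Z` preserves the kernel of `f`. -/
structure IsPure (f : X ⟶ Y) (Z : Bimodule k B E) : Prop where
  injective : Function.Injective (tmap (kerι f) (𝟙 Z))
  exact : ∀ t : tensor X Z, tmap f (𝟙 Z) t = 0 → ∃ s : tensor (ker f) Z, tmap (kerι f) (𝟙 Z) s = t

/-- The function underlying `IsPure.lift`. -/
noncomputable def IsPure.liftFun {f : X ⟶ Y} {Z : Bimodule k B E} (hf : IsPure f Z)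
    {W : Bimodule k A E} (g : W ⟶ tensor X Z) (h : g ≫ tmap f (𝟙 Z) = 0) (w : W) :
    tensor (ker f) Z :=
  (hf.exact (g w) (congrArg (fun e : W ⟶ tensor Y Z => e w) h)).choose

theorem IsPure.liftFun_spec {f : X ⟶ Y} {Z : Bimodule k B E} (hf : IsPure f Z)
    {W : Bimodule k A E} (g : W ⟶ tensor X Z) (h : g ≫ tmap f (𝟙 Z) = 0) (w : W) :
    tmap (kerι f) (𝟙 Z) (hf.liftFun g h w) = g w :=
  (hf.exact (g w) (congrArg (fun e : W ⟶ tensor Y Z => e w) h)).choose_spec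

/-- The factorization of a morphism through `ker f ⊗_B Z`, for `Z`-pure `f`. -/
noncomputable def IsPure.lift {f : X ⟶ Y} {Z : Bimodule k B E} (hf : IsPure f Z)
    {W : Bimodule k A E} (g : W ⟶ tensor X Z) (h : g ≫ tmap f (𝟙 Z) = 0) :
    W ⟶ tensor (ker f) Z :=
  ⟨{ toFun := hf.liftFun g h
     map_add' := fun w w' => hf.injective (by
      rw [hom_add, liftFun_spec, liftFun_spec, liftFun_spec, hom_add])
     map_smul' := fun a w => hf.injective (by
      rw [RingHom.id_apply, hom_smul, liftFun_spec, liftFun_spec, hom_smul]) },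
    fun b w => hf.injective (by
      change tmap (kerι f) (𝟙 Z) (hf.liftFun g h (op b • w))
        = tmap (kerι f) (𝟙 Z) (op b • hf.liftFun g h w)
      rw [hom_rsmul, liftFun_spec, liftFun_spec, hom_rsmul])⟩

theorem IsPure.lift_comp {f : X ⟶ Y} {Z : Bimodule k B E} (hf : IsPure f Z) {W : Bimodule k A E}
    (g : W ⟶ tensor X Z) (h : g ≫ tmap f (𝟙 Z) = 0) :
    hf.lift g h ≫ tmap (kerι f) (𝟙 Z) = g :=
  hom_ext fun w => hf.liftFun_spec g h w

end Kernel

end Bimodule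

open Bimodule

/-! ### Corings and comodules -/

section Comodules

variable (k : Type u) [CommRing k] (A : Type u) [Ring A] [Algebra k A]

/-- An `A`-coring. -/
structure Coring where
  /-- the underlying bimodule -/
  obj : Bimodule k A A
  /-- the comultiplication -/
  comul : obj ⟶ tensor obj obj
  /-- the counit -/
  counit : obj ⟶ unit k A
  coassoc : comul ≫ tmap comul (𝟙 obj) ≫ assocHom obj obj obj = comul ≫ tmap (𝟙 obj) comul
  counit_left : comul ≫ tmap counit (𝟙 obj) ≫ lUnit obj = 𝟙 obj
  counit_right : comul ≫ tmap (𝟙 obj) counit ≫ rUnit obj = 𝟙 obj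

/-- The element `1` of the bimodule `A`. -/
def unitOne : unit k A := show A from 1

/-- The comultiplication `a ↦ a ⊗ 1` of the trivial coring. -/
def trivialComul : unit k A ⟶ tensor (unit k A) (unit k A) :=
  homMk (AddMonoidHom.mk' (fun a => tm a (unitOne k A)) (fun a b => add_tm a b _))
    (fun a b => (smul_tm a b _).symm)
    (fun a b => by
      change tm (op a • b) _ = op a • tm b _
      rw [rsmul_tm, smul_tm']
      exact congrArg (tm b) ((mul_one a).trans (one_mul a).symm))

theorem trivialComul_apply (a : unit k A) : trivialComul k A a = tm a (unitOne k A) := rfl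

/-- The trivial `A`-coring `A`. -/
def Coring.trivial : Coring k A where
  obj := unit k A
  comul := trivialComul k A
  counit := 𝟙 _
  coassoc := hom_ext fun a => by
    simp only [Bimodule.comp_apply, trivialComul_apply, tmap_tm, Bimodule.id_apply, assocHom_tm]
  counit_left := hom_ext fun a => by
    rw [tmap_id, Category.id_comp]
    exact (lUnit_tm (unit k A) a _).trans (mul_one (show A from a))
  counit_right := hom_ext fun a => by
    rw [tmap_id, Category.id_comp]
    exact (rUnit_tm (unit k A) a _).trans (mul_one (show A from a))

variable {k A}

/-- A coring is coseparable if its comultiplication is a split monomorphism of bicomodules, where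
`C ⊗_A C` carries the left coaction `Δ ⊗ C` and the right coaction `C ⊗ Δ`. -/
def Coring.IsCoseparable (C : Coring k A) : Prop :=
  ∃ p : tensor C.obj C.obj ⟶ C.obj,
    tmap C.comul (𝟙 C.obj) ≫ assocHom C.obj C.obj C.obj ≫ tmap (𝟙 C.obj) p = p ≫ C.comul ∧
    tmap (𝟙 C.obj) C.comul ≫ assocInv C.obj C.obj C.obj ≫ tmap p (𝟙 C.obj) = p ≫ C.comul ∧
    C.comul ≫ p = 𝟙 C.obj

/-- A right comodule over the coring `C`. -/
structure RComod (C : Coring k A) where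
  /-- the underlying right `A`-module -/
  obj : Bimodule k k A
  /-- the coaction -/
  coact : obj ⟶ tensor obj C.obj
  coassoc : coact ≫ tmap coact (𝟙 C.obj) ≫ assocHom obj C.obj C.obj = coact ≫ tmap (𝟙 obj) C.comul
  counit : coact ≫ tmap (𝟙 obj) C.counit ≫ rUnit obj = 𝟙 obj

namespace RComod

variable {C : Coring k A}

/-- Morphisms of right comodules. -/
@[ext] structure Hom (X Y : RComod C) where
  /-- the underlying morphism of right modules -/
  hom : X.obj ⟶ Y.obj
  comm : X.coact ≫ tmap hom (𝟙 C.obj) = hom ≫ Y.coact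

instance : Category (RComod C) where
  Hom := Hom
  id X := ⟨𝟙 _, by rw [tmap_id, Category.comp_id, Category.id_comp]⟩
  comp f g := ⟨f.hom ≫ g.hom, by
    rw [tmap_comp_left, ← Category.assoc, f.comm, Category.assoc, g.comm, Category.assoc]⟩

variable {X Y : RComod C}

theorem hom_ext {f g : X ⟶ Y} (h : f.hom = g.hom) : f = g := Hom.ext h

@[simp] theorem id_hom (X : RComod C) : (𝟙 X : X ⟶ X).hom = 𝟙 X.obj := rfl
@[simp] theorem comp_hom {X Y Z : RComod C} (f : X ⟶ Y) (g : Y ⟶ Z) :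
    (f ≫ g).hom = f.hom ≫ g.hom := rfl

variable (X Y) in
/-- The comodule morphisms form a `k`-submodule of the morphisms of right modules. -/
def homSubmodule : Submodule k (X.obj ⟶ Y.obj) where
  carrier := {f | X.coact ≫ tmap f (𝟙 C.obj) = f ≫ Y.coact}
  add_mem' {f g} hf hg := by
    simp only [Set.mem_ofPred_eq] at *
    rw [tmap_add_left, Preadditive.comp_add, Preadditive.add_comp, hf, hg]
  zero_mem' := by
    simp only [Set.mem_ofPred_eq]
    rw [tmap_zero_left, Limits.comp_zero, Limits.zero_comp]
  smul_mem' r f hf := by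
    simp only [Set.mem_ofPred_eq] at *
    rw [tmap_smul_left, Linear.comp_smul, Linear.smul_comp, hf]

variable (X Y) in
/-- Comodule morphisms as elements of a submodule. -/
def homEquiv : (X ⟶ Y) ≃ homSubmodule X Y where
  toFun f := ⟨f.hom, f.comm⟩
  invFun f := ⟨f.1, f.2⟩

instance : AddCommGroup (X ⟶ Y) := (homEquiv X Y).addCommGroup
instance : Module k (X ⟶ Y) := (homEquiv X Y).module k

theorem add_hom (f g : X ⟶ Y) : (f + g).hom = f.hom + g.hom := rfl
theorem smul_hom (r : k) (f : X ⟶ Y) : (r • f).hom = r • f.hom := rfl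

instance : Preadditive (RComod C) where
  add_comp X Y Z f g h := hom_ext (Preadditive.add_comp _ _ _ _ _ _)
  comp_add X Y Z f g h := hom_ext (Preadditive.comp_add _ _ _ _ _ _)

instance : Linear k (RComod C) where
  smul_comp X Y Z r f g := hom_ext (Linear.smul_comp _ _ _ _ _ _)
  comp_smul X Y Z f r g := hom_ext (Linear.comp_smul _ _ _ _ _ _)

variable (C) in
/-- The forgetful functor from right comodules to right `A`-modules. -/
def forget : RComod C ⥤ Bimodule k k A where
  obj X := X.obj
  map f := f.hom

end RComod

variable {B : Type u} [Ring B] [Algebra k B]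

/-- A `C`-`D`-bicomodule: an `A`-`B`-bimodule with a left `C`-comodule structure and a right
`D`-comodule structure which commute, both given by morphisms of bimodules. -/
structure Bicomod (C : Coring k A) (D : Coring k B) where
  /-- the underlying bimodule -/
  obj : Bimodule k A B
  /-- the left coaction -/
  lcoact : obj ⟶ tensor C.obj obj
  /-- the right coaction -/
  rcoact : obj ⟶ tensor obj D.obj
  lcoassoc : lcoact ≫ tmap C.comul (𝟙 obj) ≫ assocHom C.obj C.obj obj
    = lcoact ≫ tmap (𝟙 C.obj) lcoact
  lcounit : lcoact ≫ tmap C.counit (𝟙 obj) ≫ lUnit obj = 𝟙 obj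
  rcoassoc : rcoact ≫ tmap rcoact (𝟙 D.obj) ≫ assocHom obj D.obj D.obj
    = rcoact ≫ tmap (𝟙 obj) D.comul
  rcounit : rcoact ≫ tmap (𝟙 obj) D.counit ≫ rUnit obj = 𝟙 obj
  bicomod : rcoact ≫ tmap lcoact (𝟙 D.obj) ≫ assocHom C.obj obj D.obj
    = lcoact ≫ tmap (𝟙 C.obj) rcoact

namespace Bicomod

variable {C : Coring k A} {D : Coring k B} (M : Bicomod C D)

/-! ### The tensor product functor -/

/-- The right `D`-coaction on `X ⊗_A M`. -/
def tensorCoact (X : Bimodule k k A) : tensor X M.obj ⟶ tensor (tensor X M.obj) D.obj :=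
  tmap (𝟙 X) M.rcoact ≫ assocInv X M.obj D.obj

theorem tensorCoact_coassoc (X : Bimodule k k A) :
    M.tensorCoact X ≫ tmap (M.tensorCoact X) (𝟙 D.obj) ≫ assocHom _ D.obj D.obj
      = M.tensorCoact X ≫ tmap (𝟙 _) D.comul := by
  unfold tensorCoact
  rw [tmap_comp_left]
  simp only [Category.assoc]
  rw [← Category.assoc (assocInv _ _ _) (tmap (tmap _ _) _), assocInv_naturality]
  simp only [Category.assoc]
  rw [pentagonAux, ← Category.assoc, ← Category.assoc, ← tmap_comp_right, ← Category.assoc,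
    ← tmap_comp_right, Category.assoc, M.rcoassoc, ← tmap_id X M.obj, tmap_comp_right,
    Category.assoc, Category.assoc, assocInv_naturality]

theorem tensorCoact_counit (X : Bimodule k k A) :
    M.tensorCoact X ≫ tmap (𝟙 _) D.counit ≫ rUnit _ = 𝟙 _ := by
  unfold tensorCoact
  simp only [Category.assoc]
  rw [← tmap_id X M.obj, ← Category.assoc (assocInv _ _ _), assocInv_naturality, Category.assoc,
    triangleAux, ← tmap_comp_right, ← tmap_comp_right, M.rcounit]

theorem tensorCoact_naturality {X Y : Bimodule k k A} (f : X ⟶ Y) :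
    M.tensorCoact X ≫ tmap (tmap f (𝟙 M.obj)) (𝟙 D.obj) = tmap f (𝟙 M.obj) ≫ M.tensorCoact Y := by
  unfold tensorCoact
  rw [Category.assoc, assocInv_naturality, tmap_id, ← Category.assoc, ← Category.assoc,
    tmap_exchange]

/-- The right `D`-comodule `X ⊗_A M`. -/
def tensorObj (X : Bimodule k k A) : RComod D where
  obj := tensor X M.obj
  coact := M.tensorCoact X
  coassoc := M.tensorCoact_coassoc X
  counit := M.tensorCoact_counit X

/-- The functor `- ⊗_A M` from right `A`-modules to right `D`-comodules. -/
def tensorFunctor : Bimodule k k A ⥤ RComod D where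
  obj := M.tensorObj
  map f := ⟨tmap f (𝟙 M.obj), M.tensorCoact_naturality f⟩
  map_id X := RComod.hom_ext (tmap_id _ _)
  map_comp f g := RComod.hom_ext (tmap_comp_left _ _ _)

/-! ### The cotensor product -/

/-- The map `ω = ρ_X ⊗ M - X ⊗ λ_M : X ⊗_A M ⟶ X ⊗_A C ⊗_A M`. -/
def omega (X : RComod C) : tensor X.obj M.obj ⟶ tensor X.obj (tensor C.obj M.obj) :=
  tmap X.coact (𝟙 M.obj) ≫ assocHom X.obj C.obj M.obj - tmap (𝟙 X.obj) M.lcoact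

theorem omega_naturality {X Y : RComod C} (f : X ⟶ Y) :
    tmap f.hom (𝟙 M.obj) ≫ M.omega Y = M.omega X ≫ tmap f.hom (𝟙 _) := by
  unfold omega
  rw [Preadditive.comp_sub, Preadditive.sub_comp, tmap_exchange, ← Category.assoc,
    ← tmap_comp_left, ← f.comm, tmap_comp_left, Category.assoc, Category.assoc,
    ← assocHom_naturality, tmap_id]

/-- The cotensor product `X □_C M`, a right `B`-module. -/
def cotensorModule (X : RComod C) : Bimodule k k B := ker (M.omega X)

/-- The inclusion of `X □_C M` in `X ⊗_A M`. -/
def cotensorι (X : RComod C) : M.cotensorModule X ⟶ tensor X.obj M.obj := kerι (M.omega X)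

theorem cotensorι_omega (X : RComod C) : M.cotensorι X ≫ M.omega X = 0 := kerι_comp _

/-- The map `f □_C M`. -/
def cotensorMap {X Y : RComod C} (f : X ⟶ Y) : M.cotensorModule X ⟶ M.cotensorModule Y :=
  kerLift (M.omega Y) (M.cotensorι X ≫ tmap f.hom (𝟙 M.obj)) (by
    rw [Category.assoc, omega_naturality, ← Category.assoc, cotensorι_omega, zero_comp])

theorem cotensorMap_ι {X Y : RComod C} (f : X ⟶ Y) :
    M.cotensorMap f ≫ M.cotensorι Y = M.cotensorι X ≫ tmap f.hom (𝟙 M.obj) := rfl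

/-- The functor `- □_C M` from right `C`-comodules to right `B`-modules. -/
def cotensorModuleFunctor : RComod C ⥤ Bimodule k k B where
  obj := M.cotensorModule
  map f := M.cotensorMap f
  map_id X := eq_of_comp_injective (M.cotensorι X) (kerι_injective (M.omega X)) (by
    rw [cotensorMap_ι, RComod.id_hom, tmap_id, Category.id_comp, Category.comp_id])
  map_comp {X Y Z} f g := eq_of_comp_injective (M.cotensorι Z) (kerι_injective (M.omega Z)) (by
    rw [cotensorMap_ι, Category.assoc, cotensorMap_ι, ← Category.assoc, cotensorMap_ι,
      RComod.comp_hom, tmap_comp_left, Category.assoc])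

/-- `M` is coflat as a left `C`-comodule: the functor `- □_C M` from right `C`-comodules to
`k`-modules is exact. It depends on the left `C`-comodule `M` only. -/
def IsCoflat : Prop :=
  PreservesFiniteLimits (M.cotensorModuleFunctor ⋙ forgetToModuleCat k B) ∧
    PreservesFiniteColimits (M.cotensorModuleFunctor ⋙ forgetToModuleCat k B)

/-- The purity which makes `X □_C M` a right `D`-comodule for every right `C`-comodule `X`. -/
structure HasCotensor : Prop where
  pure : ∀ X : RComod C, IsPure (M.omega X) D.obj
  injective : ∀ X : RComod C,
    Function.Injective (tmap (tmap (M.cotensorι X) (𝟙 D.obj)) (𝟙 D.obj))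

variable {M}

theorem omega_coact (X : RComod C) : M.tensorCoact X.obj ≫ tmap (M.omega X) (𝟙 D.obj) =
    M.omega X ≫ tmap (𝟙 X.obj) (tmap (𝟙 C.obj) M.rcoact ≫ assocInv C.obj M.obj D.obj) ≫
      assocInv X.obj (tensor C.obj M.obj) D.obj := by
  have hb : M.rcoact ≫ tmap M.lcoact (𝟙 D.obj)
      = M.lcoact ≫ tmap (𝟙 C.obj) M.rcoact ≫ assocInv C.obj M.obj D.obj := by
    rw [← Category.assoc, ← M.bicomod, Category.assoc, Category.assoc, assocHom_assocInv,
      Category.comp_id]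
  unfold omega tensorCoact
  rw [tmap_sub_left, Preadditive.comp_sub, Preadditive.sub_comp]
  congr 1
  · rw [tmap_comp_left, Category.assoc, ← Category.assoc (assocInv _ _ _), assocInv_naturality,
      Category.assoc, pentagonAux', tmap_id, ← Category.assoc, ← tmap_exchange]
    simp only [Category.assoc]
    rw [← tmap_id X.obj C.obj, ← Category.assoc (tmap (tmap _ _) _) (assocHom _ _ _),
      ← assocHom_naturality, tmap_comp_right]
    simp only [Category.assoc]
  · rw [Category.assoc, assocInv_naturality, ← Category.assoc, ← Category.assoc, ← tmap_comp_right,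
      ← tmap_comp_right, hb]

/-- The right `D`-coaction on `X □_C M`: the restriction of the coaction on `X ⊗_A M`. -/
noncomputable def HasCotensor.cotensorCoact (h : M.HasCotensor) (X : RComod C) :
    M.cotensorModule X ⟶ tensor (M.cotensorModule X) D.obj :=
  (h.pure X).lift (M.cotensorι X ≫ M.tensorCoact X.obj) (by
    rw [Category.assoc, omega_coact, ← Category.assoc, cotensorι_omega, zero_comp])

theorem HasCotensor.cotensorCoact_ι (h : M.HasCotensor) (X : RComod C) :
    h.cotensorCoact X ≫ tmap (M.cotensorι X) (𝟙 D.obj) = M.cotensorι X ≫ M.tensorCoact X.obj :=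
  (h.pure X).lift_comp _ _

theorem HasCotensor.cotensorCoact_coassoc (h : M.HasCotensor) (X : RComod C) :
    h.cotensorCoact X ≫ tmap (h.cotensorCoact X) (𝟙 D.obj) ≫ assocHom _ D.obj D.obj
      = h.cotensorCoact X ≫ tmap (𝟙 _) D.comul := by
  have hc := h.cotensorCoact_ι X
  have key : h.cotensorCoact X ≫ tmap (h.cotensorCoact X) (𝟙 D.obj)
      = h.cotensorCoact X ≫ tmap (𝟙 _) D.comul ≫ assocInv _ D.obj D.obj := by
    refine eq_of_comp_injective _ (h.injective X) ?_
    have h1 : M.tensorCoact X.obj ≫ tmap (M.tensorCoact X.obj) (𝟙 D.obj) =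
        M.tensorCoact X.obj ≫ tmap (𝟙 _) D.comul ≫ assocInv _ D.obj D.obj := by
      rw [← Category.assoc _ _ (assocInv _ _ _), ← M.tensorCoact_coassoc X.obj]
      simp only [Category.assoc]
      rw [assocHom_assocInv, Category.comp_id]
    simp only [Category.assoc]
    rw [assocInv_naturality, ← tmap_comp_left, hc, tmap_comp_left, ← Category.assoc, hc,
      Category.assoc, h1, tmap_id, ← Category.assoc (tmap (𝟙 _) D.comul), ← tmap_exchange,
      Category.assoc, ← Category.assoc (h.cotensorCoact X), hc, Category.assoc]
  rw [← Category.assoc, key]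
  simp only [Category.assoc]
  rw [assocInv_assocHom, Category.comp_id]

theorem HasCotensor.cotensorCoact_counit (h : M.HasCotensor) (X : RComod C) :
    h.cotensorCoact X ≫ tmap (𝟙 _) D.counit ≫ rUnit _ = 𝟙 _ := by
  refine eq_of_comp_injective (M.cotensorι X) (kerι_injective (M.omega X)) ?_
  simp only [Category.assoc]
  rw [← rUnit_naturality, ← Category.assoc (tmap _ _), ← tmap_exchange, Category.assoc,
    ← Category.assoc, h.cotensorCoact_ι X, Category.assoc, M.tensorCoact_counit, Category.comp_id,
    Category.id_comp]

theorem HasCotensor.cotensorCoact_naturality (h : M.HasCotensor) {X Y : RComod C} (f : X ⟶ Y) :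
    h.cotensorCoact X ≫ tmap (M.cotensorMap f) (𝟙 D.obj)
      = M.cotensorMap f ≫ h.cotensorCoact Y := by
  refine eq_of_comp_injective (tmap (M.cotensorι Y) (𝟙 D.obj)) (h.pure Y).injective ?_
  rw [Category.assoc, Category.assoc, h.cotensorCoact_ι, ← tmap_comp_left, cotensorMap_ι,
    tmap_comp_left, ← Category.assoc, h.cotensorCoact_ι, ← Category.assoc, cotensorMap_ι,
    Category.assoc, Category.assoc, tensorCoact_naturality]

/-- The right `D`-comodule `X □_C M`. -/
noncomputable def HasCotensor.cotensorObj (h : M.HasCotensor) (X : RComod C) : RComod D where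
  obj := M.cotensorModule X
  coact := h.cotensorCoact X
  coassoc := h.cotensorCoact_coassoc X
  counit := h.cotensorCoact_counit X

/-- The functor `- □_C M` from right `C`-comodules to right `D`-comodules. -/
noncomputable def HasCotensor.cotensorFunctor (h : M.HasCotensor) : RComod C ⥤ RComod D where
  obj := h.cotensorObj
  map f := ⟨M.cotensorMap f, h.cotensorCoact_naturality f⟩
  map_id X := RComod.hom_ext (M.cotensorModuleFunctor.map_id X)
  map_comp f g := RComod.hom_ext (M.cotensorModuleFunctor.map_comp f g)

end Bicomod

end Comodules

end Corings

open Corings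

/-! This is an Eilenberg–Watts theorem for comodules. The bicomodule representing F is M = F(C).
Left multiplications on C are right colinear, so F turns them into a left A-action on F(C), and
k-linearity of F makes k act centrally. For a right A-module X, the colinear maps c ↦ x ⊗ c induce a
natural map X ⊗ F(C) → F(X ⊗ C), `imageMap`, which is bijective at X = A. If it is bijective for
every X (`IsTensorial`), then F(Δ) read through it is a left coaction on F(C), and the axioms of a
bicomodule are images under F of identities satisfied by Δ.

Both sides of `imageMap` are functors of X, and - ⊗ F(C) and the cofree functor preserve colimits.
Bijectivity therefore spreads from A to all X: through cokernels of maps of free modules if F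
preserves colimits, through retracts of free modules if A is semisimple and F preserves coproducts,
and, over a von Neumann regular ring, through filtered colimits of retracts of free modules if F
preserves filtered colimits.

Every comodule X is the equalizer of ρ ⊗ C and X ⊗ Δ, two maps X ⊗ C → X ⊗ C ⊗ C. If F keeps this
equalizer (`PreservesCoactFork`), then F(X) is the kernel of F(ρ ⊗ C) - F(X ⊗ Δ). The identification
above carries this difference to ω (`omega_iso_hom`), so F(X) is X □ F(C). For flat D, left
exactness of F is enough; for coseparable C the fork is split in comodules, and any functor keeps
it.

Conversely, X □ M is the kernel of a transformation between functors of X that preserve colimits.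
Filtered colimits of modules commute with kernels, so - □ M preserves filtered colimits and, being
additive, coproducts; together with cokernels this gives all colimits. Over a regular ring all
modules are flat, which gives left exactness. The purity needed for the D-coaction comes from
flatness of D, or from a contraction of ω built out of a colinear retraction of ρ when C is
coseparable. For C = A the coaction is an isomorphism, so F(X) is X ⊗ F(A), and the adjoint functor
theorem supplies a right adjoint. -/

namespace Corings

namespace Bimodule

/-! ### Right modules as a category, and tensor-hom adjunction -/

section RightModules

variable {k : Type u} [CommRing k] {A B : Type u} [Ring A] [Algebra k A] [Ring B] [Algebra k B]

theorem tm_zero {S : Type u} [Ring S] [Algebra k S] {X : Bimodule k S A} {Y : Bimodule k A B}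
    (x : X) : tm x (0 : Y) = 0 := by
  simpa using tm_add x (0 : Y) 0

theorem zero_tm {S : Type u} [Ring S] [Algebra k S] {X : Bimodule k S A} {Y : Bimodule k A B}
    (y : Y) : tm (0 : X) y = 0 := by
  simpa using add_tm (0 : X) 0 y

/-- A right linear map of right modules is automatically `k`-linear. -/
def rightHom {X Y : Bimodule k k B} (f : X →+ Y) (hr : ∀ (b : B) x, f (op b • x) = op b • f x) :
    X ⟶ Y :=
  homMk f (fun r x => by
    have h1 := X.central r x
    have h2 := Y.central r (f x)
    rw [Algebra.algebraMap_self_apply] at h1 h2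
    rw [h1, h2, hr]) hr

@[simp] theorem rightHom_apply {X Y : Bimodule k k B} (f : X →+ Y)
    (hr : ∀ (b : B) x, f (op b • x) = op b • f x) (x : X) : rightHom f hr x = f x := rfl

variable (k) in
/-- A right `B`-module, with the action of `k` through `B`. -/
def ofRight (X : Type u) [AddCommGroup X] [Module Bᵐᵒᵖ X] : Bimodule k k B :=
  letI : Module k X := Module.compHom X (algebraMap k Bᵐᵒᵖ)
  { carrier := X
    smulComm := ⟨fun r b x => by
      change algebraMap k Bᵐᵒᵖ r • b • x = b • algebraMap k Bᵐᵒᵖ r • x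
      rw [← mul_smul, ← mul_smul, Algebra.commutes]⟩
    central := fun _ _ => rfl }

variable (k B) in
/-- Right `B`-modules as modules over the opposite ring. -/
def toModuleCat : Bimodule k k B ⥤ ModuleCat.{u} Bᵐᵒᵖ where
  obj X := ModuleCat.of Bᵐᵒᵖ X
  map f := ModuleCat.ofHom (Hom.rightLin f)

instance : (toModuleCat k B).Faithful where
  map_injective h := hom_ext fun x => congrArg (fun e => e.hom x) h

instance : (toModuleCat k B).Full where
  map_surjective {X Y} f := ⟨rightHom (X := X) (Y := Y) f.hom.toAddMonoidHom
    (fun b x => map_smul f.hom (op b) x), rfl⟩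

instance : (toModuleCat k B).EssSurj where
  mem_essImage X := ⟨ofRight k X, ⟨Iso.refl _⟩⟩

instance : (toModuleCat k B).IsEquivalence where

instance : HasColimits (Bimodule k k B) :=
  Adjunction.has_colimits_of_equivalence (toModuleCat k B)

instance : HasLimits (Bimodule k k B) :=
  Adjunction.has_limits_of_equivalence (toModuleCat k B)

instance : HasFiniteBiproducts (Bimodule k k B) := HasFiniteBiproducts.of_hasFiniteProducts

instance : HasBinaryBiproducts (Bimodule k k B) := hasBinaryBiproducts_of_finite_biproducts _

/-- Forgetting the action of `k` or of `B` gives the same abelian group. -/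
def forgetToModuleCatIso : forgetToModuleCat k B ⋙ forget₂ (ModuleCat.{u} k) AddCommGrpCat ≅
    toModuleCat k B ⋙ forget₂ (ModuleCat.{u} Bᵐᵒᵖ) AddCommGrpCat :=
  NatIso.ofComponents (fun _ => Iso.refl _) (fun _ => rfl)

/-- Limits of right B-modules and of k-modules are both computed on the underlying abelian groups,
and the passage from k-modules to abelian groups reflects them. -/
instance : PreservesLimits (forgetToModuleCat k B) :=
  haveI : PreservesLimits (forgetToModuleCat k B ⋙ forget₂ (ModuleCat.{u} k) AddCommGrpCat) :=
    preservesLimits_of_natIso forgetToModuleCatIso.symm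
  preservesLimits_of_reflects_of_preserves _ (forget₂ (ModuleCat.{u} k) AddCommGrpCat)

instance : PreservesColimits (forgetToModuleCat k B) :=
  haveI : PreservesColimits (forgetToModuleCat k B ⋙ forget₂ (ModuleCat.{u} k) AddCommGrpCat) :=
    preservesColimits_of_natIso forgetToModuleCatIso.symm
  haveI : ReflectsColimits (forget₂ (ModuleCat.{u} k) AddCommGrpCat) :=
    reflectsColimits_of_reflectsIsomorphisms
  preservesColimits_of_reflects_of_preserves _ (forget₂ (ModuleCat.{u} k) AddCommGrpCat)

theorem isIso_of_bijective {X Y : Bimodule k A B} (f : X ⟶ Y) (hf : Function.Bijective f) :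
    IsIso f := by
  let e := AddEquiv.ofBijective (f.toLin : X →+ Y) hf
  have he : ∀ y, f (e.symm y) = y := e.apply_symm_apply
  refine ⟨homMk (X := Y) (Y := X) e.symm.toAddMonoidHom (fun a y => hf.1 ?_) (fun a y => hf.1 ?_),
    hom_ext fun x => e.symm_apply_apply x, hom_ext fun y => e.apply_symm_apply y⟩
  · change f (e.symm _) = f (a • e.symm y)
    rw [he, hom_smul, he]
  · change f (e.symm _) = f (op a • e.symm y)
    rw [he, hom_rsmul, he]

theorem bijective_of_isIso {X Y : Bimodule k A B} (f : X ⟶ Y) [IsIso f] :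
    Function.Bijective f :=
  Function.bijective_iff_has_inverse.2 ⟨inv f,
    fun x => congrArg (fun e : X ⟶ X => e x) (IsIso.hom_inv_id f),
    fun y => congrArg (fun e : Y ⟶ Y => e y) (IsIso.inv_hom_id f)⟩

instance : (forgetToModuleCat k B).ReflectsIsomorphisms where
  reflects f _ := isIso_of_bijective f
    ((ConcreteCategory.isIso_iff_bijective ((forgetToModuleCat k B).map f)).1 inferInstance)

/-- The restriction of the left action to `k`. -/
def res (X : Bimodule k A B) : Bimodule k k B :=
  letI : Module k X := Module.compHom X (algebraMap k A)
  { carrier := X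
    smulComm := ⟨fun r b x => smul_comm (algebraMap k A r) b x⟩
    central := fun r x => X.central r x }

/-! ### The tensor product functor and its right adjoint -/

/-- The functor `- ⊗_A Z` from right `A`-modules to right `B`-modules. -/
def tensorRight (Z : Bimodule k A B) : Bimodule k k A ⥤ Bimodule k k B where
  obj X := tensor X Z
  map f := tmap f (𝟙 Z)
  map_id X := tmap_id X Z
  map_comp f g := tmap_comp_left Z f g

instance (Z : Bimodule k A B) : (tensorRight Z).Additive where
  map_add {_ _ f g} := tmap_add_left Z f g

/-- The action `(f a)(z) = f (a z)` of `A` on the right linear maps out of a bimodule. -/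
instance homRightModule (Z : Bimodule k A B) (Y : Bimodule k k B) :
    Module Aᵐᵒᵖ (Z →ₗ[Bᵐᵒᵖ] Y) where
  smul a f := f.comp (DistribSMul.toLinearMap Bᵐᵒᵖ Z a.unop)
  one_smul f := LinearMap.ext fun z => congrArg f (one_smul A z)
  mul_smul a a' f := LinearMap.ext fun z => congrArg f (mul_smul a'.unop a.unop z)
  smul_zero _ := rfl
  smul_add _ _ _ := rfl
  add_smul a a' f := LinearMap.ext fun z =>
    (congrArg f (add_smul a.unop a'.unop z)).trans (map_add f _ _)
  zero_smul f := LinearMap.ext fun z => (congrArg f (zero_smul A z)).trans (map_zero f)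

/-- The right `A`-module of right `B`-linear maps from an `A`-`B`-bimodule. -/
def homRight (Z : Bimodule k A B) (Y : Bimodule k k B) : Bimodule k k A :=
  ofRight k (Z →ₗ[Bᵐᵒᵖ] Y)

/-- The linear map underlying an element of `homRight Z Y`. -/
def homRight.toLin {Z : Bimodule k A B} {Y : Bimodule k k B} (g : homRight Z Y) :
    Z →ₗ[Bᵐᵒᵖ] Y := g

/-- The value at `x` of the right `A`-linear map corresponding to a map out of `X ⊗_A Z`. -/
def curryAux {Z : Bimodule k A B} {X : Bimodule k k A} {Y : Bimodule k k B} (f : tensor X Z ⟶ Y)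
    (x : X) : Z →ₗ[Bᵐᵒᵖ] Y where
  toFun z := f (tm x z)
  map_add' z z' := by rw [tm_add, hom_add]
  map_smul' b z := by rw [← smul_tm', hom_rsmul]; rfl

/-- The right `A`-linear map corresponding to a map out of `X ⊗_A Z`. -/
def curry {Z : Bimodule k A B} {X : Bimodule k k A} {Y : Bimodule k k B} (f : tensor X Z ⟶ Y) :
    X ⟶ homRight Z Y :=
  rightHom (X := X) (Y := homRight Z Y)
    (AddMonoidHom.mk' (fun x => curryAux f x) (fun x x' => LinearMap.ext fun z => by
      change f (tm (x + x') z) = f (tm x z) + f (tm x' z)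
      rw [add_tm, hom_add]))
    (fun a x => LinearMap.ext fun z => by
      change f (tm (op a • x) z) = f (tm x (a • z))
      rw [rsmul_tm])

/-- The map out of `X ⊗_A Z` corresponding to a right `A`-linear map. -/
def uncurry {Z : Bimodule k A B} {X : Bimodule k k A} {Y : Bimodule k k B} (g : X ⟶ homRight Z Y) :
    tensor X Z ⟶ Y :=
  rightHom (X := tensor X Z) (Y := Y)
    (tlift (fun x z => homRight.toLin (g x) z)
      (fun x x' z => by rw [hom_add]; rfl) (fun x z z' => map_add _ z z')
      (fun a x z => by rw [hom_rsmul]; rfl))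
    (fun b t => by
      induction t using tensor_induction with
      | tm x z =>
        rw [smul_tm', tlift_tm, tlift_tm]
        exact map_smul (homRight.toLin (g x)) (op b) z
      | zero => simp
      | add t t' ht ht' => rw [smul_add, map_add, map_add, smul_add, ht, ht'])

theorem uncurry_tm {Z : Bimodule k A B} {X : Bimodule k k A} {Y : Bimodule k k B}
    (g : X ⟶ homRight Z Y) (x : X) (z : Z) : uncurry g (tm x z) = homRight.toLin (g x) z :=
  by unfold uncurry; rw [rightHom_apply, tlift_tm]

/-- Right `B`-linear maps out of `X ⊗_A Z` are right `A`-linear maps into `Hom_B(Z, -)`. -/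
def tensorHomEquiv (Z : Bimodule k A B) (X : Bimodule k k A) (Y : Bimodule k k B) :
    (tensor X Z ⟶ Y) ≃ (X ⟶ homRight Z Y) where
  toFun := curry
  invFun := uncurry
  left_inv f := tensor_hom_ext fun x z => uncurry_tm (curry f) x z
  right_inv g := hom_ext fun x => LinearMap.ext fun z => uncurry_tm g x z

/-- The use of this adjunction is that - ⊗ Z preserves all colimits. -/
instance (Z : Bimodule k A B) : (tensorRight Z).IsLeftAdjoint :=
  (Adjunction.adjunctionOfEquivRight (F := tensorRight Z) (G_obj := homRight Z)
    (fun X Y => tensorHomEquiv Z X Y)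
    (fun X' X Y f g => hom_ext fun x => LinearMap.ext fun z => by
      change g (tmap f (𝟙 Z) (tm x z)) = g (tm (f x) z)
      rw [tmap_tm, Bimodule.id_apply])).isLeftAdjoint

end RightModules

end Bimodule

end Corings

/-! ### Comodules: the cofree adjunction and colimits -/

namespace Corings

open Bimodule

variable {k : Type u} [CommRing k] {A B : Type u} [Ring A] [Algebra k A] [Ring B] [Algebra k B]

/-- A coring as a bicomodule over itself. -/
def Bicomod.regular (C : Coring k A) : Bicomod C C where
  obj := C.obj
  lcoact := C.comul
  rcoact := C.comul
  lcoassoc := C.coassoc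
  lcounit := C.counit_left
  rcoassoc := C.coassoc
  rcounit := C.counit_right
  bicomod := C.coassoc

namespace RComod

variable {C : Coring k A}

/-- Coassociativity in the form that says that ρ is colinear from X to the cofree comodule X ⊗ C. -/
theorem coassoc' (X : RComod C) : X.coact ≫ tmap X.coact (𝟙 C.obj) =
    X.coact ≫ tmap (𝟙 X.obj) C.comul ≫ assocInv X.obj C.obj C.obj := by
  rw [← Category.assoc, ← X.coassoc]
  simp only [Category.assoc]
  rw [assocHom_assocInv, Category.comp_id]

theorem isIso_of_isIso_hom {X Y : RComod C} (f : X ⟶ Y) [IsIso f.hom] : IsIso f :=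
  ⟨⟨inv f.hom, by
      rw [IsIso.eq_inv_comp, ← Category.assoc, ← f.comm, Category.assoc, ← tmap_comp_left,
        IsIso.hom_inv_id, tmap_id, Category.comp_id]⟩,
    hom_ext (IsIso.hom_inv_id f.hom), hom_ext (IsIso.inv_hom_id f.hom)⟩

theorem isIso_of_bijective {X Y : RComod C} (f : X ⟶ Y) (hf : Function.Bijective f.hom) :
    IsIso f :=
  haveI := Bimodule.isIso_of_bijective f.hom hf
  isIso_of_isIso_hom f

instance : (forget C).ReflectsIsomorphisms where
  reflects f (_ : IsIso f.hom) := isIso_of_isIso_hom f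

instance : (forget C).Additive where
  map_add := rfl

variable (C) in
/-- The cofree comodule functor `- ⊗_A C`. -/
def cofree : Bimodule k k A ⥤ RComod C := (Bicomod.regular C).tensorFunctor

/-- The coaction as a morphism of comodules. -/
def coactHom (X : RComod C) : X ⟶ (cofree C).obj X.obj :=
  ⟨X.coact, X.coassoc'⟩

theorem coactHom_naturality {X Y : RComod C} (f : X ⟶ Y) :
    X.coactHom ≫ (cofree C).map f.hom = f ≫ Y.coactHom := RComod.hom_ext f.comm

variable (C) in
/-- The counit of the adjunction between the forgetful and the cofree functor. -/
def cofreeCounit (Y : Bimodule k k A) : tensor Y C.obj ⟶ Y := tmap (𝟙 Y) C.counit ≫ rUnit Y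

theorem coact_cofreeCounit (X : RComod C) : X.coact ≫ cofreeCounit C X.obj = 𝟙 _ := X.counit

theorem cofreeCounit_naturality {X Y : Bimodule k k A} (f : X ⟶ Y) :
    tmap f (𝟙 C.obj) ≫ cofreeCounit C Y = cofreeCounit C X ≫ f := by
  unfold cofreeCounit
  rw [← Category.assoc, tmap_exchange, Category.assoc, rUnit_naturality, Category.assoc]

/-- One of the triangle identities for the forgetful and cofree functors; it comes from the left
counit axiom of C, since y ε(c) ⊗ c' = y ⊗ ε(c) c'. -/
theorem tmap_cofreeCounit (Y : Bimodule k k A) :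
    (tmap (𝟙 Y) C.comul ≫ assocInv Y C.obj C.obj) ≫ tmap (cofreeCounit C Y) (𝟙 C.obj) = 𝟙 _ := by
  have h : assocInv Y C.obj C.obj ≫ tmap (cofreeCounit C Y) (𝟙 C.obj) =
      tmap (𝟙 Y) (tmap C.counit (𝟙 C.obj) ≫ lUnit C.obj) :=
    tensor_hom_ext₃' fun y c c' => by
      have h1 := rUnit_tm Y y (show A from C.counit c)
      have h2 := lUnit_tm C.obj (show A from C.counit c) c'
      simp only [Bimodule.comp_apply, assocInv_tm, tmap_tm, Bimodule.id_apply, cofreeCounit]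
      refine (congrArg (fun e => tm e c') h1).trans ((rsmul_tm _ _ _).trans ?_)
      exact congrArg (tm y) h2.symm
  rw [Category.assoc, h, ← tmap_comp_right, C.counit_left, tmap_id]

/-- The hypothesis is colinearity of g. A colinear map into a cofree comodule is thus recovered from
its composite with the counit. -/
theorem coact_tmap_comp_cofreeCounit (X : RComod C) {Y : Bimodule k k A}
    (g : X.obj ⟶ tensor Y C.obj)
    (h : X.coact ≫ tmap g (𝟙 C.obj) = g ≫ tmap (𝟙 Y) C.comul ≫ assocInv Y C.obj C.obj) :
    X.coact ≫ tmap (g ≫ cofreeCounit C Y) (𝟙 C.obj) = g := by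
  rw [tmap_comp_left, ← Category.assoc, h, Category.assoc, tmap_cofreeCounit, Category.comp_id]

/-- Comodule morphisms into a cofree comodule. -/
def cofreeEquiv (X : RComod C) (Y : Bimodule k k A) :
    (X.obj ⟶ Y) ≃ (X ⟶ (cofree C).obj Y) where
  toFun f := X.coactHom ≫ (cofree C).map f
  invFun g := g.hom ≫ cofreeCounit C Y
  left_inv f := by
    change (X.coact ≫ tmap f (𝟙 C.obj)) ≫ cofreeCounit C Y = f
    rw [Category.assoc, cofreeCounit_naturality, ← Category.assoc, coact_cofreeCounit,
      Category.id_comp]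
  right_inv g := RComod.hom_ext (by
    exact X.coact_tmap_comp_cofreeCounit g.hom g.comm)

variable (C) in
/-- The cofree functor is right adjoint to the forgetful functor. -/
def forgetAdj : forget C ⊣ cofree C :=
  Adjunction.mkOfHomEquiv
    { homEquiv := fun X Y => cofreeEquiv X Y
      homEquiv_naturality_left_symm := fun {X X' Y} f g =>
        (Category.assoc f.hom g.hom (cofreeCounit C Y) : _)
      homEquiv_naturality_right := fun {X Y Y'} f g =>
        (congrArg (X.coactHom ≫ ·) ((cofree C).map_comp (X := X.obj) f g)).trans
          (Category.assoc _ _ _).symm }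

instance : (forget C).IsLeftAdjoint := (forgetAdj C).isLeftAdjoint

variable {J : Type*} [Category J]

/-- Applied to the legs ι of a colimit of modules, which are jointly epimorphic: the module map
induced by colinear maps is then colinear. -/
theorem desc_comm {X Y Z : RComod C} {ι : X.obj ⟶ Y.obj} {f : X.obj ⟶ Z.obj} {d : Y.obj ⟶ Z.obj}
    (hι : X.coact ≫ tmap ι (𝟙 C.obj) = ι ≫ Y.coact) (hf : X.coact ≫ tmap f (𝟙 C.obj) = f ≫ Z.coact)
    (h : ι ≫ d = f) : ι ≫ Y.coact ≫ tmap d (𝟙 C.obj) = ι ≫ d ≫ Z.coact := by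
  rw [← Category.assoc, ← hι, ← Category.assoc, h, ← hf, Category.assoc, ← tmap_comp_left, h]

/-- A cocone of comodules which is a colimit of modules is a colimit of comodules. -/
def isColimitOfForget {K : J ⥤ RComod C} (c : Cocone K) (hc : IsColimit ((forget C).mapCocone c)) :
    IsColimit c where
  desc s := ⟨hc.desc ((forget C).mapCocone s), hc.hom_ext fun j =>
    desc_comm (c.ι.app j).comm (s.ι.app j).comm (hc.fac ((forget C).mapCocone s) j)⟩
  fac s j := RComod.hom_ext (hc.fac ((forget C).mapCocone s) j)
  uniq s m h := RComod.hom_ext (hc.uniq ((forget C).mapCocone s) m.hom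
    fun j => congrArg RComod.Hom.hom (h j))

instance : ReflectsColimitsOfShape J (forget C) where
  reflectsColimit := ⟨fun hc => ⟨isColimitOfForget _ hc⟩⟩

theorem comp_coact_comp_tmap {X Y : RComod C} (f : X ⟶ Y) {Z : Bimodule k k A} {ι : Y.obj ⟶ Z}
    {ι' : X.obj ⟶ Z} (h : f.hom ≫ ι = ι') :
    f.hom ≫ Y.coact ≫ tmap ι (𝟙 C.obj) = X.coact ≫ tmap ι' (𝟙 C.obj) := by
  rw [← Category.assoc, ← f.comm, Category.assoc, ← tmap_comp_left, h]

/-- The axioms for a coaction γ on a colimit may be tested on each leg ι, where they reduce to the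
axioms for X. The next lemma does the same for the counit. -/
theorem comp_coassoc_of_comm (X : RComod C) {Z : Bimodule k k A} {ι : X.obj ⟶ Z}
    {γ : Z ⟶ tensor Z C.obj} (h : ι ≫ γ = X.coact ≫ tmap ι (𝟙 C.obj)) :
    ι ≫ γ ≫ tmap γ (𝟙 C.obj) ≫ assocHom Z C.obj C.obj = ι ≫ γ ≫ tmap (𝟙 Z) C.comul := by
  rw [← Category.assoc, h, ← Category.assoc ι, h]
  simp only [Category.assoc]
  rw [tmap_exchange ι, ← Category.assoc (tmap _ _) (tmap _ _) (assocHom _ _ _),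
    ← tmap_comp_left, h, tmap_comp_left, Category.assoc, ← assocHom_naturality,
    tmap_id, ← Category.assoc (tmap X.coact _), ← Category.assoc X.coact, X.coassoc,
    Category.assoc]

theorem comp_counit_of_comm (X : RComod C) {Z : Bimodule k k A} {ι : X.obj ⟶ Z}
    {γ : Z ⟶ tensor Z C.obj} (h : ι ≫ γ = X.coact ≫ tmap ι (𝟙 C.obj)) :
    ι ≫ γ ≫ tmap (𝟙 Z) C.counit ≫ rUnit Z = ι ≫ 𝟙 Z := by
  have h1 := cofreeCounit_naturality (C := C) ι
  have h2 := X.coact_cofreeCounit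
  unfold cofreeCounit at h1 h2
  rw [← Category.assoc, h, Category.assoc, h1, ← Category.assoc, h2, Category.id_comp,
    Category.comp_id]

section Colimits

variable (K : J ⥤ RComod C) {c : Cocone (K ⋙ forget C)} (hc : IsColimit c)

/-- The coaction on the colimit of the underlying modules. -/
def colimitCoact : c.pt ⟶ tensor c.pt C.obj :=
  hc.desc ⟨tensor c.pt C.obj,
    { app := fun j => (K.obj j).coact ≫ tmap (X := (K.obj j).obj) (c.ι.app j) (𝟙 C.obj)
      naturality := fun _ _ f => (comp_coact_comp_tmap (K.map f) (c.w f)).trans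
        (Category.comp_id _).symm }⟩

theorem ι_colimitCoact (j : J) : c.ι.app j ≫ colimitCoact K hc =
    (K.obj j).coact ≫ tmap (X := (K.obj j).obj) (c.ι.app j) (𝟙 C.obj) :=
  hc.fac _ j

/-- The comodule structure on the colimit of the underlying modules. -/
def colimitObj : RComod C where
  obj := c.pt
  coact := colimitCoact K hc
  coassoc := hc.hom_ext fun j => comp_coassoc_of_comm (K.obj j) (ι_colimitCoact K hc j)
  counit := hc.hom_ext fun j => comp_counit_of_comm (K.obj j) (ι_colimitCoact K hc j)

/-- The colimit cocone of comodules. -/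
def colimitCocone : Cocone K where
  pt := colimitObj K hc
  ι := { app := fun j => ⟨c.ι.app j, (ι_colimitCoact K hc j).symm⟩
         naturality := fun i j f => RComod.hom_ext (c.ι.naturality f) }

/-- The colimit cocone of comodules is a colimit. -/
def colimitCoconeIsColimit : IsColimit (colimitCocone K hc) :=
  isColimitOfForget _ (IsColimit.ofIsoColimit hc (Cocone.ext (Iso.refl _)))

end Colimits

/-- No flatness is needed: a coaction maps out of the colimit, so it is induced by the universal
property of the colimit of modules. -/
instance : HasColimits (RComod C) where
  has_colimits_of_shape _ _ :=
    ⟨fun K => ⟨⟨⟨_, colimitCoconeIsColimit K (colimit.isColimit (K ⋙ forget C))⟩⟩⟩⟩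

instance : HasFiniteBiproducts (RComod C) := HasFiniteBiproducts.of_hasFiniteCoproducts

instance : HasBinaryBiproducts (RComod C) := hasBinaryBiproducts_of_finite_biproducts _

instance : HasZeroObject (RComod C) := Limits.hasZeroObject_of_hasInitial_object

end RComod

/-- The tensor product functor of a bicomodule preserves colimits. -/
theorem Bicomod.tensorFunctor_preservesColimits {C : Coring k A} {D : Coring k B}
    (M : Bicomod C D) : PreservesColimits M.tensorFunctor :=
  haveI : PreservesColimits (M.tensorFunctor ⋙ RComod.forget D) :=
    inferInstanceAs (PreservesColimits (tensorRight M.obj))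
  ⟨fun {_} _ => preservesColimitsOfShape_of_reflects_of_preserves _ (RComod.forget D)⟩

instance {C : Coring k A} : PreservesColimits (RComod.cofree C) :=
  Bicomod.tensorFunctor_preservesColimits _

end Corings

/-! ### Exactness of the balanced tensor product, and flatness -/

namespace Corings

namespace BalTensor

variable {R : Type u} [Ring R] {X Y Z W : Type u} [AddCommGroup X] [Module Rᵐᵒᵖ X]
  [AddCommGroup Y] [Module Rᵐᵒᵖ Y] [AddCommGroup Z] [Module R Z] [AddCommGroup W] [Module R W]

theorem map_map {X' Z' : Type u} [AddCommGroup X'] [Module Rᵐᵒᵖ X'] [AddCommGroup Z'] [Module R Z']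
    (f : X →ₗ[Rᵐᵒᵖ] Y) (f' : Y →ₗ[Rᵐᵒᵖ] X') (g : Z →ₗ[R] W) (g' : W →ₗ[R] Z')
    (t : BalTensor R X Z) : map f' g' (map f g t) = map (f' ∘ₗ f) (g' ∘ₗ g) t :=
  hom_ext (f := (map f' g').comp (map f g)) (fun x z => by simp) t

theorem map_zero_right (f : X →ₗ[Rᵐᵒᵖ] Y) (t : BalTensor R X Z) :
    map f (0 : Z →ₗ[R] W) t = 0 := by
  refine hom_ext (g := 0) (fun x z => ?_) t
  rw [map_tmul, LinearMap.zero_apply, AddMonoidHom.zero_apply]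
  simpa using tmul_add (f x) (0 : W) 0

/-- Right exactness of the tensor product in the first variable. -/
theorem exists_map_ker_left (g : X →ₗ[Rᵐᵒᵖ] Y) (hg : Function.Surjective g) (t : BalTensor R X Z)
    (ht : map g (LinearMap.id : Z →ₗ[R] Z) t = 0) :
    ∃ s : BalTensor R (LinearMap.ker g) Z, map (LinearMap.ker g).subtype LinearMap.id s = t := by
  let N := (map (LinearMap.ker g).subtype (LinearMap.id : Z →ₗ[R] Z)).range
  have key : ∀ (x x' : X) (z : Z), g x = g x' →
      (QuotientAddGroup.mk (tmul R x z) : BalTensor R X Z ⧸ N) =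
        QuotientAddGroup.mk (tmul R x' z) := fun x x' z h =>
    (QuotientAddGroup.eq_iff_sub_mem (N := N)).2
      ⟨tmul R (⟨x - x', by simp [h]⟩ : LinearMap.ker g) z, by
        rw [map_tmul, eq_sub_iff_add_eq, LinearMap.id_apply, ← add_tmul]
        simp⟩
  -- A set-theoretic section suffices: by `key`, changing the preimage does not change the class
  -- modulo N, so y ⊗ z ↦ c(y) ⊗ z becomes biadditive and balanced in the quotient.
  let c := Function.surjInv hg
  have hc : ∀ y, g (c y) = y := Function.surjInv_eq hg
  let φ : BalTensor R Y Z →+ BalTensor R X Z ⧸ N :=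
    lift (mkBiadd (fun y z => QuotientAddGroup.mk (tmul R (c y) z))
      (fun y y' z => by
        rw [← QuotientAddGroup.mk_add, ← add_tmul]
        exact key _ _ _ (by simp [hc]))
      (fun y z z' => by rw [tmul_add, QuotientAddGroup.mk_add]))
      (fun r y z => by
        change QuotientAddGroup.mk (tmul R (c (op r • y)) z) =
          QuotientAddGroup.mk (tmul R (c y) (r • z))
        rw [← smul_tmul]
        exact key _ _ _ (by simp [hc]))
  have hφ : φ (map g LinearMap.id t) = QuotientAddGroup.mk t :=
    hom_ext (f := φ.comp (map g LinearMap.id)) (g := QuotientAddGroup.mk' N) (fun x z => by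
      rw [AddMonoidHom.comp_apply, map_tmul]
      exact (lift_tmul _ _ _ _).trans (key _ _ _ (hc _))) t
  rw [ht, map_zero] at hφ
  exact (QuotientAddGroup.eq_zero_iff t).1 hφ.symm

/-- Right exactness of the tensor product in the second variable. -/
theorem exists_map_ker_right (g : Z →ₗ[R] W) (hg : Function.Surjective g) (t : BalTensor R X Z)
    (ht : map (LinearMap.id : X →ₗ[Rᵐᵒᵖ] X) g t = 0) :
    ∃ s : BalTensor R X (LinearMap.ker g), map LinearMap.id (LinearMap.ker g).subtype s = t := by
  let N := (map (LinearMap.id : X →ₗ[Rᵐᵒᵖ] X) (LinearMap.ker g).subtype).range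
  have key : ∀ (x : X) (z z' : Z), g z = g z' →
      (QuotientAddGroup.mk (tmul R x z) : BalTensor R X Z ⧸ N) =
        QuotientAddGroup.mk (tmul R x z') := fun x z z' h =>
    (QuotientAddGroup.eq_iff_sub_mem (N := N)).2
      ⟨tmul R x (⟨z - z', by simp [h]⟩ : LinearMap.ker g), by
        rw [map_tmul, eq_sub_iff_add_eq, LinearMap.id_apply, ← tmul_add]
        simp⟩
  let c := Function.surjInv hg
  have hc : ∀ y, g (c y) = y := Function.surjInv_eq hg
  let φ : BalTensor R X W →+ BalTensor R X Z ⧸ N :=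
    lift (mkBiadd (fun x w => QuotientAddGroup.mk (tmul R x (c w)))
      (fun x x' w => by rw [add_tmul, QuotientAddGroup.mk_add])
      (fun x w w' => by
        rw [← QuotientAddGroup.mk_add, ← tmul_add]
        exact key _ _ _ (by simp [hc])))
      (fun r x w => by
        change QuotientAddGroup.mk (tmul R (op r • x) (c w)) =
          QuotientAddGroup.mk (tmul R x (c (r • w)))
        rw [smul_tmul]
        exact key _ _ _ (by simp [hc]))
  have hφ : φ (map LinearMap.id g t) = QuotientAddGroup.mk t :=
    hom_ext (f := φ.comp (map LinearMap.id g)) (g := QuotientAddGroup.mk' N) (fun x z => by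
      rw [AddMonoidHom.comp_apply, map_tmul]
      exact (lift_tmul _ _ _ _).trans (key _ _ _ (hc _))) t
  rw [ht, map_zero] at hφ
  exact (QuotientAddGroup.eq_zero_iff t).1 hφ.symm

theorem map_right_surjective (g : Z →ₗ[R] W) (hg : Function.Surjective g) :
    Function.Surjective (map (LinearMap.id : X →ₗ[Rᵐᵒᵖ] X) g) := fun t => by
  induction t using induction_on with
  | tmul x w =>
    obtain ⟨z, rfl⟩ := hg w
    exact ⟨tmul R x z, map_tmul ..⟩
  | zero => exact ⟨0, map_zero _⟩
  | add s t hs ht =>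
    obtain ⟨s, rfl⟩ := hs
    obtain ⟨t, rfl⟩ := ht
    exact ⟨s + t, map_add ..⟩

/-- The map `X ⊗_R R^(ι) → X^(ι)`. -/
noncomputable def toFinsupp (R : Type u) [Ring R] (X : Type u) [AddCommGroup X] [Module Rᵐᵒᵖ X]
    (ι : Type u) : BalTensor R X (ι →₀ R) →+ (ι →₀ X) :=
  lift (mkBiadd (fun x v => v.mapRange (fun r => op r • x) (by simp))
    (fun x x' v => by ext; simp) (fun x v v' => by ext; simp [add_smul]))
    (fun r x v => Finsupp.ext fun i => by
      change op (v i) • op r • x = op ((r • v) i) • x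
      simp [mul_smul])

theorem toFinsupp_tmul_apply {ι : Type u} (x : X) (v : ι →₀ R) (i : ι) :
    toFinsupp R X ι (tmul R x v) i = op (v i) • x := by
  unfold toFinsupp
  rw [lift_tmul]
  rfl

/-- A left inverse sends x in coordinate i to x ⊗ eᵢ. -/
theorem toFinsupp_injective (ι : Type u) : Function.Injective (toFinsupp R X ι) := by
  classical
  let ψ : (ι →₀ X) →+ BalTensor R X (ι →₀ R) := Finsupp.liftAddHom fun i =>
    AddMonoidHom.mk' (fun x => tmul R x (Finsupp.single i (1 : R))) (fun x x' => add_tmul x x' _)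
  have hs : ∀ (x : X) (i : ι) (r : R), toFinsupp R X ι (tmul R x (Finsupp.single i r)) =
      Finsupp.single i (op r • x) := fun x i r => Finsupp.ext fun j => by
    rw [toFinsupp_tmul_apply]
    by_cases h : i = j
    · subst h; simp
    · simp [Finsupp.single_eq_of_ne' h]
  refine Function.LeftInverse.injective (g := ψ) fun t => ?_
  refine hom_ext (f := ψ.comp (toFinsupp R X ι)) (g := AddMonoidHom.id _) (fun x v => ?_) t
  rw [AddMonoidHom.comp_apply, AddMonoidHom.id_apply]
  induction v using Finsupp.induction_linear with
  | zero =>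
    have h : tmul R x (0 : ι →₀ R) = 0 := by simpa using tmul_add x (0 : ι →₀ R) 0
    rw [h, map_zero, map_zero]
  | add v w hv hw => rw [tmul_add, map_add, map_add, hv, hw]
  | single i r =>
    rw [hs, Finsupp.liftAddHom_apply_single]
    change tmul R (op r • x) (Finsupp.single i 1) = _
    rw [smul_tmul, Finsupp.smul_single, smul_eq_mul, mul_one]

end BalTensor

/-- Through the natural embedding of X ⊗ R^(ι) in X^(ι), the map f ⊗ id acts as f in each
coordinate. -/
theorem flatLeft_finsupp (R : Type u) [Ring R] (ι : Type u) : FlatLeft R (ι →₀ R) := by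
  intro X Y _ _ _ _ f hf
  refine (injective_iff_map_eq_zero _).2 fun t ht => BalTensor.toFinsupp_injective ι ?_
  have h : ∀ t, BalTensor.toFinsupp R Y ι (BalTensor.map f LinearMap.id t) =
      (BalTensor.toFinsupp R X ι t).mapRange f (map_zero f) := fun t => by
    refine BalTensor.hom_ext (f := (BalTensor.toFinsupp R Y ι).comp (BalTensor.map f LinearMap.id))
      (g := (Finsupp.mapRange.addMonoidHom (f : X →+ Y)).comp (BalTensor.toFinsupp R X ι))
      (fun x v => Finsupp.ext fun i => ?_) t
    rw [AddMonoidHom.comp_apply, BalTensor.map_tmul, AddMonoidHom.comp_apply,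
      BalTensor.toFinsupp_tmul_apply]
    change _ = f (BalTensor.toFinsupp R X ι (BalTensor.tmul R x v) i)
    rw [BalTensor.toFinsupp_tmul_apply, map_smul]
    rfl
  have h1 := h t
  rw [ht, map_zero] at h1
  rw [map_zero]
  refine Finsupp.ext fun i => hf ?_
  have h2 := DFunLike.congr_fun h1 i
  simpa using h2.symm

/-! ### Von Neumann regular rings -/

namespace IsVonNeumannRegular

variable {R : Type u} [Ring R]

/-- Needed because right A-modules are handled as left modules over the opposite ring. -/
theorem mulOpposite (hR : IsVonNeumannRegular R) : IsVonNeumannRegular Rᵐᵒᵖ := fun a => by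
  obtain ⟨x, hx⟩ := hR a.unop
  exact ⟨op x, unop_injective (by simpa [mul_assoc] using hx)⟩

/-- Every element of a free module over a von Neumann regular ring is regular. -/
theorem exists_smul_eq (hR : IsVonNeumannRegular R) {ι : Type u} (v : ι →₀ R) :
    ∃ φ : (ι →₀ R) →ₗ[R] R, φ v • v = v := by
  classical
  suffices H : ∀ (s : Finset ι) (v : ι →₀ R), v.support ⊆ s →
      ∃ φ : (ι →₀ R) →ₗ[R] R, φ v • v = v from H _ v subset_rfl
  intro s
  induction s using Finset.induction_on with
  | empty =>
    intro v hv
    have : v = 0 := by simpa using hv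
    exact ⟨0, by simp [this]⟩
  | insert i s hi ih =>
    intro v hv
    obtain ⟨y, hy⟩ := hR (v i)
    obtain ⟨φ, hφ⟩ := ih (v - (v i * y) • v) (fun j hj => by
      by_contra hjs
      refine Finsupp.mem_support_iff.1 hj ?_
      by_cases hji : j = i
      · subst hji; simp [hy]
      · have : v j = 0 := by
          by_contra hne
          exact (Finset.mem_insert.1 (hv (Finsupp.mem_support_iff.2 hne))).elim hji hjs
        simp [this])
    let μ : (ι →₀ R) →ₗ[R] R := (LinearMap.toSpanSingleton R R y).comp (Finsupp.lapply i)
    -- With vᵢ y vᵢ = vᵢ, the vector w = v - vᵢ y v has no i-th coordinate, and φ(w) w = w by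
    -- induction. The new functional takes the value vᵢ y + φ(w)(1 - vᵢ y) at v, and this scalar
    -- sends v to vᵢ y v + φ(w) w = v.
    refine ⟨μ + (LinearMap.toSpanSingleton R R (1 - v i * y)).comp
      (φ.comp (LinearMap.id - (LinearMap.toSpanSingleton R _ v).comp μ)), ?_⟩
    change (v i * y + φ (v - (v i * y) • v) * (1 - v i * y)) • v = v
    rw [add_smul, mul_smul (φ _), sub_smul, one_smul, hφ]
    abel

/-- A finitely generated submodule of a free module over a von Neumann regular ring is a direct
summand. -/
theorem exists_projection (hR : IsVonNeumannRegular R) {ι : Type u} (T : Finset (ι →₀ R)) :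
    ∃ e : (ι →₀ R) →ₗ[R] (ι →₀ R), (∀ v, e v ∈ Submodule.span R (T : Set (ι →₀ R))) ∧
      ∀ t ∈ T, e t = t := by
  classical
  induction T using Finset.induction_on with
  | empty => exact ⟨0, by simp⟩
  | insert t T _ ih =>
    obtain ⟨e, he, heT⟩ := ih
    obtain ⟨φ, hφ⟩ := hR.exists_smul_eq (t - e t)
    have hsub : Submodule.span R (T : Set (ι →₀ R)) ≤ Submodule.span R (insert t T : Finset _) :=
      Submodule.span_mono (by simp)
    -- The correction v ↦ φ(v - e v)(t - e t) vanishes on T, where e is the identity, and adds the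
    -- missing t - e t at t.
    refine ⟨e + (LinearMap.toSpanSingleton R _ (t - e t)).comp (φ.comp (LinearMap.id - e)),
      fun v => ?_, fun s hs => ?_⟩
    · refine add_mem (hsub (he v)) (Submodule.smul_mem _ _ (sub_mem ?_ (hsub (he t))))
      exact Submodule.subset_span (by simp)
    · change e s + φ (s - e s) • (t - e t) = s
      rcases Finset.mem_insert.1 hs with rfl | hs
      · rw [hφ]; abel
      · simp [heT s hs]

/-- Every module over a von Neumann regular ring is flat. -/
theorem flatLeft (hR : IsVonNeumannRegular R) (N : Type u) [AddCommGroup N] [Module R N] :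
    FlatLeft R N := by
  classical
  intro X Y _ _ _ _ f hf
  let g : (N →₀ R) →ₗ[R] N := Finsupp.linearCombination R id
  have hg : Function.Surjective g := fun n => ⟨Finsupp.single n 1, by simp [g]⟩
  refine (injective_iff_map_eq_zero _).2 fun t ht => ?_
  obtain ⟨t, rfl⟩ := BalTensor.map_right_surjective g hg t
  rw [BalTensor.map_map] at ht
  obtain ⟨s, hs⟩ := BalTensor.exists_map_ker_right g hg (BalTensor.map f LinearMap.id t) (by
    rw [BalTensor.map_map]; exact ht)
  -- A tensor in Y ⊗ ker g involves finitely many elements of ker g; an endomorphism fixing these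
  -- fixes the image of the tensor in Y ⊗ R^(N).
  have hT : ∃ T : Finset (N →₀ R), (∀ x ∈ T, g x = 0) ∧
      ∀ e : (N →₀ R) →ₗ[R] (N →₀ R), (∀ x ∈ T, e x = x) →
        BalTensor.map (LinearMap.id : Y →ₗ[Rᵐᵒᵖ] Y) (e ∘ₗ (LinearMap.ker g).subtype) s =
          BalTensor.map LinearMap.id (LinearMap.ker g).subtype s := by
    clear hs
    induction s using BalTensor.induction_on with
    | tmul y x =>
      refine ⟨{x.1}, by simp, fun e he => ?_⟩
      rw [BalTensor.map_tmul, BalTensor.map_tmul, LinearMap.comp_apply, Submodule.subtype_apply,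
        he x.1 (by simp)]
    | zero => exact ⟨∅, by simp, fun e _ => by rw [map_zero, map_zero]⟩
    | add s t hs ht =>
      obtain ⟨S, hS, hS'⟩ := hs
      obtain ⟨T, hT, hT'⟩ := ht
      refine ⟨S ∪ T, fun x hx => (Finset.mem_union.1 hx).elim (hS x) (hT x), fun e he => ?_⟩
      rw [map_add, map_add, hS' e (fun x hx => he x (Finset.mem_union_left _ hx)),
        hT' e (fun x hx => he x (Finset.mem_union_right _ hx))]
  obtain ⟨T, hT, hT'⟩ := hT
  obtain ⟨e, he, heT⟩ := hR.exists_projection T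
  have hge : g ∘ₗ e = 0 := LinearMap.ext fun v =>
    (Submodule.span_le (p := LinearMap.ker g)).2 (fun x hx => hT x hx) (he v)
  -- The projection e fixes the image of t in Y ⊗ R^(N), hence fixes t because free modules are
  -- flat. Since g ∘ e = 0, the image of t in X ⊗ N is zero.
  have h1 : BalTensor.map LinearMap.id e (BalTensor.map f LinearMap.id t) =
      BalTensor.map f LinearMap.id t := by
    rw [← hs, BalTensor.map_map]
    exact hT' e heT
  have h2 : BalTensor.map LinearMap.id e t = t := by
    refine flatLeft_finsupp R N X Y f hf ?_
    rw [← h1, BalTensor.map_map, BalTensor.map_map]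
    rfl
  rw [← h2, BalTensor.map_map, hge, BalTensor.map_zero_right]

/-- The left ideal Ra is generated by an idempotent e. Writing e = xa and a = ye gives a x a = a e =
y e e = a. -/
theorem of_isSemisimpleRing [IsSemisimpleRing R] : IsVonNeumannRegular R := fun a => by
  obtain ⟨e, he, h⟩ := IsSemisimpleRing.ideal_eq_span_idempotent (Ideal.span {a})
  obtain ⟨x, hx⟩ := Ideal.mem_span_singleton'.1 (h ▸ Ideal.mem_span_singleton_self e)
  obtain ⟨y, hy⟩ := Ideal.mem_span_singleton'.1 (h ▸ Ideal.mem_span_singleton_self a)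
  refine ⟨x, ?_⟩
  rw [mul_assoc, hx, ← hy, mul_assoc, he.eq]

end IsVonNeumannRegular

end Corings

/-! ### Purity and kernels of comodules under flatness -/

namespace Corings

open Bimodule

variable {k : Type u} [CommRing k] {S A B E : Type u} [Ring S] [Algebra k S] [Ring A] [Algebra k A]
  [Ring B] [Algebra k B] [Ring E] [Algebra k E]

namespace Bimodule

theorem tmap_injective_of_flatLeft {X Y : Bimodule k A B} (f : X ⟶ Y) (hf : Function.Injective f)
    (Z : Bimodule k B E) (hZ : FlatLeft B Z) : Function.Injective (tmap f (𝟙 Z)) :=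
  hZ X Y (Hom.rightLin f) hf

/-- Factor f through its image. Flatness keeps the inclusion of the image injective, and right
exactness of the tensor product handles the surjection onto the image. -/
theorem isPure_of_flatLeft {X Y : Bimodule k A B} (f : X ⟶ Y) (Z : Bimodule k B E)
    (hZ : FlatLeft B Z) : IsPure f Z where
  injective := tmap_injective_of_flatLeft _ (kerι_injective f) Z hZ
  exact t ht := by
    let g := (Hom.rightLin f).rangeRestrict
    have ht' : BalTensor.map g (LinearMap.id : Z →ₗ[B] Z) t = 0 := by
      refine hZ _ _ (LinearMap.range (Hom.rightLin f)).subtype Subtype.val_injective ?_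
      exact (BalTensor.map_map g (LinearMap.range (Hom.rightLin f)).subtype LinearMap.id
        LinearMap.id t).trans (Eq.trans ht (map_zero _).symm)
    obtain ⟨s, hs⟩ := BalTensor.exists_map_ker_left g (LinearMap.surjective_rangeRestrict _) t ht'
    let j : LinearMap.ker g →ₗ[Bᵐᵒᵖ] ker f :=
      { toFun := fun x => ⟨x.1, congrArg Subtype.val x.2⟩
        map_add' := fun _ _ => rfl
        map_smul' := fun _ _ => rfl }
    refine ⟨BalTensor.map j LinearMap.id s, ?_⟩
    refine Eq.trans ?_ hs
    exact BalTensor.map_map j (Hom.rightLin (kerι f)) LinearMap.id LinearMap.id s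

variable {W X Y : Bimodule k A B}

/-- The kernel fork in bimodules. -/
def kerIsLimit (f : X ⟶ Y) : IsLimit (KernelFork.ofι (kerι f) (kerι_comp f)) :=
  KernelFork.IsLimit.ofι _ _ (fun g h => kerLift f g h) (fun g h => kerLift_comp f g h)
    (fun _ _ _ hm => eq_of_comp_injective (kerι f) (kerι_injective f) hm)

/-- An exact sequence `0 → W → X → Y` of bimodules is a kernel. -/
noncomputable def isLimitOfExact (i : W ⟶ X) (f : X ⟶ Y) (w : i ≫ f = 0)
    (hi : Function.Injective i)
    (hf : ∀ x, f x = 0 → ∃ y, i y = x) : IsLimit (KernelFork.ofι i w) :=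
  haveI : IsIso (kerLift f i w) := isIso_of_bijective _
    ⟨fun x y h => hi (congrArg Subtype.val h), fun x => by
      obtain ⟨y, hy⟩ := hf x.1 x.2
      exact ⟨y, Subtype.ext hy⟩⟩
  IsLimit.ofIsoLimit (kerIsLimit f) (Fork.ext (asIso (kerLift f i w)) (kerLift_comp f i w)).symm

theorem exact_of_isLimit {i : W ⟶ X} {f : X ⟶ Y} {w : i ≫ f = 0}
    (h : IsLimit (KernelFork.ofι i w)) :
    Function.Injective i ∧ ∀ x, f x = 0 → ∃ y, i y = x := by
  let e := h.conePointUniqueUpToIso (kerIsLimit f)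
  have he : e.hom ≫ kerι f = i := h.conePointUniqueUpToIso_hom_comp (kerIsLimit f) .zero
  have hb := bijective_of_isIso e.hom
  rw [← he]
  refine ⟨(kerι_injective f).comp hb.1, fun x hx => ?_⟩
  obtain ⟨y, hy⟩ := hb.2 ⟨x, hx⟩
  exact ⟨y, congrArg Subtype.val hy⟩

theorem tensorRight_preservesFiniteLimits (Z : Bimodule k A B) (hZ : FlatLeft A Z) :
    PreservesFiniteLimits (tensorRight Z) :=
  haveI : ∀ {X Y : Bimodule k k A} (f : X ⟶ Y),
      PreservesLimit (parallelPair f 0) (tensorRight Z) := fun {X Y} f => by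
    refine preservesLimit_of_preserves_limit_cone (kerIsLimit f)
      ((KernelFork.isLimitMapConeEquiv _ _).symm ?_)
    have hp := isPure_of_flatLeft f Z hZ
    exact isLimitOfExact (tmap (kerι f) (𝟙 Z)) (tmap f (𝟙 Z))
      (by rw [← tmap_comp_left, kerι_comp, tmap_zero_left]) hp.injective hp.exact
  Functor.preservesFiniteLimits_of_preservesKernels _

end Bimodule

namespace RComod

variable {C : Coring k A} {X Y : RComod C}

section Kernel

variable (f : X ⟶ Y) (hp : IsPure f.hom C.obj)
  (hi : Function.Injective (tmap (tmap (kerι f.hom) (𝟙 C.obj)) (𝟙 C.obj)))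

/-- The coaction on the kernel of a comodule morphism. -/
noncomputable def kerCoact : ker f.hom ⟶ tensor (ker f.hom) C.obj :=
  hp.lift (kerι f.hom ≫ X.coact) (by
    rw [Category.assoc, f.comm, ← Category.assoc, kerι_comp, zero_comp])

theorem kerCoact_ι : kerCoact f hp ≫ tmap (kerι f.hom) (𝟙 C.obj) = kerι f.hom ≫ X.coact :=
  hp.lift_comp _ _

-- Purity of f alone yields the coaction; coassociativity is an equality of maps into ker f ⊗ C ⊗ C,
-- and `hi` allows it to be tested in X ⊗ C ⊗ C.
include hi in
theorem kerCoact_coassoc : kerCoact f hp ≫ tmap (kerCoact f hp) (𝟙 C.obj) ≫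
    assocHom _ C.obj C.obj = kerCoact f hp ≫ tmap (𝟙 _) C.comul := by
  have hc := kerCoact_ι f hp
  have key : kerCoact f hp ≫ tmap (kerCoact f hp) (𝟙 C.obj) =
      kerCoact f hp ≫ tmap (𝟙 _) C.comul ≫ assocInv _ C.obj C.obj := by
    refine eq_of_comp_injective _ hi ?_
    simp only [Category.assoc]
    rw [assocInv_naturality, ← tmap_comp_left, hc, tmap_comp_left, ← Category.assoc, hc,
      Category.assoc, X.coassoc', tmap_id, ← Category.assoc (tmap (𝟙 _) C.comul), ← tmap_exchange,
      Category.assoc, ← Category.assoc (kerCoact f hp), hc, Category.assoc]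
  rw [← Category.assoc, key]
  simp only [Category.assoc]
  rw [assocInv_assocHom, Category.comp_id]

theorem kerCoact_counit : kerCoact f hp ≫ tmap (𝟙 _) C.counit ≫ rUnit _ = 𝟙 _ := by
  refine eq_of_comp_injective (kerι f.hom) (kerι_injective f.hom) ?_
  simp only [Category.assoc]
  rw [← rUnit_naturality, ← Category.assoc (tmap _ _), ← tmap_exchange, Category.assoc,
    ← Category.assoc, kerCoact_ι f hp, Category.assoc, X.counit, Category.comp_id,
    Category.id_comp]

/-- The kernel of a comodule morphism. -/
noncomputable def kerObj : RComod C where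
  obj := ker f.hom
  coact := kerCoact f hp
  coassoc := kerCoact_coassoc f hp hi
  counit := kerCoact_counit f hp

/-- The inclusion of the kernel of a comodule morphism. -/
noncomputable def kerObjι : kerObj f hp hi ⟶ X := ⟨kerι f.hom, kerCoact_ι f hp⟩

theorem kerObjι_comp : kerObjι f hp hi ≫ f = 0 := RComod.hom_ext (kerι_comp f.hom)

theorem kerLift_comm {W : RComod C} (g : W ⟶ X) (h : g.hom ≫ f.hom = 0) :
    W.coact ≫ tmap (kerLift f.hom g.hom h) (𝟙 C.obj) =
      kerLift f.hom g.hom h ≫ kerCoact f hp := by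
  refine eq_of_comp_injective (tmap (kerι f.hom) (𝟙 C.obj)) hp.injective ?_
  rw [Category.assoc, Category.assoc, ← tmap_comp_left, kerLift_comp, kerCoact_ι,
    ← Category.assoc, kerLift_comp, g.comm]

/-- The universal property of the kernel of a comodule morphism. -/
noncomputable def kerObjIsLimit : IsLimit (KernelFork.ofι (kerObjι f hp hi) (kerObjι_comp f hp hi)) :=
  KernelFork.IsLimit.ofι _ _
    (fun g h => ⟨kerLift f.hom g.hom (congrArg Hom.hom h), kerLift_comm f hp g (congrArg Hom.hom h)⟩)
    (fun g h => RComod.hom_ext (kerLift_comp f.hom g.hom (congrArg Hom.hom h)))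
    (fun _ _ _ hm => RComod.hom_ext (eq_of_comp_injective (kerι f.hom) (kerι_injective f.hom)
      (congrArg Hom.hom hm)))

end Kernel

theorem tmap_tmap_kerι_injective (hC : FlatLeft A C.obj) (f : X ⟶ Y) :
    Function.Injective (tmap (tmap (kerι f.hom) (𝟙 C.obj)) (𝟙 C.obj)) :=
  tmap_injective_of_flatLeft _ (tmap_injective_of_flatLeft _ (kerι_injective _) _ hC) _ hC

theorem hasKernels (hC : FlatLeft A C.obj) : HasKernels (RComod C) :=
  ⟨fun f => ⟨⟨⟨_, kerObjIsLimit f (isPure_of_flatLeft _ _ hC) (tmap_tmap_kerι_injective hC f)⟩⟩⟩⟩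

theorem hasFiniteLimits (hC : FlatLeft A C.obj) : HasFiniteLimits (RComod C) :=
  haveI := hasKernels hC
  haveI : HasEqualizers (RComod C) := Preadditive.hasEqualizers_of_hasKernels
  hasFiniteLimits_of_hasEqualizers_and_finite_products

/-- For an additive functor it suffices to preserve kernels, and the kernel comodule is carried by
the kernel of modules. -/
theorem forget_preservesFiniteLimits (hC : FlatLeft A C.obj) :
    PreservesFiniteLimits (forget C) :=
  haveI := hasFiniteLimits hC
  haveI : ∀ {X Y : RComod C} (f : X ⟶ Y),
      PreservesLimit (parallelPair f 0) (forget C) := fun {X Y} f => by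
    refine preservesLimit_of_preserves_limit_cone (kerObjIsLimit f (isPure_of_flatLeft _ _ hC)
      (tmap_tmap_kerι_injective hC f)) ((KernelFork.isLimitMapConeEquiv _ _).symm ?_)
    exact kerIsLimit f.hom
  Functor.preservesFiniteLimits_of_preservesKernels _

/-- The forgetful functor from right comodules to `k`-modules. -/
abbrev forgetToModuleCat (C : Coring k A) : RComod C ⥤ ModuleCat.{u} k :=
  forget C ⋙ Bimodule.forgetToModuleCat k A

instance : (forgetToModuleCat C).ReflectsIsomorphisms := inferInstance

end RComod

namespace Bicomod

variable {C : Coring k A} {D : Coring k B}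

theorem hasCotensor_of_flatLeft (hD : FlatLeft B D.obj) (M : Bicomod C D) : M.HasCotensor where
  pure _ := isPure_of_flatLeft _ _ hD
  injective _ := tmap_injective_of_flatLeft _
    (tmap_injective_of_flatLeft _ (kerι_injective _) _ hD) _ hD

/-- The cotensor product functor is exact if and only if the bicomodule is coflat. -/
theorem isCoflat_iff (hD : FlatLeft B D.obj) (M : Bicomod C D) (h : M.HasCotensor) :
    M.IsCoflat ↔
      PreservesFiniteLimits h.cotensorFunctor ∧ PreservesFiniteColimits h.cotensorFunctor := by
  have := RComod.forget_preservesFiniteLimits hD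
  have := RComod.hasFiniteLimits hD
  have : PreservesFiniteLimits (RComod.forgetToModuleCat D) := comp_preservesFiniteLimits _ _
  have : ReflectsFiniteLimits (RComod.forgetToModuleCat D) := inferInstance
  have : ∀ (J : Type) [SmallCategory J] [FinCategory J],
      ReflectsColimitsOfShape J (RComod.forgetToModuleCat D) := fun J _ _ =>
    reflectsColimitsOfShape_of_reflectsIsomorphisms
  -- The functor that defines coflatness is the cotensor functor followed by the forgetful functor,
  -- which for flat D preserves and reflects finite limits and finite colimits.
  change (PreservesFiniteLimits (h.cotensorFunctor ⋙ RComod.forgetToModuleCat D) ∧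
    PreservesFiniteColimits (h.cotensorFunctor ⋙ RComod.forgetToModuleCat D)) ↔ _
  refine ⟨fun ⟨_, _⟩ => ⟨?_, ?_⟩, fun ⟨_, _⟩ => ⟨?_, ?_⟩⟩
  · exact preservesFiniteLimits_of_reflects_of_preserves _ (RComod.forgetToModuleCat D)
  · exact ⟨fun J _ _ => preservesColimitsOfShape_of_reflects_of_preserves _
      (RComod.forgetToModuleCat D)⟩
  · exact comp_preservesFiniteLimits _ _
  · exact comp_preservesFiniteColimits _ _

end Bicomod

end Corings

/-! ### Functors that are kernels of transformations; coproducts from filtered colimits -/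

namespace Corings

section KernelFunctor

variable {𝒞 : Type*} [Category 𝒞] {R : Type u} [Ring R] {K P Q : 𝒞 ⥤ ModuleCat.{u} R} (ι : K ⟶ P)
  (ω : P ⟶ Q)

/-- A functor to modules which is the kernel of a transformation of functors preserving filtered
colimits preserves them. -/
theorem preservesColimitsOfShape_of_kernel (hι : ∀ X, Function.Injective (ι.app X))
    (hω : ∀ X (p : P.obj X), ω.app X p = 0 ↔ ∃ y, ι.app X y = p)
    (J : Type u) [SmallCategory J] [IsFiltered J] [PreservesColimitsOfShape J P]
    [PreservesColimitsOfShape J Q] : PreservesColimitsOfShape J K where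
  preservesColimit {T} := ⟨fun {c} hc => ⟨by
    have hP := isColimitOfPreserves P hc
    have hQ := isColimitOfPreserves Q hc
    have hP' := isColimitOfPreserves (forget (ModuleCat.{u} R)) hP
    have nat : ∀ {X Y : 𝒞} (f : X ⟶ Y) (x : K.obj X), ι.app Y (K.map f x) = P.map f (ι.app X x) :=
      fun f x => congrArg (fun e => e.hom x) (ι.naturality f)
    have nat' : ∀ {X Y : 𝒞} (f : X ⟶ Y) (x : P.obj X), ω.app Y (P.map f x) = Q.map f (ω.app X x) :=
      fun f x => congrArg (fun e => e.hom x) (ω.naturality f)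
    refine isColimitOfReflects (forget (ModuleCat.{u} R))
      (Types.FilteredColimit.isColimitOf' _ _ (fun x => ?_) (fun i x y h => ?_))
    · obtain ⟨j, p, hp⟩ := Types.jointly_surjective_of_isColimit hP' (ι.app c.pt x)
      change P.map (c.ι.app j) p = ι.app c.pt x at hp
      -- The element ω(p) vanishes in the colimit of Q, hence already at a later stage l; there the
      -- image of p comes from K.
      have h0 : Q.map (c.ι.app j) (ω.app _ p) = Q.map (c.ι.app j) 0 := by
        rw [← nat', hp, map_zero]
        exact (hω _ _).2 ⟨x, rfl⟩
      obtain ⟨l, f, hf⟩ := (IsColimit.eq_iff' hQ _ _).1 h0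
      have hf' : ω.app _ (P.map (T.map f) p) = 0 := by
        rw [nat']
        exact hf.trans (map_zero _)
      obtain ⟨y, hy⟩ := (hω _ _).1 hf'
      refine ⟨l, y, hι _ ?_⟩
      change ι.app _ x = ι.app _ (K.map (c.ι.app l) y)
      rw [nat, hy, ← hp, ← c.w f, P.map_comp]
      rfl
    · change K.map (c.ι.app i) x = K.map (c.ι.app i) y at h
      have h1 := congrArg (ι.app c.pt) h
      rw [nat, nat] at h1
      obtain ⟨l, f, hf⟩ := (IsColimit.eq_iff' hP _ _).1 h1
      refine ⟨l, f, hι _ ?_⟩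
      change ι.app _ (K.map (T.map f) x) = ι.app _ (K.map (T.map f) y)
      rw [nat, nat]
      exact hf⟩⟩

/-- A functor to modules which is the kernel of a transformation of functors preserving finite
limits preserves them. -/
theorem preservesFiniteLimits_of_kernel (hι : ∀ X, Function.Injective (ι.app X))
    (hω : ∀ X (p : P.obj X), ω.app X p = 0 ↔ ∃ y, ι.app X y = p)
    [PreservesFiniteLimits P] [PreservesFiniteLimits Q] : PreservesFiniteLimits K where
  preservesFiniteLimits J _ _ := ⟨fun {T} => ⟨fun {c} hc => ⟨by
    have hP := isLimitOfPreserves (forget (ModuleCat.{u} R)) (isLimitOfPreserves P hc)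
    have hQ := isLimitOfPreserves (forget (ModuleCat.{u} R)) (isLimitOfPreserves Q hc)
    have nat : ∀ {X Y : 𝒞} (f : X ⟶ Y) (x : K.obj X), ι.app Y (K.map f x) = P.map f (ι.app X x) :=
      fun f x => congrArg (fun e => e.hom x) (ι.naturality f)
    have nat' : ∀ {X Y : 𝒞} (f : X ⟶ Y) (x : P.obj X), ω.app Y (P.map f x) = Q.map f (ω.app X x) :=
      fun f x => congrArg (fun e => e.hom x) (ω.naturality f)
    have hP' := (Types.isLimit_iff _).1 ⟨hP⟩
    have hQ' := (Types.isLimit_iff _).1 ⟨hQ⟩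
    refine isLimitOfReflects (forget (ModuleCat.{u} R)) ((Types.isLimit_iff _).2 fun s hs => ?_).some
    obtain ⟨p, hp, hp'⟩ := hP' (fun j => ι.app _ (s j)) (fun {i j} f => by
      change P.map (T.map f) (ι.app _ (s i)) = ι.app _ (s j)
      rw [← nat]
      exact congrArg _ (hs f))
    -- All coordinates of ω(p) in the limit of Q vanish, so the glued element p lies in K.
    have h0 : ω.app _ p = 0 := by
      refine (hQ' (fun j => (0 : Q.obj (T.obj j))) (fun {i j} f => ?_)).unique (fun j => ?_)
        (fun j => ?_)
      · exact map_zero (Q.map (T.map f)).hom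
      · change Q.map (c.π.app j) (ω.app _ p) = 0
        rw [← nat']
        exact (hω _ _).2 ⟨s j, (hp j).symm⟩
      · exact map_zero (Q.map (c.π.app j)).hom
    obtain ⟨y, hy⟩ := (hω _ _).1 h0
    refine ⟨y, fun j => hι _ ?_, fun z hz => hι _ ?_⟩
    · exact (nat (c.π.app j) y).trans ((congrArg (P.map (c.π.app j)) hy).trans (hp j))
    · rw [hy]
      refine hp' _ fun j => ?_
      change P.map (c.π.app j) (ι.app _ z) = _
      exact (nat (c.π.app j) z).symm.trans (congrArg _ (hz j))⟩⟩⟩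

end KernelFunctor

section Coproducts

open CoproductsFromFiniteFiltered

variable {𝒞 𝒟 : Type*} [Category.{u} 𝒞] [Category.{u} 𝒟] [Preadditive 𝒞] [Preadditive 𝒟]
  [HasColimits 𝒞] (F : 𝒞 ⥤ 𝒟)

/-- An additive functor which preserves filtered colimits preserves coproducts. -/
theorem preservesCoproducts_of_preservesFilteredColimits [F.Additive] [PreservesFilteredColimits F]
    (J : Type u) : PreservesColimitsOfShape (Discrete J) F := by
  have : HasFiniteBiproducts 𝒞 := HasFiniteBiproducts.of_hasFiniteCoproducts
  suffices H : ∀ f : J → 𝒞, PreservesColimit (Discrete.functor f) F from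
    ⟨fun {K} => preservesColimit_of_iso_diagram F Discrete.natIsoFunctor.symm⟩
  intro f
  -- A coproduct is the filtered colimit of its finite subcoproducts, and these are biproducts,
  -- which the additive F preserves.
  have hc := isColimitOfPreserves F (isColimitFiniteSubproductsCocone f)
  let hS (S : Finset (Discrete J)) :=
    isColimitOfPreserves F (colimit.isColimit (Discrete.functor fun x : S => f x.1.as))
  have hι : ∀ (S : Finset (Discrete J)) (x : S), F.map (Sigma.ι (fun x : S => f x.1.as) x) ≫
      F.map ((finiteSubcoproductsCocone f).ι.app S) = F.map (Sigma.ι f x.1.as) := fun S x =>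
    (F.map_comp _ _).symm.trans (congrArg F.map (Sigma.ι_desc _ _))
  let d (s : Cocone (Discrete.functor f ⋙ F)) (S : Finset (Discrete J)) :
      F.obj (∐ fun x : S => f x.1.as) ⟶ s.pt :=
    (hS S).desc ⟨s.pt, Discrete.natTrans fun x => s.ι.app x.as.1⟩
  have hd : ∀ s (S : Finset (Discrete J)) (x : S), F.map (Sigma.ι (fun x : S => f x.1.as) x) ≫ d s S = s.ι.app x.1 :=
    fun s S x => (hS S).fac ⟨s.pt, Discrete.natTrans fun x => s.ι.app x.as.1⟩ ⟨x⟩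
  let c (s : Cocone (Discrete.functor f ⋙ F)) :
      Cocone (liftToFinsetObj (Discrete.functor f) ⋙ F) :=
    ⟨s.pt, { app := d s
             naturality := fun S T h => (hS S).hom_ext fun ⟨x⟩ => by
              have h1 : F.map (Sigma.ι (fun x : S => f x.1.as) x) ≫
                  F.map ((liftToFinsetObj (Discrete.functor f)).map h) =
                  F.map (Sigma.ι (fun x : T => f x.1.as) ⟨x.1, h.down.down x.2⟩) :=
                (F.map_comp _ _).symm.trans (congrArg F.map (Sigma.ι_desc _ _))
              exact (Category.assoc _ _ _).symm.trans ((congrArg (· ≫ d s T) h1).trans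
                ((hd s T ⟨x.1, h.down.down x.2⟩).trans ((hd s S x).symm.trans
                  (congrArg (F.map (Sigma.ι _ x) ≫ ·) (Category.comp_id (d s S)).symm)))) }⟩
  refine preservesColimit_of_preserves_colimit_cocone (colimit.isColimit (Discrete.functor f))
    { desc := fun s => hc.desc (c s)
      fac := fun s ⟨j⟩ => ?_
      uniq := fun s m hm => hc.hom_ext fun S => (hS S).hom_ext fun ⟨x⟩ => ?_ }
  · have h1 := hι {⟨j⟩} ⟨⟨j⟩, by simp⟩
    have h2 := hc.fac (c s) {⟨j⟩}
    exact (congrArg (· ≫ hc.desc (c s)) h1.symm).trans ((Category.assoc _ _ _).trans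
      ((congrArg _ h2).trans (hd s {⟨j⟩} ⟨⟨j⟩, by simp⟩)))
  · have h1 : F.map (Sigma.ι (fun x : S => f x.1.as) x) ≫
        F.map ((finiteSubcoproductsCocone f).ι.app S) ≫ m = s.ι.app x.1 :=
      (Category.assoc _ _ _).symm.trans ((congrArg (· ≫ m) (hι S x)).trans (hm x.1))
    have h2 := hc.fac (c s) S
    exact h1.trans ((hd s S x).symm.trans (congrArg _ h2.symm))

end Coproducts

end Corings

/-! ### Transformations determined by their value at the ring -/

namespace Corings

section IsoClosure

variable {𝒞 𝒟 : Type*} [Category 𝒞] [Category 𝒟] {P Q : 𝒞 ⥤ 𝒟} (τ : P ⟶ Q)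

/-- The component at the colimit is the map induced by the components on the diagram, which form an
isomorphism of diagrams. -/
theorem isIso_app_of_isColimit {J : Type*} [Category J] {K : J ⥤ 𝒞} {c : Cocone K}
    (hc : IsColimit c) [PreservesColimit K P] [PreservesColimit K Q]
    (h : ∀ j, IsIso (τ.app (K.obj j))) : IsIso (τ.app c.pt) := by
  let e : K ⋙ P ≅ K ⋙ Q := NatIso.ofComponents (fun j => asIso (τ.app (K.obj j)))
    (fun f => τ.naturality (K.map f))
  let E := IsColimit.coconePointsIsoOfNatIso (isColimitOfPreserves P hc)
    (isColimitOfPreserves Q hc) e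
  have hE : E.hom = τ.app c.pt := (isColimitOfPreserves P hc).hom_ext fun j =>
    (IsColimit.comp_coconePointsIsoOfNatIso_hom _ _ _ j).trans (τ.naturality (c.ι.app j)).symm
  rw [← hE]
  infer_instance

/-- Naturality makes the composite of Q(i), the inverse at Y and P(r) an inverse at X. -/
theorem isIso_app_of_retract {X Y : 𝒞} (i : X ⟶ Y) (r : Y ⟶ X) (h : i ≫ r = 𝟙 X)
    [IsIso (τ.app Y)] : IsIso (τ.app X) := by
  refine ⟨Q.map i ≫ inv (τ.app Y) ≫ P.map r, ?_, ?_⟩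
  · rw [← Category.assoc, ← τ.naturality, Category.assoc, IsIso.hom_inv_id_assoc, ← P.map_comp, h,
      P.map_id]
  · rw [Category.assoc, Category.assoc, τ.naturality, IsIso.inv_hom_id_assoc, ← Q.map_comp, h,
      Q.map_id]

end IsoClosure

section Modules

variable {R : Type u} [Ring R]

variable (R) in
/-- A free module as a coproduct. -/
noncomputable def finsuppCofan (ι : Type u) : Cofan (fun _ : ι => ModuleCat.of R R) :=
  Cofan.mk (ModuleCat.of R (ι →₀ R)) fun i => ModuleCat.ofHom (Finsupp.lsingle i)

variable (R) in
/-- A free module is a coproduct. -/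
noncomputable def finsuppCofanIsColimit (ι : Type u) : IsColimit (finsuppCofan R ι) :=
  Cofan.IsColimit.mk _
    (fun s => ModuleCat.ofHom (Finsupp.lsum ℕ fun i => (s.inj i).hom))
    (fun s i => ModuleCat.hom_ext (LinearMap.ext fun r => by
      change Finsupp.lsum ℕ (fun i => (s.inj i).hom) (Finsupp.single i r) = _
      rw [Finsupp.lsum_single]))
    (fun s m hm => ModuleCat.hom_ext (Finsupp.lhom_ext fun i r => by
      have h := congrArg (fun e => e.hom r) (hm i)
      refine h.trans ?_
      change _ = Finsupp.lsum ℕ (fun i => (s.inj i).hom) (Finsupp.single i r)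
      rw [Finsupp.lsum_single]))

/-- The free cover of a module. -/
noncomputable def freeCover (X : Type u) [AddCommGroup X] [Module R X] : (X →₀ R) →ₗ[R] X :=
  Finsupp.linearCombination R id

theorem freeCover_surjective (X : Type u) [AddCommGroup X] [Module R X] :
    Function.Surjective (freeCover (R := R) X) := fun x =>
  ⟨Finsupp.single x 1, by simp [freeCover]⟩

variable {𝒟 : Type*} [Category.{u} 𝒟] {P Q : ModuleCat.{u} R ⥤ 𝒟} (τ : P ⟶ Q)

theorem isIso_app_free [∀ J : Type u, PreservesColimitsOfShape (Discrete J) P]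
    [∀ J : Type u, PreservesColimitsOfShape (Discrete J) Q]
    (h : IsIso (τ.app (ModuleCat.of R R))) (ι : Type u) :
    IsIso (τ.app (ModuleCat.of R (ι →₀ R))) :=
  isIso_app_of_isColimit τ (finsuppCofanIsColimit R ι) fun _ => h

/-- Transformations between colimit preserving functors on modules are determined by their value
at the ring. -/
theorem isIso_app_of_preservesColimits [PreservesColimits P] [PreservesColimits Q]
    (h : IsIso (τ.app (ModuleCat.of R R))) (X : ModuleCat.{u} R) : IsIso (τ.app X) := by
  let g := freeCover (R := R) X
  -- A free presentation: X is the cokernel of f, a map between free modules.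
  let f := (LinearMap.ker g).subtype ∘ₗ freeCover (R := R) (LinearMap.ker g)
  let S : ShortComplex (ModuleCat.{u} R) := ShortComplex.mk (ModuleCat.ofHom f) (ModuleCat.ofHom g)
    (ModuleCat.hom_ext (LinearMap.ext fun x => (freeCover (R := R) (LinearMap.ker g) x).2))
  have hS : S.Exact := (ShortComplex.moduleCat_exact_iff S).2 fun x hx => by
    obtain ⟨y, hy⟩ := freeCover_surjective (R := R) (LinearMap.ker g) ⟨x, hx⟩
    exact ⟨y, congrArg Subtype.val hy⟩
  have : Epi S.g := (ModuleCat.epi_iff_surjective _).2 (freeCover_surjective (R := R) X)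
  refine isIso_app_of_isColimit τ hS.gIsCokernel fun j => ?_
  rcases j with _ | _ <;> exact isIso_app_free τ h _

/-- A projective module is a retract of its free cover, so coproducts suffice and no cokernel has to
be preserved. -/
theorem isIso_app_of_projective [∀ J : Type u, PreservesColimitsOfShape (Discrete J) P]
    [∀ J : Type u, PreservesColimitsOfShape (Discrete J) Q]
    (h : IsIso (τ.app (ModuleCat.of R R))) (X : ModuleCat.{u} R) [Module.Projective R X] :
    IsIso (τ.app X) := by
  obtain ⟨s, hs⟩ := Module.Projective.out (R := R) (P := X)
  have := isIso_app_free τ h X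
  exact isIso_app_of_retract τ (ModuleCat.ofHom s)
    (ModuleCat.ofHom (Finsupp.linearCombination R id))
    (ModuleCat.hom_ext (LinearMap.ext hs))

section Presentation

variable {F X : Type u} [AddCommGroup F] [Module R F] [AddCommGroup X] [Module R X]
  (g : F →ₗ[R] X)

/-- The submodule of the kernel spanned by a finite set. -/
def kerSpan (T : Finset (LinearMap.ker g)) : Submodule R F :=
  Submodule.span R (Subtype.val '' (T : Set (LinearMap.ker g)))

theorem kerSpan_mono {S T : Finset (LinearMap.ker g)} (h : S ≤ T) : kerSpan g S ≤ kerSpan g T :=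
  Submodule.span_mono (Set.image_mono h)

theorem kerSpan_le (T : Finset (LinearMap.ker g)) : kerSpan g T ≤ LinearMap.ker g :=
  Submodule.span_le.2 (by rintro _ ⟨x, _, rfl⟩; exact x.2)

/-- The quotients of a module by the finitely generated submodules of a kernel. -/
def kerQuotients : Finset (LinearMap.ker g) ⥤ ModuleCat.{u} R where
  obj T := ModuleCat.of R (F ⧸ kerSpan g T)
  map h := ModuleCat.ofHom (Submodule.factor (kerSpan_mono g h.le))
  map_id _ := ModuleCat.hom_ext (Submodule.mapQ_id _)
  map_comp {_ _ _} h h' := ModuleCat.hom_ext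
    (Submodule.factor_comp (kerSpan_mono g h.le) (kerSpan_mono g h'.le)).symm

/-- The image as a cocone over the quotients by finitely generated submodules of the kernel. -/
def kerQuotientsCocone : Cocone (kerQuotients g) where
  pt := ModuleCat.of R X
  ι := { app := fun T => ModuleCat.ofHom ((kerSpan g T).liftQ g (kerSpan_le g T))
         naturality := fun _ T h => ModuleCat.hom_ext (Submodule.linearMap_qext _
           (LinearMap.ext fun x => by
             change (kerSpan g T).liftQ g (kerSpan_le g T) (Submodule.factor (kerSpan_mono g h.le)
               (Submodule.mkQ _ x)) = g x
             rw [Submodule.factor_mk]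
             rfl)) }

/-- The map from the source of a surjection to a cocone over the quotients. -/
def kerQuotientsDescAux (s : Cocone (kerQuotients g)) : F →ₗ[R] s.pt :=
  (s.ι.app ∅).hom ∘ₗ (kerSpan g ∅).mkQ

theorem kerQuotientsDescAux_eq (s : Cocone (kerQuotients g)) (T : Finset (LinearMap.ker g)) :
    kerQuotientsDescAux g s = (s.ι.app T).hom ∘ₗ (kerSpan g T).mkQ := by
  have h := s.w (homOfLE (Finset.empty_subset T))
  unfold kerQuotientsDescAux
  rw [← h]
  exact LinearMap.ext fun x => congrArg (s.ι.app T).hom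
    (Submodule.factor_mk (kerSpan_mono g (Finset.empty_subset T)) x)

theorem kerQuotientsDescAux_apply (s : Cocone (kerQuotients g)) (T : Finset (LinearMap.ker g))
    (x : F) : kerQuotientsDescAux g s x =
      (s.ι.app T).hom (show (kerQuotients g).obj T from (kerSpan g T).mkQ x) :=
  LinearMap.congr_fun (kerQuotientsDescAux_eq g s T) x

/-- The induced map can be computed at any stage, and an element x of the kernel is already zero at
the stage of the singleton {x}. -/
theorem ker_le_ker_kerQuotientsDescAux (s : Cocone (kerQuotients g)) :
    LinearMap.ker g ≤ LinearMap.ker (kerQuotientsDescAux g s) := fun x hx => by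
  have h : (kerSpan g {⟨x, hx⟩}).mkQ x = (kerSpan g {⟨x, hx⟩}).mkQ 0 := by
    rw [map_zero]
    exact (Submodule.Quotient.mk_eq_zero _).2 (Submodule.subset_span ⟨⟨x, hx⟩, by simp, rfl⟩)
  have h1 : kerQuotientsDescAux g s x = kerQuotientsDescAux g s 0 := by
    generalize ({⟨x, hx⟩} : Finset (LinearMap.ker g)) = T at h
    rw [kerQuotientsDescAux_apply g s T, kerQuotientsDescAux_apply g s T, h]
  rw [LinearMap.mem_ker, h1, map_zero]

/-- The map from the image to a cocone over the quotients. -/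
noncomputable def kerQuotientsDesc (hg : Function.Surjective g) (s : Cocone (kerQuotients g)) :
    X →ₗ[R] s.pt :=
  (LinearMap.ker g).liftQ (kerQuotientsDescAux g s) (ker_le_ker_kerQuotientsDescAux g s) ∘ₗ
    (g.quotKerEquivOfSurjective hg).symm.toLinearMap

theorem kerQuotientsDesc_apply (hg : Function.Surjective g) (s : Cocone (kerQuotients g)) (x : F) :
    kerQuotientsDesc g hg s (g x) = kerQuotientsDescAux g s x := by
  have h : (g.quotKerEquivOfSurjective hg).symm (g x) = (LinearMap.ker g).mkQ x :=
    (LinearEquiv.symm_apply_eq _).2 rfl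
  rw [kerQuotientsDesc, LinearMap.comp_apply, LinearEquiv.coe_coe, h, Submodule.mkQ_apply,
    Submodule.liftQ_apply]

/-- A module is the filtered colimit of the quotients of a cover by finitely generated submodules
of the kernel. -/
noncomputable def kerQuotientsIsColimit (hg : Function.Surjective g) :
    IsColimit (kerQuotientsCocone g) where
  desc s := ModuleCat.ofHom (kerQuotientsDesc g hg s)
  fac s T := ModuleCat.hom_ext (LinearMap.ext fun y => by
    obtain ⟨x, rfl⟩ := Submodule.mkQ_surjective (kerSpan g T) y
    have h := LinearMap.congr_fun (kerQuotientsDescAux_eq g s T) x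
    exact (kerQuotientsDesc_apply g hg s x).trans h)
  uniq s m hm := ModuleCat.hom_ext (LinearMap.ext fun y => by
    obtain ⟨x, rfl⟩ := hg y
    have h := congrArg (fun e => e.hom ((kerSpan g ∅).mkQ x)) (hm ∅)
    exact Eq.trans h (kerQuotientsDesc_apply g hg s x).symm)

end Presentation

/-- Over a von Neumann regular ring, transformations between functors preserving coproducts and
filtered colimits are determined by their value at the ring. -/
theorem isIso_app_of_isVonNeumannRegular (hR : IsVonNeumannRegular R)
    [∀ J : Type u, PreservesColimitsOfShape (Discrete J) P]
    [∀ J : Type u, PreservesColimitsOfShape (Discrete J) Q]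
    [PreservesFilteredColimits P] [PreservesFilteredColimits Q]
    (h : IsIso (τ.app (ModuleCat.of R R))) (X : ModuleCat.{u} R) : IsIso (τ.app X) := by
  classical
  let g := freeCover (R := R) X
  refine isIso_app_of_isColimit τ (kerQuotientsIsColimit g (freeCover_surjective X)) fun T => ?_
  -- Since e projects onto the span of T, the map id - e descends to a section of the quotient by
  -- that span; each term of the filtered diagram is thus a retract of a free module.
  obtain ⟨e, he, heT⟩ := hR.exists_projection (T.image Subtype.val)
  have hT : kerSpan g T = Submodule.span R ((T.image Subtype.val : Finset _) : Set (X →₀ R)) := by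
    rw [kerSpan, Finset.coe_image]
  have hker : kerSpan g T ≤ LinearMap.ker (LinearMap.id - e) := by
    rw [hT]
    refine Submodule.span_le.2 fun t ht => ?_
    change t - e t = 0
    rw [heT t ht, sub_self]
  have := isIso_app_free τ h X
  refine isIso_app_of_retract τ (Y := ModuleCat.of R (X →₀ R))
    (ModuleCat.ofHom ((kerSpan g T).liftQ (LinearMap.id - e) hker))
    (ModuleCat.ofHom (kerSpan g T).mkQ)
    (ModuleCat.hom_ext (Submodule.linearMap_qext _ (LinearMap.ext fun v => ?_)))
  change (kerSpan g T).mkQ (v - e v) = (kerSpan g T).mkQ v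
  rw [map_sub, sub_eq_self]
  exact (Submodule.Quotient.mk_eq_zero _).2 (hT ▸ he v)

end Modules

end Corings

/-! ### The bimodule F(C) and the comparison X ⊗ F(C) → F(X ⊗ C) -/

namespace Corings

open Bimodule

variable {k : Type u} [CommRing k] {A B : Type u} [Ring A] [Algebra k A] [Ring B] [Algebra k B]

namespace RComod

variable (C : Coring k A)

/-- The coring as a right comodule over itself. -/
def self : RComod C where
  obj := res C.obj
  coact := rightHom (X := res C.obj) (Y := tensor (res C.obj) C.obj)
    C.comul.toLin.toAddMonoidHom C.comul.map_rsmul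
  coassoc := Bimodule.hom_ext fun c => congrArg (fun e : C.obj ⟶ _ => e c) C.coassoc
  counit := Bimodule.hom_ext fun c => congrArg (fun e : C.obj ⟶ _ => e c) C.counit_right

variable {C}

/-- The comodule morphism `c ↦ x ⊗ c`. -/
def tensorLeft {X : Bimodule k k A} (x : X) : self C ⟶ (cofree C).obj X where
  hom := rightHom (X := res C.obj) (Y := tensor X C.obj)
    (AddMonoidHom.mk' (fun c : C.obj => tm x c) (fun c c' => tm_add x c c'))
    (fun a c => (smul_tm' (op a) x c).symm)
  comm := Bimodule.hom_ext fun c => by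
    have key : ∀ t : tensor (res C.obj) C.obj, tmap (rightHom (X := res C.obj) (Y := tensor X C.obj)
        (AddMonoidHom.mk' (fun c : C.obj => tm x c) (fun c c' => tm_add x c c'))
        (fun a c => (smul_tm' (op a) x c).symm)) (𝟙 C.obj) t =
        assocInv X C.obj C.obj (tm x (show tensor C.obj C.obj from t)) := fun t => by
      induction t using tensor_induction with
      | tm c c' =>
        exact (tmap_tm _ _ _ _).trans (assocInv_tm X C.obj C.obj x c c').symm
      | zero =>
        rw [hom_zero]
        exact ((congrArg _ (tm_zero x)).trans (hom_zero _)).symm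
      | add t t' ht ht' =>
        rw [hom_add, ht, ht']
        exact ((congrArg _ (tm_add x _ _)).trans (hom_add _ _ _)).symm
    refine (key _).trans ?_
    exact (congrArg (assocInv X C.obj C.obj) (tmap_tm (𝟙 X) C.comul x c)).symm

/-- Left multiplication as a comodule morphism. -/
def mulLeft (a : A) : self C ⟶ self C where
  hom := rightHom (X := res C.obj) (Y := res C.obj) (DistribSMul.toAddMonoidHom C.obj a)
    (fun b c => smul_comm a (op b) (show C.obj from c))
  comm := Bimodule.hom_ext fun c => (C.comul.toLin.map_smul a c).symm

theorem tensorLeft_add {X : Bimodule k k A} (x x' : X) :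
    tensorLeft (C := C) (x + x') = tensorLeft x + tensorLeft x' :=
  RComod.hom_ext (Bimodule.hom_ext fun c => add_tm x x' (show C.obj from c))

/-- Under F this becomes the relation xa ⊗ m = x ⊗ am, so that the comparison map is well defined on
the balanced tensor product. -/
theorem tensorLeft_smul {X : Bimodule k k A} (a : A) (x : X) :
    tensorLeft (C := C) (op a • x) = mulLeft a ≫ tensorLeft x :=
  RComod.hom_ext (Bimodule.hom_ext fun c => rsmul_tm a x (show C.obj from c))

theorem tensorLeft_naturality {X Y : Bimodule k k A} (f : X ⟶ Y) (x : X) :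
    tensorLeft x ≫ (cofree C).map f = tensorLeft (f x) :=
  RComod.hom_ext (Bimodule.hom_ext fun c => tmap_tm f (𝟙 C.obj) x (show C.obj from c))

theorem mulLeft_one : mulLeft (C := C) 1 = 𝟙 _ :=
  RComod.hom_ext (Bimodule.hom_ext fun c => one_smul A (show C.obj from c))

theorem mulLeft_mul (a b : A) : mulLeft (C := C) (a * b) = mulLeft b ≫ mulLeft a :=
  RComod.hom_ext (Bimodule.hom_ext fun c => mul_smul a b (show C.obj from c))

theorem mulLeft_add (a b : A) : mulLeft (C := C) (a + b) = mulLeft a + mulLeft b :=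
  RComod.hom_ext (Bimodule.hom_ext fun c => add_smul a b (show C.obj from c))

theorem mulLeft_zero : mulLeft (C := C) 0 = 0 :=
  RComod.hom_ext (Bimodule.hom_ext fun c => zero_smul A (show C.obj from c))

/-- With k-linearity of F, this is what makes k act centrally on F(C). -/
theorem mulLeft_algebraMap (r : k) : mulLeft (C := C) (algebraMap k A r) = r • 𝟙 (self C) := rfl

end RComod

open RComod

section Image

variable {C : Coring k A} {D : Coring k B} (F : RComod C ⥤ RComod D)

variable [F.Additive] [F.Linear k]

/-- The image of the coring under a `k`-linear functor, as a bimodule. -/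
def imageBimodule : Bimodule k A B :=
  letI : Module A (F.obj (self C)).obj :=
    { smul := fun a m => (F.map (mulLeft a)).hom m
      one_smul := fun m => by
        change (F.map (mulLeft 1)).hom m = m
        rw [mulLeft_one, F.map_id]; rfl
      mul_smul := fun a b m => by
        change (F.map (mulLeft (a * b))).hom m = _
        rw [mulLeft_mul, F.map_comp]; rfl
      smul_zero := fun a => hom_zero _
      smul_add := fun a m m' => hom_add _ m m'
      add_smul := fun a b m => by
        change (F.map (mulLeft (a + b))).hom m = _
        rw [mulLeft_add, F.map_add]; rfl
      zero_smul := fun m => by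
        change (F.map (mulLeft 0)).hom m = 0
        rw [mulLeft_zero, F.map_zero]; rfl }
  { carrier := (F.obj (self C)).obj
    smulComm := ⟨fun a b m => hom_rsmul _ b m⟩
    central := fun r m => by
      change (F.map (mulLeft (algebraMap k A r))).hom m = _
      rw [mulLeft_algebraMap, F.map_smul, F.map_id]
      exact (F.obj (self C)).obj.central r m }

/-- The right coaction on the image of the coring. -/
def imageRcoact : imageBimodule F ⟶ tensor (imageBimodule F) D.obj :=
  homMk (X := imageBimodule F) (Y := tensor (imageBimodule F) D.obj)
    (F.obj (self C)).coact.toLin.toAddMonoidHom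
    (fun a m => congrArg (fun e : (F.obj (self C)).obj ⟶ _ => e m) (F.map (mulLeft a)).comm.symm)
    (F.obj (self C)).coact.map_rsmul

/-- The value of `F` at a morphism out of the coring, as a map on the image of the coring. -/
def imageEval {X : RComod C} (f : self C ⟶ X) : imageBimodule F →+ (F.obj X).obj :=
  (F.map f).hom.toLin.toAddMonoidHom

theorem imageEval_add {X : RComod C} (f g : self C ⟶ X) (m : imageBimodule F) :
    imageEval F (f + g) m = imageEval F f m + imageEval F g m :=
  congrArg (fun e : F.obj (self C) ⟶ F.obj X => e.hom m) F.map_add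

theorem imageEval_comp {X Y : RComod C} (f : self C ⟶ X) (g : X ⟶ Y) (m : imageBimodule F) :
    imageEval F (f ≫ g) m = (F.map g).hom (imageEval F f m) :=
  congrArg (fun e : F.obj (self C) ⟶ F.obj Y => e.hom m) (F.map_comp f g)

theorem imageEval_smul {X : RComod C} (f : self C ⟶ X) (a : A) (m : imageBimodule F) :
    imageEval F f (a • m) = imageEval F (mulLeft a ≫ f) m :=
  (imageEval_comp F (mulLeft a) f m).symm

theorem imageEval_rsmul {X : RComod C} (f : self C ⟶ X) (b : B) (m : imageBimodule F) :
    imageEval F f (op b • m) = op b • imageEval F f m :=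
  hom_rsmul (X := (F.obj (self C)).obj) (F.map f).hom (op b) m

/-- The natural map `X ⊗_A F(C) → F(X ⊗_A C)`. -/
def imageMap (X : Bimodule k k A) :
    tensor X (imageBimodule F) ⟶ (F.obj ((cofree C).obj X)).obj :=
  rightHom (X := tensor X (imageBimodule F)) (Y := (F.obj ((cofree C).obj X)).obj)
    (tlift (fun x m => imageEval F (tensorLeft x) m)
      (fun x x' m => by rw [tensorLeft_add, imageEval_add])
      (fun x m m' => map_add _ m m')
      (fun a x m => by rw [tensorLeft_smul, imageEval_smul]))
    (fun b t => by
      induction t using tensor_induction with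
      | tm x m => rw [smul_tm', tlift_tm, tlift_tm, imageEval_rsmul]
      | zero => rw [smul_zero, map_zero, smul_zero]
      | add t t' ht ht' => rw [smul_add, map_add, map_add, smul_add, ht, ht'])

theorem imageMap_tm {X : Bimodule k k A} (x : X) (m : imageBimodule F) :
    imageMap F X (tm x m) = imageEval F (tensorLeft x) m := by
  unfold imageMap
  rw [rightHom_apply, tlift_tm]

theorem imageMap_naturality {X Y : Bimodule k k A} (f : X ⟶ Y) :
    tmap f (𝟙 (imageBimodule F)) ≫ imageMap F Y =
      imageMap F X ≫ (F.map ((cofree C).map f)).hom :=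
  tensor_hom_ext fun x m => by
    rw [Bimodule.comp_apply, Bimodule.comp_apply, tmap_tm, imageMap_tm, imageMap_tm,
      ← tensorLeft_naturality, imageEval_comp, Bimodule.id_apply]

/-- On x ⊗ m the claim is that the image under F of c ↦ x ⊗ c is a morphism of D-comodules. -/
theorem imageMap_colinear (X : Bimodule k k A) :
    (tmap (𝟙 X) (imageRcoact F) ≫ assocInv X (imageBimodule F) D.obj) ≫
      tmap (imageMap F X) (𝟙 D.obj) = imageMap F X ≫ (F.obj ((cofree C).obj X)).coact :=
  tensor_hom_ext fun x m => by
    have key : ∀ t : tensor (imageBimodule F) D.obj,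
        tmap (imageMap F X) (𝟙 D.obj) (assocInv X (imageBimodule F) D.obj (tm x t)) =
        tmap (X := (F.obj (self C)).obj) (F.map (tensorLeft (C := C) x)).hom (𝟙 D.obj) t := fun t => by
      induction t using tensor_induction with
      | tm m d =>
        rw [assocInv_tm, tmap_tm, imageMap_tm]
        exact (tmap_tm (X := (F.obj (self C)).obj) (F.map (tensorLeft (C := C) x)).hom
          (𝟙 D.obj) m d).symm
      | zero =>
        rw [tm_zero, hom_zero, hom_zero]
        exact (hom_zero _).symm
      | add t t' ht ht' =>
        rw [tm_add, hom_add, hom_add, ht, ht']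
        exact (hom_add _ _ _).symm
    rw [Bimodule.comp_apply, Bimodule.comp_apply, tmap_tm, Bimodule.comp_apply, imageMap_tm]
    refine (key _).trans ?_
    exact congrArg (fun e : (F.obj (self C)).obj ⟶ _ => e m) (F.map (tensorLeft x)).comm

end Image

end Corings

/-! ### The left coaction on F(C) -/

namespace Corings

open Bimodule

variable {k : Type u} [CommRing k] {A B : Type u} [Ring A] [Algebra k A] [Ring B] [Algebra k B]

namespace Bimodule

variable {S : Type u} [Ring S] [Algebra k S]

/-- A morphism of bimodules as a morphism of right modules. -/
def resHom {X Y : Bimodule k A B} (f : X ⟶ Y) : res X ⟶ res Y :=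
  rightHom (X := res X) (Y := res Y) f.toLin.toAddMonoidHom f.map_rsmul

/-- Forgetting the left action on a tensor product. -/
def tensorRes {Z : Bimodule k S A} {M : Bimodule k A B} (t : tensor Z M) : tensor (res Z) M := t

theorem tensorRes_tm {Z : Bimodule k S A} {M : Bimodule k A B} (z : Z) (m : M) :
    tensorRes (tm z m) = tm (X := res Z) z m := rfl

theorem tensorRes_zero {Z : Bimodule k S A} {M : Bimodule k A B} :
    tensorRes (0 : tensor Z M) = 0 := rfl

theorem tensorRes_add {Z : Bimodule k S A} {M : Bimodule k A B} (t t' : tensor Z M) :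
    tensorRes (t + t') = tensorRes t + tensorRes t' := rfl

theorem lUnit_section (X : Bimodule k A B) (t : tensor (unit k A) X) :
    tm (X := unit k A) (1 : A) (lUnit X t) = t := by
  induction t using tensor_induction with
  | tm a x =>
    have h := rsmul_tm (X := unit k A) (show A from a) (1 : A) x
    have h2 : op (show A from a) • (show unit k A from (1 : A)) = a := one_mul (show A from a)
    refine (congrArg _ (lUnit_tm X (show A from a) x)).trans (h.symm.trans ?_)
    exact congrArg (fun e => tm e x) h2
  | zero => exact (congrArg _ (hom_zero (lUnit X))).trans (tm_zero _)
  | add t t' ht ht' =>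
    exact (congrArg _ (hom_add (lUnit X) t t')).trans
      ((tm_add _ _ _).trans (congrArg₂ (· + ·) ht ht'))

theorem isIso_tmap_left {X X' : Bimodule k S A} (f : X ⟶ X') [IsIso f] (Y : Bimodule k A B) :
    IsIso (tmap f (𝟙 Y)) :=
  ⟨⟨tmap (inv f) (𝟙 Y), by rw [← tmap_comp_left, IsIso.hom_inv_id, tmap_id],
    by rw [← tmap_comp_left, IsIso.inv_hom_id, tmap_id]⟩⟩

end Bimodule

namespace RComod

variable (C : Coring k A)

/-- The comultiplication as a comodule morphism. -/
def selfCoact : self C ⟶ (cofree C).obj (res C.obj) := coactHom (self C)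

variable {C}

/-- The coaction of a cofree comodule. -/
def cofreeCoact (X : Bimodule k k A) : (cofree C).obj X ⟶ (cofree C).obj (tensor X C.obj) :=
  coactHom ((cofree C).obj X)

/-- The module map underlying a comodule map from the coring to a cofree comodule. -/
def toTensorHom {X : Bimodule k k A} (f : self C ⟶ (cofree C).obj X) : res C.obj ⟶ tensor X C.obj :=
  f.hom

/-- The module map underlying an endomorphism of the coring. -/
def endHom (f : self C ⟶ self C) : res C.obj ⟶ res C.obj := f.hom

/-- Naturality of the coaction at f, that is, colinearity of f, restated as an identity of comodule
morphisms so that F can be applied to it. -/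
theorem selfCoact_toTensorHom {X : Bimodule k k A} (f : self C ⟶ (cofree C).obj X) :
    selfCoact C ≫ (cofree C).map (toTensorHom f) = f ≫ cofreeCoact X :=
  coactHom_naturality f

theorem selfCoact_endHom (f : self C ⟶ self C) :
    selfCoact C ≫ (cofree C).map (endHom f) = f ≫ selfCoact C :=
  coactHom_naturality f

/-- The left counit axiom: Δ followed by ε ⊗ C is c ↦ 1 ⊗ c. Its image under F is the counit axiom
for the left coaction on F(C). -/
theorem selfCoact_counit :
    selfCoact C ≫ (cofree C).map (resHom C.counit) =
      tensorLeft (X := res (unit k A)) (1 : A) :=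
  RComod.hom_ext (Bimodule.hom_ext fun c => by
    have h : lUnit C.obj (tmap C.counit (𝟙 C.obj) (C.comul (show C.obj from c))) = c :=
      congrArg (fun e : C.obj ⟶ C.obj => e c) C.counit_left
    have h2 := lUnit_section C.obj (tmap C.counit (𝟙 C.obj) (C.comul (show C.obj from c)))
    rw [h] at h2
    exact h2.symm)

end RComod

open RComod

section Image

variable {C : Coring k A} {D : Coring k B} (F : RComod C ⥤ RComod D) [F.Additive] [F.Linear k]

/-- The value of `F` at a morphism out of the coring, as a map of right modules. -/
def imageEvalHom {X : RComod C} (f : self C ⟶ X) : res (imageBimodule F) ⟶ (F.obj X).obj :=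
  rightHom (X := res (imageBimodule F)) (imageEval F f) (imageEval_rsmul F f)

/-- `X ⊗_A F(C) → F(X ⊗_A C)` is an isomorphism for all `X`. -/
def IsTensorial : Prop := ∀ X : Bimodule k k A, Function.Bijective (imageMap F X)

variable {F} (hF : IsTensorial F)

namespace IsTensorial

/-- The left coaction on the image of the coring, as a map of right modules. -/
noncomputable def lcoactAux : res (imageBimodule F) ⟶ tensor (res C.obj) (imageBimodule F) :=
  haveI := Bimodule.isIso_of_bijective _ (hF (res C.obj))
  imageEvalHom F (selfCoact C) ≫ inv (imageMap F (res C.obj))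

theorem lcoactAux_comp :
    hF.lcoactAux ≫ imageMap F (res C.obj) = imageEvalHom F (selfCoact C) := by
  have := Bimodule.isIso_of_bijective _ (hF (res C.obj))
  unfold lcoactAux
  rw [Category.assoc, IsIso.inv_hom_id, Category.comp_id]

theorem imageMap_lcoactAux (m : imageBimodule F) :
    imageMap F (res C.obj) (hF.lcoactAux (show res (imageBimodule F) from m)) =
      imageEval F (selfCoact C) m :=
  congrArg (fun e : res (imageBimodule F) ⟶ _ => e m) hF.lcoactAux_comp

-- Naturality of the comparison map at left multiplication by a, regarded as an endomorphism of the
-- right module C.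
variable (F) in
theorem imageMap_smul (a : A) (t : tensor C.obj (imageBimodule F)) :
    imageMap F (res C.obj) (tensorRes (a • t)) =
      (F.map ((cofree C).map (endHom (mulLeft a)))).hom
        (imageMap F (res C.obj) (tensorRes t)) :=
  congrArg (fun e : tensor (res C.obj) (imageBimodule F) ⟶ _ => e (tensorRes t))
    (imageMap_naturality F (endHom (mulLeft a)))

/-- The left coaction on the image of the coring. -/
noncomputable def lcoact : imageBimodule F ⟶ tensor C.obj (imageBimodule F) :=
  homMk (X := imageBimodule F) (Y := tensor C.obj (imageBimodule F))
    hF.lcoactAux.toLin.toAddMonoidHom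
    (fun a m => (hF (res C.obj)).1 (by
      -- Left linearity is tested after the injective comparison map, where it is the image under F
      -- of Δ(ac) = aΔ(c).
      refine (hF.imageMap_lcoactAux (a • m)).trans ?_
      refine Eq.trans ?_ (imageMap_smul F a (hF.lcoactAux (show res (imageBimodule F) from m))).symm
      refine Eq.trans ?_ (congrArg (F.map ((cofree C).map (endHom (mulLeft a)))).hom (hF.imageMap_lcoactAux m)).symm
      rw [imageEval_smul, ← selfCoact_endHom, imageEval_comp]))
    hF.lcoactAux.map_rsmul

theorem imageMap_lcoact (m : imageBimodule F) :
    imageMap F (res C.obj) (tensorRes (hF.lcoact m)) = imageEval F (selfCoact C) m :=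
  hF.imageMap_lcoactAux m

-- Naturality at the module map c ↦ x ⊗ c compares the identifications for C and for X ⊗ C.
variable (F) in
theorem imageMap_assocInv {X : Bimodule k k A} (x : X) (t : tensor C.obj (imageBimodule F)) :
    imageMap F (tensor X C.obj) (assocInv X C.obj (imageBimodule F) (tm x t)) =
      (F.map ((cofree C).map (toTensorHom (tensorLeft x)))).hom
        (imageMap F (res C.obj) (tensorRes t)) := by
  induction t using tensor_induction with
  | tm c m =>
    rw [assocInv_tm, imageMap_tm, tensorRes_tm]
    refine Eq.trans ?_ (congrArg (F.map ((cofree C).map (toTensorHom (tensorLeft x)))).hom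
      (imageMap_tm F (X := res C.obj) c m)).symm
    rw [← imageEval_comp]
    exact congrArg (fun e => imageEval F e m)
      (tensorLeft_naturality (X := res C.obj) (toTensorHom (tensorLeft x)) c).symm
  | zero => rw [tm_zero, tensorRes_zero, hom_zero, hom_zero, hom_zero, hom_zero]
  | add t t' ht ht' =>
    rw [tm_add, tensorRes_add, hom_add, hom_add, hom_add, hom_add, ht, ht']

/-- The comparison maps identify X ⊗ λ with F(X ⊗ Δ). This carries coassociativity of λ and the
description of ω. -/
theorem imageMap_tmap_lcoact (X : Bimodule k k A) :
    tmap (𝟙 X) hF.lcoact ≫ assocInv X C.obj (imageBimodule F) ≫ imageMap F (tensor X C.obj) =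
      imageMap F X ≫ (F.map (cofreeCoact X)).hom :=
  tensor_hom_ext fun x m => by
    rw [Bimodule.comp_apply, Bimodule.comp_apply, Bimodule.comp_apply, tmap_tm, imageMap_assocInv,
      imageMap_lcoact, Bimodule.id_apply, imageMap_tm]
    refine (imageEval_comp F _ _ m).symm.trans ?_
    refine Eq.trans ?_ (imageEval_comp F _ _ m)
    rw [selfCoact_toTensorHom]

/-- After the injective comparison map for C ⊗ C, both sides become images under F of the two
iterated comultiplications C → C ⊗ C ⊗ C. -/
theorem lcoassoc_apply (m : imageBimodule F) :
    tmap C.comul (𝟙 (imageBimodule F)) (hF.lcoact m) =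
      assocInv C.obj C.obj (imageBimodule F) (tmap (𝟙 C.obj) hF.lcoact (hF.lcoact m)) := by
  refine (hF (tensor (res C.obj) C.obj)).1 ?_
  refine (congrArg (fun e : tensor (res C.obj) (imageBimodule F) ⟶ _ =>
    e (tensorRes (hF.lcoact m))) (imageMap_naturality F
      (toTensorHom (selfCoact C)))).trans ?_
  refine Eq.trans ?_ (congrArg (fun e : tensor (res C.obj) (imageBimodule F) ⟶ _ =>
    e (tensorRes (hF.lcoact m))) (hF.imageMap_tmap_lcoact (res C.obj))).symm
  refine (congrArg _ (hF.imageMap_lcoact m)).trans ?_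
  refine Eq.trans ?_ (congrArg (F.map (cofreeCoact (res C.obj))).hom
    (hF.imageMap_lcoact m)).symm
  refine (imageEval_comp F _ _ m).symm.trans ?_
  refine Eq.trans ?_ (imageEval_comp F _ _ m)
  rw [selfCoact_toTensorHom]

theorem lcounit_apply (m : imageBimodule F) :
    tmap C.counit (𝟙 (imageBimodule F)) (hF.lcoact m) = tm (X := unit k A) (1 : A) m := by
  refine (hF (res (unit k A))).1 ?_
  refine (congrArg (fun e : tensor (res C.obj) (imageBimodule F) ⟶ _ =>
    e (tensorRes (hF.lcoact m))) (imageMap_naturality F (resHom C.counit))).trans ?_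
  refine (congrArg (F.map ((cofree C).map (resHom C.counit))).hom
    (hF.imageMap_lcoact m)).trans ?_
  refine Eq.trans ?_ (imageMap_tm F (X := res (unit k A)) (1 : A) m).symm
  rw [← imageEval_comp, selfCoact_counit]

/-- The two coactions commute because F(Δ) and the comparison map are both D-colinear. The equality
is tested after tensoring the comparison isomorphism with D. -/
theorem bicomod_apply (m : imageBimodule F) :
    tmap hF.lcoact (𝟙 D.obj) (imageRcoact F m) =
      assocInv C.obj (imageBimodule F) D.obj
        (tmap (𝟙 C.obj) (imageRcoact F) (hF.lcoact m)) := by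
  have := Bimodule.isIso_of_bijective _ (hF (res C.obj))
  have := isIso_tmap_left (imageMap F (res C.obj)) D.obj
  refine (Bimodule.bijective_of_isIso (tmap (imageMap F (res C.obj)) (𝟙 D.obj))).1 ?_
  refine Eq.trans ?_ (congrArg (fun e : tensor (res C.obj) (imageBimodule F) ⟶ _ =>
    e (tensorRes (hF.lcoact m))) (imageMap_colinear F (res C.obj))).symm
  refine Eq.trans ?_ (congrArg (F.obj ((cofree C).obj (res C.obj))).coact
    (hF.imageMap_lcoact m)).symm
  refine Eq.trans ?_ (congrArg (fun e : (F.obj (self C)).obj ⟶ _ => e m)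
    (F.map (selfCoact C)).comm)
  refine (congrArg (fun e : tensor (res (imageBimodule F)) D.obj ⟶ _ =>
    e (tensorRes (imageRcoact F m))) (tmap_comp_left D.obj hF.lcoactAux
      (imageMap F (res C.obj)))).symm.trans ?_
  rw [hF.lcoactAux_comp]
  rfl

/-- The image of the coring as a bicomodule. -/
noncomputable def bicomod : Bicomod C D where
  obj := imageBimodule F
  lcoact := hF.lcoact
  rcoact := imageRcoact F
  lcoassoc := by
    have h : hF.lcoact ≫ tmap C.comul (𝟙 (imageBimodule F)) =
        hF.lcoact ≫ tmap (𝟙 C.obj) hF.lcoact ≫ assocInv C.obj C.obj (imageBimodule F) :=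
      Bimodule.hom_ext hF.lcoassoc_apply
    rw [← Category.assoc, h]
    simp only [Category.assoc]
    rw [assocInv_assocHom, Category.comp_id]
  lcounit := Bimodule.hom_ext fun m =>
    (congrArg (lUnit (imageBimodule F)) (hF.lcounit_apply m)).trans
      ((lUnit_tm (imageBimodule F) (1 : A) m).trans (one_smul A m))
  rcoassoc := Bimodule.hom_ext fun m =>
    congrArg (fun e : (F.obj (self C)).obj ⟶ _ => e m) (F.obj (self C)).coassoc
  rcounit := Bimodule.hom_ext fun m =>
    congrArg (fun e : (F.obj (self C)).obj ⟶ _ => e m) (F.obj (self C)).counit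
  bicomod := by
    have h : imageRcoact F ≫ tmap hF.lcoact (𝟙 D.obj) =
        hF.lcoact ≫ tmap (𝟙 C.obj) (imageRcoact F) ≫
          assocInv C.obj (imageBimodule F) D.obj :=
      Bimodule.hom_ext hF.bicomod_apply
    rw [← Category.assoc, h]
    simp only [Category.assoc]
    rw [assocInv_assocHom, Category.comp_id]

end IsTensorial

end Image

end Corings

/-! ### The comparison of F(X) with the cotensor product -/

namespace Corings

open Bimodule RComod

variable {k : Type u} [CommRing k] {A B : Type u} [Ring A] [Algebra k A] [Ring B] [Algebra k B]

variable {C : Coring k A} {D : Coring k B} (F : RComod C ⥤ RComod D) [F.Additive] [F.Linear k]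

namespace IsTensorial

variable {F} (hF : IsTensorial F)

/-- The isomorphism `X ⊗_A F(C) → F(X ⊗_A C)`. -/
noncomputable def iso (X : Bimodule k k A) :
    tensor X hF.bicomod.obj ≅ (F.obj ((cofree C).obj X)).obj :=
  letI : IsIso (imageMap F X) := Bimodule.isIso_of_bijective _ (hF X)
  show tensor X (imageBimodule F) ≅ (F.obj ((cofree C).obj X)).obj from asIso (imageMap F X)

theorem iso_hom_naturality {X Y : Bimodule k k A} (f : X ⟶ Y) :
    tmap f (𝟙 hF.bicomod.obj) ≫ (hF.iso Y).hom =
      (hF.iso X).hom ≫ (F.map ((cofree C).map f)).hom :=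
  imageMap_naturality F f

theorem iso_hom_colinear (X : Bimodule k k A) :
    hF.bicomod.tensorCoact X ≫ tmap (hF.iso X).hom (𝟙 D.obj) =
      (hF.iso X).hom ≫ (F.obj ((cofree C).obj X)).coact :=
  imageMap_colinear F X

theorem lcoact_iso_hom (X : Bimodule k k A) :
    tmap (𝟙 X) hF.bicomod.lcoact ≫ assocInv X C.obj hF.bicomod.obj ≫
      (hF.iso (tensor X C.obj)).hom = (hF.iso X).hom ≫ (F.map (cofreeCoact X)).hom :=
  hF.imageMap_tmap_lcoact X

/-- The term ρ ⊗ M becomes F(ρ ⊗ C) by naturality of the comparison, and the term X ⊗ λ becomes F(X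
⊗ Δ) by construction of λ. -/
theorem omega_iso_hom (X : RComod C) :
    hF.bicomod.omega X ≫ assocInv X.obj C.obj hF.bicomod.obj ≫
      (hF.iso (tensor X.obj C.obj)).hom = (hF.iso X.obj).hom ≫
        ((F.map ((cofree C).map X.coact)).hom - (F.map (cofreeCoact X.obj)).hom) := by
  unfold Bicomod.omega
  rw [Preadditive.sub_comp, lcoact_iso_hom, Category.assoc, ← Category.assoc (assocHom _ _ _),
    assocHom_assocInv, Category.id_comp, iso_hom_naturality, Preadditive.comp_sub]

/-- The map `F(X) → X ⊗_A F(C)`. -/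
noncomputable def toTensor (X : RComod C) : (F.obj X).obj ⟶ tensor X.obj hF.bicomod.obj :=
  (F.map X.coactHom).hom ≫ (hF.iso X.obj).inv

theorem toTensor_iso_hom (X : RComod C) :
    hF.toTensor X ≫ (hF.iso X.obj).hom = (F.map X.coactHom).hom := by
  unfold toTensor
  rw [Category.assoc, Iso.inv_hom_id, Category.comp_id]

theorem map_coactHom_eq (F : RComod C ⥤ RComod D) (X : RComod C) :
    (F.map X.coactHom).hom ≫ (F.map ((cofree C).map X.coact)).hom =
      (F.map X.coactHom).hom ≫ (F.map (cofreeCoact X.obj)).hom := by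
  have h : X.coactHom ≫ (cofree C).map X.coact = X.coactHom ≫ cofreeCoact X.obj :=
    coactHom_naturality X.coactHom
  rw [← RComod.comp_hom, ← RComod.comp_hom, ← F.map_comp, ← F.map_comp, h]

theorem toTensor_omega (X : RComod C) : hF.toTensor X ≫ hF.bicomod.omega X = 0 := by
  have h : hF.toTensor X ≫ hF.bicomod.omega X ≫ assocInv X.obj C.obj hF.bicomod.obj ≫
      (hF.iso (tensor X.obj C.obj)).hom = 0 := by
    rw [omega_iso_hom, ← Category.assoc, toTensor_iso_hom, Preadditive.comp_sub, map_coactHom_eq,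
      sub_self]
  have h2 := congrArg (fun e => e ≫ (hF.iso (tensor X.obj C.obj)).inv ≫
    assocHom X.obj C.obj hF.bicomod.obj) h
  simpa only [Category.assoc, Iso.hom_inv_id_assoc, assocInv_assocHom, Category.comp_id,
    zero_comp] using h2

/-- The map `F(X) → X □_C F(C)`. -/
noncomputable def toCotensor (X : RComod C) : (F.obj X).obj ⟶ hF.bicomod.cotensorModule X :=
  kerLift (hF.bicomod.omega X) (hF.toTensor X) (hF.toTensor_omega X)

theorem toCotensor_ι (X : RComod C) :
    hF.toCotensor X ≫ hF.bicomod.cotensorι X = hF.toTensor X := rfl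

theorem toTensor_naturality {X Y : RComod C} (f : X ⟶ Y) :
    (F.map f).hom ≫ hF.toTensor Y = hF.toTensor X ≫ tmap f.hom (𝟙 hF.bicomod.obj) := by
  rw [← cancel_mono (hF.iso Y.obj).hom, Category.assoc, toTensor_iso_hom, Category.assoc,
    iso_hom_naturality, ← Category.assoc, toTensor_iso_hom, ← RComod.comp_hom, ← RComod.comp_hom,
    ← F.map_comp, ← F.map_comp, coactHom_naturality]

theorem toCotensor_naturality {X Y : RComod C} (f : X ⟶ Y) :
    (F.map f).hom ≫ hF.toCotensor Y = hF.toCotensor X ≫ hF.bicomod.cotensorMap f := by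
  refine eq_of_comp_injective (hF.bicomod.cotensorι Y) (kerι_injective (hF.bicomod.omega Y)) ?_
  rw [Category.assoc, toCotensor_ι, toTensor_naturality, Category.assoc, Bicomod.cotensorMap_ι,
    ← Category.assoc, toCotensor_ι]

theorem toTensor_colinear (X : RComod C) :
    (F.obj X).coact ≫ tmap (hF.toTensor X) (𝟙 D.obj) =
      hF.toTensor X ≫ hF.bicomod.tensorCoact X.obj := by
  have := isIso_tmap_left (hF.iso X.obj).hom D.obj
  rw [← cancel_mono (tmap (hF.iso X.obj).hom (𝟙 D.obj)), Category.assoc, ← tmap_comp_left,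
    toTensor_iso_hom, Category.assoc, iso_hom_colinear, ← Category.assoc, toTensor_iso_hom]
  exact (F.map X.coactHom).comm

theorem toCotensor_colinear (h : hF.bicomod.HasCotensor) (X : RComod C) :
    (F.obj X).coact ≫ tmap (hF.toCotensor X) (𝟙 D.obj) =
      hF.toCotensor X ≫ h.cotensorCoact X := by
  refine eq_of_comp_injective (tmap (hF.bicomod.cotensorι X) (𝟙 D.obj)) (h.pure X).injective ?_
  rw [Category.assoc, ← tmap_comp_left, toCotensor_ι, toTensor_colinear, Category.assoc,
    h.cotensorCoact_ι, ← Category.assoc, toCotensor_ι]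

end IsTensorial

/-- `F` preserves the equalizer of `X ⊗ C ⇉ X ⊗ C ⊗ C` for all comodules `X`. -/
structure PreservesCoactFork (F : RComod C ⥤ RComod D) : Prop where
  injective : ∀ X : RComod C, Function.Injective (F.map X.coactHom).hom
  exact : ∀ (X : RComod C) (y : (F.obj ((cofree C).obj X.obj)).obj),
    (F.map ((cofree C).map X.coact)).hom y = (F.map (cofreeCoact X.obj)).hom y →
      ∃ x, (F.map X.coactHom).hom x = y

namespace IsTensorial

variable {F} (hF : IsTensorial F)

theorem toTensor_injective (h' : PreservesCoactFork F) (X : RComod C) : Function.Injective (hF.toTensor X) := fun x y hxy =>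
  h'.injective X (by
    rw [← hF.toTensor_iso_hom, Bimodule.comp_apply, Bimodule.comp_apply, hxy])

/-- Kernels of identified maps agree: X □ M is the kernel of ω, and F(X) is the kernel of F(ρ ⊗ C) -
F(X ⊗ Δ) because F keeps the fork. -/
theorem toCotensor_bijective (h' : PreservesCoactFork F) (X : RComod C) : Function.Bijective (hF.toCotensor X) := by
  refine ⟨fun x y hxy => hF.toTensor_injective h' X ?_, fun t => ?_⟩
  · rw [← hF.toCotensor_ι, Bimodule.comp_apply, Bimodule.comp_apply, hxy]
  · have hω : hF.bicomod.omega X (hF.bicomod.cotensorι X t) = 0 :=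
      congrArg (fun e : hF.bicomod.cotensorModule X ⟶ _ => e t) (hF.bicomod.cotensorι_omega X)
    have h1 := congrArg (fun e : tensor X.obj hF.bicomod.obj ⟶ _ => e (hF.bicomod.cotensorι X t))
      (hF.omega_iso_hom X)
    simp only [Bimodule.comp_apply, hω, hom_zero, Bimodule.sub_apply] at h1
    obtain ⟨x, hx⟩ := h'.exact X _ (sub_eq_zero.1 h1.symm)
    refine ⟨x, kerι_injective (hF.bicomod.omega X) ((bijective_of_isIso (hF.iso X.obj).hom).1 ?_)⟩
    refine Eq.trans ?_ hx
    exact congrArg (fun e : (F.obj X).obj ⟶ _ => e x) (hF.toTensor_iso_hom X)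

/-- `F` is isomorphic to the cotensor product with `F(C)`. -/
noncomputable def isoCotensorFunctor (h' : PreservesCoactFork F)
    (h : hF.bicomod.HasCotensor) : F ≅ h.cotensorFunctor :=
  NatIso.ofComponents
    (fun X =>
      haveI := RComod.isIso_of_bijective (X := F.obj X) (Y := h.cotensorObj X)
        ⟨hF.toCotensor X, hF.toCotensor_colinear h X⟩ (hF.toCotensor_bijective h' X)
      asIso (X := F.obj X) (Y := h.cotensorObj X)
        ⟨hF.toCotensor X, hF.toCotensor_colinear h X⟩)
    (fun f => RComod.hom_ext (hF.toCotensor_naturality f))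

end IsTensorial

end Corings

/-! ### Conditions under which the comparison map is bijective -/

namespace Corings

open Bimodule RComod

variable {k : Type u} [CommRing k] {A B : Type u} [Ring A] [Algebra k A] [Ring B] [Algebra k B]

namespace Bimodule

section Transformations

variable {𝒟 : Type*} [Category.{u} 𝒟] {P Q : Bimodule k k A ⥤ 𝒟} (τ : P ⟶ Q)

variable (k A) in
/-- Right modules as a functor from modules over the opposite ring. -/
noncomputable abbrev ofModuleCat : ModuleCat.{u} Aᵐᵒᵖ ⥤ Bimodule k k A :=
  (toModuleCat k A).asEquivalence.inverse

variable (k A) in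
/-- The ring as a right module. -/
noncomputable def ofModuleCatRing :
    (ofModuleCat k A).obj (ModuleCat.of Aᵐᵒᵖ Aᵐᵒᵖ) ≅ res (unit k A) :=
  (ofModuleCat k A).mapIso (LinearEquiv.toModuleIso
    { MulOpposite.opAddEquiv (α := A) with map_smul' := fun _ _ => rfl } :
      (toModuleCat k A).obj (res (unit k A)) ≅ ModuleCat.of Aᵐᵒᵖ Aᵐᵒᵖ).symm ≪≫
    ((toModuleCat k A).asEquivalence.unitIso.app (res (unit k A))).symm

theorem isIso_app_of_iso {𝒞 : Type*} [Category 𝒞] {P Q : 𝒞 ⥤ 𝒟} (τ : P ⟶ Q) {X Y : 𝒞} (e : X ≅ Y)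
    (h : IsIso (τ.app X)) : IsIso (τ.app Y) :=
  isIso_app_of_retract τ e.inv e.hom e.inv_hom_id

theorem isIso_app_of_moduleCat (H : ∀ Y, IsIso ((Functor.whiskerLeft (ofModuleCat k A) τ).app Y))
    (X : Bimodule k k A) : IsIso (τ.app X) :=
  isIso_app_of_iso τ ((toModuleCat k A).asEquivalence.unitIso.app X).symm (H _)

theorem isIso_app_ofModuleCat_ring (h : IsIso (τ.app (res (unit k A)))) :
    IsIso ((Functor.whiskerLeft (ofModuleCat k A) τ).app (ModuleCat.of Aᵐᵒᵖ Aᵐᵒᵖ)) :=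
  isIso_app_of_iso τ (ofModuleCatRing k A).symm h

end Transformations

theorem lUnit_bijective (X : Bimodule k A B) : Function.Bijective (lUnit X) :=
  Function.bijective_iff_has_inverse.2 ⟨fun x => tm (X := unit k A) (1 : A) x,
    fun t => lUnit_section X t, fun x => (lUnit_tm X (1 : A) x).trans (one_smul A x)⟩

end Bimodule

section Image

variable {C : Coring k A} {D : Coring k B}

theorem isIso_tensorLeft_one : IsIso (tensorLeft (C := C) (X := res (unit k A)) (1 : A)) :=
  RComod.isIso_of_bijective _ (Function.bijective_iff_has_inverse.2 ⟨lUnit C.obj,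
    fun c => (lUnit_tm C.obj (1 : A) (show C.obj from c)).trans (one_smul A _),
    fun t => lUnit_section C.obj t⟩)

variable (F : RComod C ⥤ RComod D) [F.Additive] [F.Linear k]

/-- The base case X = A: up to the unit isomorphism A ⊗ F(C) → F(C), the comparison map is F applied
to the isomorphism C → A ⊗ C. -/
theorem imageMap_unit (t : tensor (unit k A) (imageBimodule F)) :
    imageMap F (res (unit k A)) (tensorRes t) =
      imageEval F (tensorLeft (X := res (unit k A)) (1 : A)) (lUnit (imageBimodule F) t) := by
  induction t using tensor_induction with
  | tm a m =>
    refine (imageMap_tm F (X := res (unit k A)) a m).trans ?_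
    refine Eq.trans ?_ (congrArg (imageEval F (tensorLeft (X := res (unit k A)) (1 : A)))
      (lUnit_tm (imageBimodule F) (show A from a) m)).symm
    rw [imageEval_smul]
    have h := tensorLeft_smul (C := C) (X := res (unit k A)) (show A from a) (1 : A)
    have h2 : op (show A from a) • (show res (unit k A) from (1 : A)) = a :=
      one_mul (show A from a)
    exact congrArg (fun e => imageEval F e m)
      ((congrArg (fun e => tensorLeft (C := C) (X := res (unit k A)) e) h2).symm.trans h)
  | zero => rw [tensorRes_zero, hom_zero, hom_zero, map_zero]
  | add t t' ht ht' => rw [tensorRes_add, hom_add, hom_add, map_add, ht, ht']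

theorem imageMap_unit_bijective : Function.Bijective (imageMap F (res (unit k A))) := by
  have := isIso_tensorLeft_one (C := C)
  have h1 : Function.Bijective (F.map (tensorLeft (C := C) (X := res (unit k A)) (1 : A))).hom :=
    have : IsIso ((RComod.forget D).map
      (F.map (tensorLeft (C := C) (X := res (unit k A)) (1 : A)))) := inferInstance
    Bimodule.bijective_of_isIso ((RComod.forget D).map
      (F.map (tensorLeft (C := C) (X := res (unit k A)) (1 : A))))
  have h2 := h1.comp (lUnit_bijective (imageBimodule F))
  have h3 : Function.Bijective fun t : tensor (unit k A) (imageBimodule F) =>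
      imageMap F (res (unit k A)) (tensorRes t) := by
    rw [funext (imageMap_unit F)]
    exact h2
  exact h3

/-- The natural transformation `X ⊗_A F(C) → F(X ⊗_A C)`. -/
def imageTrans : tensorRight (imageBimodule F) ⟶ cofree C ⋙ F ⋙ RComod.forget D where
  app X := imageMap F X
  naturality _ _ f := imageMap_naturality F f

theorem isIso_imageTrans_unit : IsIso ((imageTrans F).app (res (unit k A))) :=
  Bimodule.isIso_of_bijective _ (imageMap_unit_bijective F)

theorem isTensorial_of_isIso (H : ∀ Y,
    IsIso ((Functor.whiskerLeft (ofModuleCat k A) (imageTrans F)).app Y)) : IsTensorial F :=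
  fun X =>
    have : IsIso ((imageTrans F).app X) := isIso_app_of_moduleCat (imageTrans F) H X
    Bimodule.bijective_of_isIso ((imageTrans F).app X)

theorem isTensorial_of_preservesColimits [PreservesColimits F] : IsTensorial F :=
  isTensorial_of_isIso F (isIso_app_of_preservesColimits _
    (isIso_app_ofModuleCat_ring _ (isIso_imageTrans_unit F)))

theorem isTensorial_of_isSemisimpleRing [IsSemisimpleRing A]
    [∀ J : Type u, PreservesColimitsOfShape (Discrete J) F] : IsTensorial F :=
  isTensorial_of_isIso F fun Y =>
    have : Module.Projective Aᵐᵒᵖ Y := Module.projective_of_isSemisimpleRing Aᵐᵒᵖ Y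
    isIso_app_of_projective _ (isIso_app_ofModuleCat_ring _ (isIso_imageTrans_unit F)) Y

/-- Coproducts, needed to reach free modules, come from filtered colimits because F is additive. -/
theorem isTensorial_of_isVonNeumannRegular (hA : IsVonNeumannRegular A)
    [PreservesFilteredColimits F] : IsTensorial F :=
  have := preservesCoproducts_of_preservesFilteredColimits F
  isTensorial_of_isIso F (isIso_app_of_isVonNeumannRegular _ hA.mulOpposite
    (isIso_app_ofModuleCat_ring _ (isIso_imageTrans_unit F)))

end Image

end Corings

/-! ### The equalizer presenting a comodule -/

namespace Corings

open Bimodule RComod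

variable {k : Type u} [CommRing k] {A B : Type u} [Ring A] [Algebra k A] [Ring B] [Algebra k B]

variable {C : Coring k A} {D : Coring k B}

namespace RComod

/-- A map into a cofree comodule equalizing the two coactions factors through the comodule. -/
theorem comp_cofreeCounit_coact {W : Bimodule k k A} (X : RComod C) (g : W ⟶ tensor X.obj C.obj)
    (h : g ≫ tmap X.coact (𝟙 C.obj) =
      g ≫ tmap (𝟙 X.obj) C.comul ≫ assocInv X.obj C.obj C.obj) :
    (g ≫ cofreeCounit C X.obj) ≫ X.coact = g := by
  rw [Category.assoc, ← cofreeCounit_naturality, ← Category.assoc, h, Category.assoc]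
  exact (congrArg (g ≫ ·) (coact_cofreeCounit ((cofree C).obj X.obj))).trans (Category.comp_id g)

theorem coactHom_comp (X : RComod C) :
    X.coactHom ≫ ((cofree C).map X.coact - cofreeCoact X.obj) = 0 := by
  rw [Preadditive.comp_sub, sub_eq_zero]
  exact coactHom_naturality X.coactHom

theorem lift_condition {W X : RComod C} (g : W ⟶ (cofree C).obj X.obj)
    (h : g ≫ ((cofree C).map X.coact - cofreeCoact X.obj) = 0) :
    g.hom ≫ tmap X.coact (𝟙 C.obj) =
      g.hom ≫ tmap (𝟙 X.obj) C.comul ≫ assocInv X.obj C.obj C.obj := by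
  rw [Preadditive.comp_sub, sub_eq_zero] at h
  exact congrArg Hom.hom h

/-- A comodule is the equalizer of the two coactions on `X ⊗ C`. -/
def coactHomIsLimit (X : RComod C) :
    IsLimit (KernelFork.ofι X.coactHom X.coactHom_comp) :=
  KernelFork.IsLimit.ofι _ _
    (fun {W} g h => ⟨g.hom ≫ cofreeCounit C X.obj,
      (W.coact_tmap_comp_cofreeCounit g.hom g.comm).trans
        (X.comp_cofreeCounit_coact g.hom (lift_condition g h)).symm⟩)
    (fun g h => RComod.hom_ext (X.comp_cofreeCounit_coact g.hom (lift_condition g h)))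
    (fun {W} g h m hm => RComod.hom_ext (by
      subst hm
      exact (Category.comp_id m.hom).symm.trans ((congrArg (m.hom ≫ ·)
        X.coact_cofreeCounit.symm).trans (Category.assoc _ _ _).symm)))

end RComod

/-- Flatness of D makes the forgetful functor left exact, so F followed by it sends the kernel X → X
⊗ C to a kernel of modules, where exactness can be read on elements. -/
theorem preservesCoactFork_of_preservesFiniteLimits (hD : FlatLeft B D.obj)
    (F : RComod C ⥤ RComod D) [F.Additive] [PreservesFiniteLimits F] : PreservesCoactFork F := by
  have := RComod.forget_preservesFiniteLimits hD
  have : PreservesFiniteLimits (F ⋙ RComod.forget D) := comp_preservesFiniteLimits _ _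
  have w (X : RComod C) : (F ⋙ RComod.forget D).map X.coactHom ≫
      (F ⋙ RComod.forget D).map ((cofree C).map X.coact - cofreeCoact X.obj) = 0 := by
    rw [← Functor.map_comp, X.coactHom_comp, Functor.map_zero]
  have H := fun X : RComod C => exact_of_isLimit (w := w X)
    (KernelFork.mapIsLimit _ X.coactHomIsLimit (F ⋙ RComod.forget D))
  refine ⟨fun X => (H X).1, fun X y hy => (H X).2 y ?_⟩
  have h1 : (F ⋙ RComod.forget D).map ((cofree C).map X.coact - cofreeCoact X.obj) =
    (F.map ((cofree C).map X.coact)).hom - (F.map (cofreeCoact X.obj)).hom := by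
    rw [Functor.map_sub]; rfl
  rw [h1]
  exact sub_eq_zero.2 hy

/-! ### Coseparable corings -/

section Coseparable

/-- The map `x ⊗ c ⊗ c' ↦ x θ(c ⊗ c')`. -/
def contract (θ : tensor C.obj C.obj ⟶ unit k A) (X : Bimodule k k A) :
    tensor (tensor X C.obj) C.obj ⟶ X :=
  assocHom X C.obj C.obj ≫ tmap (𝟙 X) θ ≫ rUnit X

theorem contract_tm (θ : tensor C.obj C.obj ⟶ unit k A) (X : Bimodule k k A) (x : X)
    (c c' : C.obj) : contract θ X (tm (tm x c) c') = op (show A from θ (tm c c')) • x := by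
  unfold contract
  rw [Bimodule.comp_apply, Bimodule.comp_apply, assocHom_tm, tmap_tm]
  exact rUnit_tm X x _

theorem contract_naturality (θ : tensor C.obj C.obj ⟶ unit k A) {X Y : Bimodule k k A}
    (f : X ⟶ Y) : tmap (tmap f (𝟙 C.obj)) (𝟙 C.obj) ≫ contract θ Y = contract θ X ≫ f :=
  tensor_hom_ext₃ fun x c c' => by
    simp only [Bimodule.comp_apply, tmap_tm, Bimodule.id_apply, contract_tm, hom_rsmul]

/-- Contracting the last two factors does not touch x, so the computation takes place inside C. In
the companion statement below, θ contracts the two middle factors instead. -/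
theorem contract_assocInv (θ : tensor C.obj C.obj ⟶ unit k A) (X : Bimodule k k A) (x : X)
    (t : tensor C.obj C.obj) (c' : C.obj) :
    contract θ (tensor X C.obj) (tm (assocInv X C.obj C.obj (tm x t)) c') =
      tm x (rUnit C.obj (tmap (𝟙 C.obj) θ (assocHom C.obj C.obj C.obj (tm t c')))) := by
  induction t using tensor_induction with
  | tm c₁ c₂ =>
    rw [assocInv_tm, contract_tm, assocHom_tm, tmap_tm, smul_tm', Bimodule.id_apply]
    exact congrArg (tm x) (rUnit_tm C.obj c₁ _).symm
  | zero => rw [tm_zero, hom_zero, zero_tm, zero_tm, hom_zero, hom_zero, hom_zero, hom_zero, tm_zero]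
  | add t t' ht ht' =>
    rw [tm_add, hom_add, add_tm, hom_add, ht, ht', add_tm, hom_add, hom_add, hom_add, tm_add]

theorem tmap_contract_assocInv (θ : tensor C.obj C.obj ⟶ unit k A) (X : Bimodule k k A) (x : X)
    (c : C.obj) (t : tensor C.obj C.obj) :
    tmap (contract θ X) (𝟙 C.obj) (assocInv (tensor X C.obj) C.obj C.obj (tm (tm x c) t)) =
      tm x (lUnit C.obj (tmap θ (𝟙 C.obj) (assocInv C.obj C.obj C.obj (tm c t)))) := by
  induction t using tensor_induction with
  | tm c₁ c₂ =>
    rw [assocInv_tm, tmap_tm, contract_tm, assocInv_tm, tmap_tm, Bimodule.id_apply, rsmul_tm]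
    exact congrArg (tm x) (lUnit_tm C.obj (show A from θ (tm c c₁)) c₂).symm
  | zero => rw [tm_zero, tm_zero, hom_zero, hom_zero, hom_zero, hom_zero, hom_zero, tm_zero]
  | add t t' ht ht' =>
    rw [tm_add, hom_add, hom_add, ht, ht', tm_add, hom_add, hom_add, hom_add, tm_add]

/-- The retraction `x ⊗ c ↦ x₀ θ(x₁ ⊗ c)` of the coaction. -/
def coactRetraction (θ : tensor C.obj C.obj ⟶ unit k A) (X : RComod C) :
    tensor X.obj C.obj ⟶ X.obj :=
  tmap X.coact (𝟙 C.obj) ≫ contract θ X.obj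

variable {p : tensor C.obj C.obj ⟶ C.obj}

/-- With θ = ε ∘ p, left colinearity of p gives p(c ⊗ c') = c₁ θ(c₂ ⊗ c'). Hence the retraction r
satisfies ρ(r(x ⊗ c)) = x₀ ⊗ p(x₁ ⊗ c). -/
theorem coactRetraction_coact
    (hl : tmap C.comul (𝟙 C.obj) ≫ assocHom C.obj C.obj C.obj ≫ tmap (𝟙 C.obj) p = p ≫ C.comul)
    (X : RComod C) : coactRetraction (p ≫ C.counit) X ≫ X.coact =
      tmap X.coact (𝟙 C.obj) ≫ assocHom X.obj C.obj C.obj ≫ tmap (𝟙 X.obj) p := by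
  have hL : tmap C.comul (𝟙 C.obj) ≫ assocHom C.obj C.obj C.obj ≫
      tmap (𝟙 C.obj) (p ≫ C.counit) ≫ rUnit C.obj = p := by
    rw [tmap_comp_right]
    simp only [← Category.assoc] at hl ⊢
    rw [hl]
    simp only [Category.assoc]
    rw [C.counit_right, Category.comp_id]
  unfold coactRetraction
  rw [Category.assoc, ← contract_naturality, ← Category.assoc, ← tmap_comp_left, X.coassoc',
    tmap_comp_left, Category.assoc]
  congr 1
  refine tensor_hom_ext₃ fun x c c' => ?_
  have h := congrArg (fun e : tensor C.obj C.obj ⟶ C.obj => e (tm c c')) hL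
  simp only [Bimodule.comp_apply, tmap_tm, Bimodule.id_apply, assocHom_tm] at h ⊢
  rw [contract_assocInv, h]

/-- Right colinearity of p gives p(c ⊗ c') = θ(c ⊗ c'₁) c'₂, so r(x ⊗ c₁) ⊗ c₂ is again x₀ ⊗ p(x₁ ⊗
c). Comparison with the previous lemma shows that r is colinear. -/
theorem tmap_coactRetraction
    (hr : tmap (𝟙 C.obj) C.comul ≫ assocInv C.obj C.obj C.obj ≫ tmap p (𝟙 C.obj) = p ≫ C.comul)
    (X : RComod C) : (tmap (𝟙 X.obj) C.comul ≫ assocInv X.obj C.obj C.obj) ≫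
        tmap (coactRetraction (p ≫ C.counit) X) (𝟙 C.obj) =
      tmap X.coact (𝟙 C.obj) ≫ assocHom X.obj C.obj C.obj ≫ tmap (𝟙 X.obj) p := by
  have hR : tmap (𝟙 C.obj) C.comul ≫ assocInv C.obj C.obj C.obj ≫
      tmap (p ≫ C.counit) (𝟙 C.obj) ≫ lUnit C.obj = p := by
    rw [tmap_comp_left]
    simp only [← Category.assoc] at hr ⊢
    rw [hr]
    simp only [Category.assoc]
    rw [C.counit_left, Category.comp_id]
  have h0 : (tmap (𝟙 X.obj) C.comul ≫ assocInv X.obj C.obj C.obj) ≫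
      tmap (tmap X.coact (𝟙 C.obj)) (𝟙 C.obj) = tmap X.coact (𝟙 C.obj) ≫
        tmap (𝟙 (tensor X.obj C.obj)) C.comul ≫ assocInv (tensor X.obj C.obj) C.obj C.obj :=
    ((cofree C).map X.coact).comm
  unfold coactRetraction
  rw [tmap_comp_left, ← Category.assoc, h0, Category.assoc]
  congr 1
  refine tensor_hom_ext₃ fun x c c' => ?_
  have h := congrArg (fun e : tensor C.obj C.obj ⟶ C.obj => e (tm c c')) hR
  simp only [Bimodule.comp_apply, tmap_tm, Bimodule.id_apply, assocHom_tm] at h ⊢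
  rw [tmap_contract_assocInv, h]

/-- By coassociativity, r(ρ(x)) = x₀ ε(p(Δ(x₁))) = x₀ ε(x₁) = x. -/
theorem coact_coactRetraction (hp : C.comul ≫ p = 𝟙 C.obj) (X : RComod C) :
    X.coact ≫ coactRetraction (p ≫ C.counit) X = 𝟙 X.obj := by
  unfold coactRetraction contract
  have h := X.coassoc
  simp only [← Category.assoc] at h ⊢
  rw [h]
  simp only [Category.assoc]
  rw [← Category.assoc (tmap _ _) (tmap _ _), ← tmap_comp_right, ← Category.assoc C.comul, hp,
    Category.id_comp, X.counit]

/-- Over a coseparable coring, the coaction is a split monomorphism of comodules. -/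
theorem Coring.IsCoseparable.exists_retraction (h : C.IsCoseparable) (X : RComod C) :
    ∃ r : (cofree C).obj X.obj ⟶ X, X.coactHom ≫ r = 𝟙 X := by
  obtain ⟨p, hl, hr, hp⟩ := h
  exact ⟨⟨coactRetraction (p ≫ C.counit) X,
    (tmap_coactRetraction hr X).trans (coactRetraction_coact hl X).symm⟩,
    RComod.hom_ext (coact_coactRetraction hp X)⟩

/-- A colinear retraction r of ρ splits the fork in the category of comodules, and split equalizers
are preserved by every functor. -/
theorem preservesCoactFork_of_isCoseparable (h : C.IsCoseparable) (F : RComod C ⥤ RComod D) :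
    PreservesCoactFork F where
  injective X := by
    obtain ⟨r, hr⟩ := h.exists_retraction X
    refine Function.LeftInverse.injective (g := (F.map r).hom) fun x => ?_
    have h1 : F.map X.coactHom ≫ F.map r = 𝟙 _ := by rw [← F.map_comp, hr, F.map_id]
    exact congrArg (fun e : F.obj X ⟶ F.obj X => e.hom x) h1
  exact X y hy := by
    obtain ⟨r, hr⟩ := h.exists_retraction X
    -- The map t = r ⊗ C splits the fork: it is a retraction of ρ ⊗ C, and its composite with X ⊗ Δ
    -- is ρ ∘ r by colinearity of r. Hence y = F(ρ)(F(r)(y)).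
    let t : (cofree C).obj (tensor X.obj C.obj) ⟶ (cofree C).obj X.obj := (cofree C).map r.hom
    have h1 : F.map ((cofree C).map X.coact) ≫ F.map t = 𝟙 _ := by
      have hr' : X.coact ≫ r.hom = 𝟙 X.obj := congrArg Hom.hom hr
      have h' : (cofree C).map X.coact ≫ t = 𝟙 _ :=
        ((cofree C).map_comp X.coact r.hom).symm.trans
          ((congrArg (cofree C).map hr').trans ((cofree C).map_id X.obj))
      rw [← F.map_comp, h', F.map_id]
    have h2 : F.map (cofreeCoact X.obj) ≫ F.map t = F.map r ≫ F.map X.coactHom := by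
      rw [← F.map_comp, ← F.map_comp]
      exact congrArg F.map (coactHom_naturality r)
    refine ⟨(F.map r).hom y, ?_⟩
    refine (congrArg (fun e => e.hom y) h2).symm.trans ?_
    refine (congrArg (F.map t).hom hy.symm).trans ?_
    exact congrArg (fun e => e.hom y) h1

end Coseparable

end Corings

/-! ### Well-definedness of the cotensor product over a coseparable coring -/

namespace Corings

open Bimodule

variable {k : Type u} [CommRing k] {A B : Type u} [Ring A] [Algebra k A] [Ring B] [Algebra k B]

namespace Bimodule

variable {E : Type u} [Ring E] [Algebra k E]

theorem tmap_injective_of_retraction {X Y : Bimodule k A B} {i : X ⟶ Y} {q : Y ⟶ X} (h : i ≫ q = 𝟙 X)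
    (Z : Bimodule k B E) : Function.Injective (tmap i (𝟙 Z)) :=
  Function.LeftInverse.injective (g := tmap q (𝟙 Z)) fun t => by
    rw [← Bimodule.comp_apply, ← tmap_comp_left, h, tmap_id, Bimodule.id_apply]

/-- A morphism with a contractible kernel is pure. -/
theorem isPure_of_retraction {X Y : Bimodule k A B} {f : X ⟶ Y} {q : X ⟶ ker f} {β : Y ⟶ X}
    (h₁ : kerι f ≫ q = 𝟙 _) (h₂ : f ≫ β + q ≫ kerι f = 𝟙 X) (Z : Bimodule k B E) : IsPure f Z where
  injective := tmap_injective_of_retraction h₁ Z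
  exact t ht := ⟨tmap q (𝟙 Z) t, by
    have h := congrArg (fun e : tensor X Z ⟶ tensor X Z => e t)
      (congrArg (fun e => tmap e (𝟙 Z)) h₂)
    simp only [tmap_add_left, tmap_comp_left, tmap_id, Bimodule.add_apply, Bimodule.comp_apply, ht,
      hom_zero, zero_add, Bimodule.id_apply] at h
    exact h⟩

end Bimodule

namespace Bicomod

variable {C : Coring k A} {D : Coring k B} (M : Bicomod C D) {X : RComod C}

/-- The map `x ⊗ c ⊗ m ↦ r(x ⊗ c) ⊗ m`. -/
def homotopy (r : tensor X.obj C.obj ⟶ X.obj) :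
    tensor X.obj (tensor C.obj M.obj) ⟶ tensor X.obj M.obj :=
  assocInv X.obj C.obj M.obj ≫ tmap r (𝟙 M.obj)

/-- The term ρ ⊗ M of ω is split by r ⊗ M, which leaves only the term of X ⊗ λ to compensate. -/
theorem omega_homotopy {r : tensor X.obj C.obj ⟶ X.obj} (hr : X.coact ≫ r = 𝟙 X.obj) :
    M.omega X ≫ M.homotopy r + tmap (𝟙 X.obj) M.lcoact ≫ M.homotopy r = 𝟙 _ := by
  unfold omega homotopy
  rw [Preadditive.sub_comp, sub_add_cancel, Category.assoc, ← Category.assoc (assocHom _ _ _),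
    assocHom_assocInv, Category.id_comp, ← tmap_comp_left, hr, tmap_id]

/-- By colinearity of r and coassociativity of λ, the endomorphism (r ⊗ M) ∘ (X ⊗ λ) of X ⊗ M lands
in X □ M. With the previous lemma it is a projection onto X □ M. -/
theorem lcoact_homotopy_omega {r : tensor X.obj C.obj ⟶ X.obj}
    (hr : (tmap (𝟙 X.obj) C.comul ≫ assocInv X.obj C.obj C.obj) ≫ tmap r (𝟙 C.obj) =
      r ≫ X.coact) :
    (tmap (𝟙 X.obj) M.lcoact ≫ M.homotopy r) ≫ M.omega X = 0 := by
  have h1 : assocInv X.obj C.obj M.obj ≫ tmap (r ≫ X.coact) (𝟙 M.obj) ≫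
      assocHom X.obj C.obj M.obj = tmap (𝟙 X.obj) (tmap C.comul (𝟙 M.obj)) ≫
        tmap (𝟙 X.obj) (assocHom C.obj C.obj M.obj) ≫
          assocInv X.obj C.obj (tensor C.obj M.obj) ≫ tmap r (𝟙 _) := by
    rw [← hr, tmap_comp_left, tmap_comp_left]
    simp only [Category.assoc]
    rw [← Category.assoc (assocInv _ _ _) (tmap (tmap _ _) _), assocInv_naturality,
      ← assocHom_naturality r, tmap_id, Category.assoc]
    congr 1
    simp only [← Category.assoc]
    congr 1
    simp only [Category.assoc]
    exact pentagonAux X.obj C.obj C.obj M.obj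
  unfold omega homotopy
  rw [Preadditive.comp_sub, sub_eq_zero]
  simp only [Category.assoc]
  rw [← Category.assoc (tmap r _) (tmap X.coact _), ← tmap_comp_left, h1, tmap_exchange r,
    ← Category.assoc (assocInv _ _ _) (tmap (𝟙 _) _), ← tmap_id X.obj C.obj, assocInv_naturality]
  simp only [← Category.assoc]
  congr 2
  rw [← tmap_comp_right, ← tmap_comp_right, ← tmap_comp_right, Category.assoc, M.lcoassoc]

/-- The kernel of ω is split off by maps of right B-modules, and such a splitting survives tensoring
with any D, once or twice. -/
theorem hasCotensor_of_isCoseparable (hC : C.IsCoseparable) (M : Bicomod C D) :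
    M.HasCotensor := by
  have H (X : RComod C) : ∃ (q : tensor X.obj M.obj ⟶ ker (M.omega X))
      (β : tensor X.obj (tensor C.obj M.obj) ⟶ tensor X.obj M.obj),
      kerι (M.omega X) ≫ q = 𝟙 _ ∧ M.omega X ≫ β + q ≫ kerι (M.omega X) = 𝟙 _ := by
    obtain ⟨r, hr⟩ := hC.exists_retraction X
    have h₂ := M.omega_homotopy (X := X) (r := r.hom) (congrArg RComod.Hom.hom hr)
    refine ⟨kerLift _ _ (M.lcoact_homotopy_omega r.comm), M.homotopy r.hom, ?_, ?_⟩
    · refine eq_of_comp_injective _ (kerι_injective (M.omega X)) ?_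
      have h₃ := congrArg (fun e => kerι (M.omega X) ≫ e) h₂
      simp only [Preadditive.comp_add, ← Category.assoc (kerι (M.omega X)) (M.omega X), kerι_comp,
        zero_comp, zero_add, Category.comp_id] at h₃
      rw [Category.assoc, kerLift_comp, Category.id_comp]
      exact h₃
    · rw [kerLift_comp]
      exact h₂
  refine ⟨fun X => ?_, fun X => ?_⟩
  · obtain ⟨q, β, h₁, h₂⟩ := H X
    exact isPure_of_retraction h₁ h₂ _
  · obtain ⟨q, β, h₁, h₂⟩ := H X
    refine tmap_injective_of_retraction (q := tmap q (𝟙 D.obj)) ?_ _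
    refine (tmap_comp_left D.obj (kerι (M.omega X)) q).symm.trans ?_
    exact (congrArg (fun e => tmap e (𝟙 D.obj)) h₁).trans (tmap_id _ _)

end Bicomod

end Corings

/-! ### Limits and colimits preserved by cotensor functors -/

namespace Corings

open Bimodule

variable {k : Type u} [CommRing k] {A B : Type u} [Ring A] [Algebra k A] [Ring B] [Algebra k B]

namespace Bicomod

variable {C : Coring k A} {D : Coring k B} (M : Bicomod C D)

/-- The inclusion of the cotensor product, as a natural transformation. -/
def cotensorιTrans : M.cotensorModuleFunctor ⟶ RComod.forget C ⋙ tensorRight M.obj where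
  app X := M.cotensorι X
  naturality _ _ f := M.cotensorMap_ι f

/-- The map `ω`, as a natural transformation. -/
def omegaTrans : RComod.forget C ⋙ tensorRight M.obj ⟶
    RComod.forget C ⋙ tensorRight (tensor C.obj M.obj) where
  app X := M.omega X
  naturality _ _ f := M.omega_naturality f

theorem omega_eq_zero_iff (X : RComod C) (t : tensor X.obj M.obj) :
    M.omega X t = 0 ↔ ∃ s, M.cotensorι X s = t :=
  ⟨fun h => ⟨⟨t, h⟩, rfl⟩, by rintro ⟨s, rfl⟩; exact s.2⟩

/-- Source and target of ω preserve all colimits in X, being composites of left adjoints, and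
filtered colimits commute with the kernel. -/
theorem cotensorModuleFunctor_preservesColimitsOfShape (J : Type u) [SmallCategory J]
    [IsFiltered J] : PreservesColimitsOfShape J M.cotensorModuleFunctor :=
  have := preservesColimitsOfShape_of_kernel
    (Functor.whiskerRight M.cotensorιTrans (toModuleCat k B))
    (Functor.whiskerRight M.omegaTrans (toModuleCat k B))
    (fun X => kerι_injective (M.omega X)) M.omega_eq_zero_iff J
  preservesColimitsOfShape_of_reflects_of_preserves _ (toModuleCat k B)

/-- Flatness of C makes the forgetful functor left exact; the other two hypotheses make the source
and target of ω left exact in X. -/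
theorem cotensorModuleFunctor_preservesFiniteLimits (hC : FlatLeft A C.obj)
    (hM : FlatLeft A M.obj) (hCM : FlatLeft A (tensor C.obj M.obj)) :
    PreservesFiniteLimits M.cotensorModuleFunctor := by
  have := RComod.forget_preservesFiniteLimits hC
  have := tensorRight_preservesFiniteLimits M.obj hM
  have := tensorRight_preservesFiniteLimits (tensor C.obj M.obj) hCM
  have := preservesFiniteLimits_of_kernel
    (Functor.whiskerRight M.cotensorιTrans (toModuleCat k B))
    (Functor.whiskerRight M.omegaTrans (toModuleCat k B))
    (fun X => kerι_injective (M.omega X)) M.omega_eq_zero_iff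
  exact preservesFiniteLimits_of_reflects_of_preserves _ (toModuleCat k B)

namespace HasCotensor

variable {M} (h : M.HasCotensor)

instance : h.cotensorFunctor.Additive where
  map_add {X Y f g} := RComod.hom_ext (eq_of_comp_injective (M.cotensorι Y)
    (kerι_injective (M.omega Y)) (by
      change M.cotensorι X ≫ tmap (f.hom + g.hom) (𝟙 M.obj) =
        M.cotensorι X ≫ tmap f.hom (𝟙 M.obj) + M.cotensorι X ≫ tmap g.hom (𝟙 M.obj)
      rw [tmap_add_left, Preadditive.comp_add]))

theorem cotensorFunctor_preservesFilteredColimits :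
    PreservesFilteredColimits h.cotensorFunctor where
  preserves_filtered_colimits J _ _ :=
    have : PreservesColimitsOfShape J (h.cotensorFunctor ⋙ RComod.forget D) :=
      M.cotensorModuleFunctor_preservesColimitsOfShape J
    preservesColimitsOfShape_of_reflects_of_preserves _ (RComod.forget D)

theorem cotensorFunctor_preservesCoproducts (J : Type u) :
    PreservesColimitsOfShape (Discrete J) h.cotensorFunctor :=
  have := h.cotensorFunctor_preservesFilteredColimits
  preservesCoproducts_of_preservesFilteredColimits _ J

theorem cotensorFunctor_preservesFiniteLimits (hA : IsVonNeumannRegular A)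
    (hD : FlatLeft B D.obj) : PreservesFiniteLimits h.cotensorFunctor := by
  have : PreservesFiniteLimits (h.cotensorFunctor ⋙ RComod.forget D) :=
    M.cotensorModuleFunctor_preservesFiniteLimits (hA.flatLeft _) (hA.flatLeft _) (hA.flatLeft _)
  have := RComod.forget_preservesFiniteLimits hD
  have := RComod.hasFiniteLimits hD
  have : ReflectsFiniteLimits (RComod.forget D) := inferInstance
  exact preservesFiniteLimits_of_reflects_of_preserves _ (RComod.forget D)

/-- Coproducts are automatic for a cotensor functor, so coequalizers are all that has to be assumed.
-/
theorem cotensorFunctor_preservesColimits [HasCoequalizers (RComod C)]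
    [PreservesColimitsOfShape WalkingParallelPair h.cotensorFunctor] :
    PreservesColimits h.cotensorFunctor :=
  have := h.cotensorFunctor_preservesCoproducts
  preservesColimits_of_preservesCoequalizers_and_coproducts _

end HasCotensor

end Bicomod

end Corings

/-! ### The trivial coring and the characterizations -/

namespace Corings

open Bimodule RComod

variable {k : Type u} [CommRing k] {A B : Type u} [Ring A] [Algebra k A] [Ring B] [Algebra k B]

/-- The special adjoint functor theorem applies to modules over the opposite ring, which have the
ring as a separator; the conclusion is carried back along the equivalence with right modules. -/
theorem Bicomod.tensorFunctor_isLeftAdjoint {C : Coring k A} {D : Coring k B} (M : Bicomod C D) :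
    M.tensorFunctor.IsLeftAdjoint := by
  have := M.tensorFunctor_preservesColimits
  have : (ofModuleCat k A ⋙ M.tensorFunctor).IsLeftAdjoint :=
    isLeftAdjoint_of_preservesColimits_of_isSeparating (ModuleCat.isSeparator Aᵐᵒᵖ) _
  have h : (toModuleCat k A ⋙ ofModuleCat k A ⋙ M.tensorFunctor).IsLeftAdjoint := inferInstance
  exact Functor.isLeftAdjoint_of_iso ((Functor.associator _ _ _).symm ≪≫
    Functor.isoWhiskerRight (toModuleCat k A).asEquivalence.unitIso.symm M.tensorFunctor ≪≫
      Functor.leftUnitor _)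

theorem Bimodule.rUnit_section (X : Bimodule k A B) (t : tensor X (unit k B)) :
    tm (Y := unit k B) (rUnit X t) (1 : B) = t := by
  induction t using tensor_induction with
  | tm x b =>
    have h := rsmul_tm (Y := unit k B) (show B from b) x (1 : B)
    have h2 : (show B from b) • (show unit k B from (1 : B)) = b := mul_one (show B from b)
    refine (congrArg (fun e => tm (Y := unit k B) e (1 : B)) (rUnit_tm X x (show B from b))).trans
      (h.trans ?_)
    exact congrArg (fun e : unit k B => tm x e) h2
  | zero =>
    exact (congrArg (fun e => tm (Y := unit k B) e (1 : B)) (hom_zero (rUnit X))).trans (zero_tm _)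
  | add t t' ht ht' =>
    exact (congrArg (fun e => tm (Y := unit k B) e (1 : B)) (hom_add (rUnit X) t t')).trans
      ((add_tm _ _ _).trans (congrArg₂ (· + ·) ht ht'))

/-- Over the trivial coring, the coaction is an isomorphism. -/
theorem RComod.isIso_coactHom_trivial (X : RComod (Coring.trivial k A)) : IsIso X.coactHom := by
  have h1 : ∀ x, rUnit X.obj (tmap (𝟙 X.obj) (𝟙 (unit k A)) (X.coact x)) = x := fun x =>
    congrArg (fun e : X.obj ⟶ X.obj => e x) X.counit
  have h (x : X.obj) : rUnit X.obj (X.coact x) = x :=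
    (congrArg (fun e : tensor X.obj (unit k A) ⟶ tensor X.obj (unit k A) =>
      rUnit X.obj (e (X.coact x))) (tmap_id X.obj (unit k A))).symm.trans (h1 x)
  refine RComod.isIso_of_bijective _ (Function.bijective_iff_has_inverse.2
    ⟨rUnit X.obj, h, fun t => ?_⟩)
  refine (rUnit_section X.obj (X.coact (rUnit X.obj t))).symm.trans ?_
  exact (congrArg (fun e => tm (Y := unit k A) e (1 : A)) (h (rUnit X.obj t))).trans
    (rUnit_section X.obj t)

/-- Over the trivial coring, a tensorial functor is the tensor product with a bicomodule. -/
noncomputable def IsTensorial.isoTensorFunctor {D : Coring k B}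
    {F : RComod (Coring.trivial k A) ⥤ RComod D} [F.Additive] [F.Linear k] (hF : IsTensorial F) :
    F ≅ RComod.forget (Coring.trivial k A) ⋙ hF.bicomod.tensorFunctor :=
  NatIso.ofComponents
    (fun X =>
      haveI : IsIso (hF.toTensor X) := by
        have := X.isIso_coactHom_trivial
        have h : IsIso ((RComod.forget D).map (F.map X.coactHom)) := inferInstance
        have : IsIso (F.map X.coactHom).hom := h
        unfold IsTensorial.toTensor
        infer_instance
      haveI := RComod.isIso_of_bijective (X := F.obj X) (Y := hF.bicomod.tensorObj X.obj)
        ⟨hF.toTensor X, hF.toTensor_colinear X⟩ (Bimodule.bijective_of_isIso (hF.toTensor X))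
      asIso (X := F.obj X) (Y := hF.bicomod.tensorObj X.obj)
        ⟨hF.toTensor X, hF.toTensor_colinear X⟩)
    (fun f => RComod.hom_ext (hF.toTensor_naturality f))

section Characterization

variable {C : Coring k A} {D : Coring k B} (h : ∀ M : Bicomod C D, M.HasCotensor)
  (F : RComod C ⥤ RComod D)

theorem exists_iso_cotensorFunctor [F.Additive] [F.Linear k] (hF : IsTensorial F)
    (hF' : PreservesCoactFork F) : ∃ M : Bicomod C D, Nonempty (F ≅ (h M).cotensorFunctor) :=
  ⟨_, ⟨hF.isoCotensorFunctor hF' (h _)⟩⟩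

theorem preservesFilteredColimits_of_natIso {𝒞 𝒟 : Type*} [Category.{u} 𝒞] [Category.{u} 𝒟]
    {F G : 𝒞 ⥤ 𝒟} (e : F ≅ G) [PreservesFilteredColimits F] : PreservesFilteredColimits G where
  preserves_filtered_colimits _ _ _ := preservesColimitsOfShape_of_natIso e

theorem exists_iso_cotensorFunctor_iff_of_isSemisimpleRing [F.Additive] [F.Linear k]
    (hD : FlatLeft B D.obj) (hA : IsSemisimpleRing A) :
    (PreservesFiniteLimits F ∧ ∀ J : Type u, PreservesColimitsOfShape (Discrete J) F) ↔
      ∃ M : Bicomod C D, Nonempty (F ≅ (h M).cotensorFunctor) := by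
  refine ⟨fun ⟨_, _⟩ => exists_iso_cotensorFunctor h F (isTensorial_of_isSemisimpleRing F)
    (preservesCoactFork_of_preservesFiniteLimits hD F), fun ⟨M, ⟨e⟩⟩ => ⟨?_, fun J => ?_⟩⟩
  · have := (h M).cotensorFunctor_preservesFiniteLimits
      IsVonNeumannRegular.of_isSemisimpleRing hD
    exact preservesFiniteLimits_of_natIso e.symm
  · have := (h M).cotensorFunctor_preservesCoproducts J
    exact preservesColimitsOfShape_of_natIso e.symm

theorem exists_iso_cotensorFunctor_iff_of_isVonNeumannRegular [F.Additive] [F.Linear k]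
    (hD : FlatLeft B D.obj) (hA : IsVonNeumannRegular A) :
    (PreservesFiniteLimits F ∧ PreservesFilteredColimits F) ↔
      ∃ M : Bicomod C D, Nonempty (F ≅ (h M).cotensorFunctor) := by
  refine ⟨fun ⟨_, _⟩ => exists_iso_cotensorFunctor h F (isTensorial_of_isVonNeumannRegular F hA)
    (preservesCoactFork_of_preservesFiniteLimits hD F), fun ⟨M, ⟨e⟩⟩ => ⟨?_, ?_⟩⟩
  · have := (h M).cotensorFunctor_preservesFiniteLimits hA hD
    exact preservesFiniteLimits_of_natIso e.symm
  · have := (h M).cotensorFunctor_preservesFilteredColimits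
    exact preservesFilteredColimits_of_natIso e.symm

theorem exists_iso_cotensorFunctor_iff_of_flatLeft [F.Additive] [F.Linear k]
    (hD : FlatLeft B D.obj) :
    ((PreservesFiniteLimits F ∧ PreservesFiniteColimits F) ∧ PreservesColimits F) ↔
      ∃ M : Bicomod C D, M.IsCoflat ∧ Nonempty (F ≅ (h M).cotensorFunctor) := by
  constructor
  · rintro ⟨⟨_, _⟩, _⟩
    obtain ⟨M, ⟨e⟩⟩ := exists_iso_cotensorFunctor h F (isTensorial_of_preservesColimits F)
      (preservesCoactFork_of_preservesFiniteLimits hD F)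
    exact ⟨M, (Bicomod.isCoflat_iff hD M (h M)).2
      ⟨preservesFiniteLimits_of_natIso e, preservesFiniteColimits_of_natIso e⟩, ⟨e⟩⟩
  · rintro ⟨M, hM, ⟨e⟩⟩
    obtain ⟨_, _⟩ := (Bicomod.isCoflat_iff hD M (h M)).1 hM
    have := (h M).cotensorFunctor_preservesColimits
    exact ⟨⟨preservesFiniteLimits_of_natIso e.symm, preservesFiniteColimits_of_natIso e.symm⟩,
      preservesColimits_of_natIso e.symm⟩

/-- The split fork replaces left exactness in the direct implication. In the converse, preservation
of cokernels supplies the coequalizers that a cotensor functor need not preserve. -/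
theorem exists_iso_cotensorFunctor_iff_of_isCoseparable [F.Additive] [F.Linear k]
    (hC : C.IsCoseparable) :
    PreservesColimits F ↔
      (∀ {X Y : RComod C} (f : X ⟶ Y), PreservesColimit (parallelPair f 0) F) ∧
        ∃ M : Bicomod C D, Nonempty (F ≅ (h M).cotensorFunctor) := by
  constructor
  · intro _
    exact ⟨fun _ => inferInstance, exists_iso_cotensorFunctor h F
      (isTensorial_of_preservesColimits F) (preservesCoactFork_of_isCoseparable hC F)⟩
  · rintro ⟨_, M, ⟨e⟩⟩
    have := F.preservesCoequalizers_of_preservesCokernels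
    have (J : Type u) : PreservesColimitsOfShape (Discrete J) F :=
      have := (h M).cotensorFunctor_preservesCoproducts J
      preservesColimitsOfShape_of_natIso e.symm
    exact preservesColimits_of_preservesCoequalizers_and_coproducts F

theorem tfae_isLeftAdjoint_of_trivial (F : RComod (Coring.trivial k A) ⥤ RComod D) [F.Additive]
    [F.Linear k] :
    [F.IsLeftAdjoint,
      PreservesColimits F,
      ∃ M : Bicomod (Coring.trivial k A) D,
        Nonempty (F ≅ RComod.forget (Coring.trivial k A) ⋙ M.tensorFunctor)].TFAE := by
  tfae_have 1 → 2 := fun _ => (Adjunction.ofIsLeftAdjoint F).leftAdjoint_preservesColimits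
  tfae_have 2 → 3 := fun _ => ⟨_, ⟨(isTensorial_of_preservesColimits F).isoTensorFunctor⟩⟩
  tfae_have 3 → 1 := by
    rintro ⟨M, ⟨e⟩⟩
    have := M.tensorFunctor_isLeftAdjoint
    have : (RComod.forget (Coring.trivial k A) ⋙ M.tensorFunctor).IsLeftAdjoint := inferInstance
    exact Functor.isLeftAdjoint_of_iso e.symm
  tfae_finish

end Characterization

end Corings

/-- The functor - □ M into D-comodules is defined from a proof of `HasCotensor`, so each of the
first three parts asserts such a proof for all M before characterizing F. As `HasCotensor` is a
proposition, the functor does not depend on which proof is given. -/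
theorem corollary4 {k : Type u} [CommRing k] {A B : Type u} [Ring A] [Algebra k A] [Ring B]
    [Algebra k B] (C : Coring k A) (D : Coring k B) :
    -- part 1, for semisimple and for von Neumann regular `A`
    (FlatLeft B D.obj →
      ∃ h : ∀ M : Bicomod C D, M.HasCotensor,
        ∀ (F : RComod C ⥤ RComod D) [F.Additive] [F.Linear k],
          (IsSemisimpleRing A →
            ((PreservesFiniteLimits F ∧ ∀ J : Type u, PreservesColimitsOfShape (Discrete J) F) ↔
              ∃ M : Bicomod C D, Nonempty (F ≅ (h M).cotensorFunctor))) ∧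
          (IsVonNeumannRegular A →
            ((PreservesFiniteLimits F ∧ PreservesFilteredColimits F) ↔
              ∃ M : Bicomod C D, Nonempty (F ≅ (h M).cotensorFunctor)))) ∧
    -- part 2
    (FlatLeft A C.obj → FlatLeft B D.obj →
      ∃ h : ∀ M : Bicomod C D, M.HasCotensor,
        ∀ (F : RComod C ⥤ RComod D) [F.Additive] [F.Linear k],
          ((PreservesFiniteLimits F ∧ PreservesFiniteColimits F) ∧ PreservesColimits F) ↔
            ∃ M : Bicomod C D, M.IsCoflat ∧ Nonempty (F ≅ (h M).cotensorFunctor)) ∧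
    -- part 3
    (C.IsCoseparable → IsAbelianCategory (RComod C) → IsAbelianCategory (RComod D) →
      ∃ h : ∀ M : Bicomod C D, M.HasCotensor,
        ∀ (F : RComod C ⥤ RComod D) [F.Additive] [F.Linear k],
          PreservesColimits F ↔
            (∀ {X Y : RComod C} (f : X ⟶ Y), PreservesColimit (parallelPair f 0) F) ∧
              ∃ M : Bicomod C D, Nonempty (F ≅ (h M).cotensorFunctor)) ∧
    -- part 4
    (IsAbelianCategory (RComod D) →
      ∀ (F : RComod (Coring.trivial k A) ⥤ RComod D) [F.Additive] [F.Linear k],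
        [F.IsLeftAdjoint,
          PreservesColimits F,
          ∃ M : Bicomod (Coring.trivial k A) D,
            Nonempty (F ≅ RComod.forget (Coring.trivial k A) ⋙ M.tensorFunctor)].TFAE) := by
  refine ⟨fun hD => ⟨Bicomod.hasCotensor_of_flatLeft hD, fun F _ _ =>
      ⟨exists_iso_cotensorFunctor_iff_of_isSemisimpleRing _ F hD,
        exists_iso_cotensorFunctor_iff_of_isVonNeumannRegular _ F hD⟩⟩,
    fun _ hD => ⟨Bicomod.hasCotensor_of_flatLeft hD, fun F _ _ =>
      exists_iso_cotensorFunctor_iff_of_flatLeft _ F hD⟩,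
    fun hC _ _ => ⟨Bicomod.hasCotensor_of_isCoseparable hC, fun F _ _ =>
      exists_iso_cotensorFunctor_iff_of_isCoseparable _ F hC⟩,
    fun _ F _ _ => tfae_isLeftAdjoint_of_trivial F⟩
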